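/- A colored graph $(G,\varphi)$ is a finite simple undirected graph $G=(V,E)$ together with an arbitrary map $\varphi:V\to\mathbb N$ (not necessarily a proper coloring). Its color classes are the non-empty sets $\varphi^{-1}(c)$. Its cluster graph $G_\varphi$ has the used colors as nodes, and two distinct colors $i,j$ are adjacent when there is an edge $uv\in E$ with $\varphi(u)=i$, $\varphi(v)=j$. A set $S\subseteq V$ is a multicolored realization of $G_\varphi$ if it contains exactly one vertex of each color class and $\varphi|_S$ is an isomorphism from $G[S]$ onto $G_\varphi$. The problem MGR asks, given $(G,\varphi)$, whether $G_\varphi$ has a multicolored realization. The cluster size $\ell$ of $(G,\varphi)$ is the largest number of vertices in a color class. A graph with a bipartition $(X,Y)$ of its vertex set is convex bipartite with ordered part $X$ if $X$ has an ordering in which the neighbours of each vertex of $Y$ are consecutive; its spread $d$ (with respect to $X$) is the maximum degree of the vertices in $Y$ (and $0$ if $Y=\emptyset$). The machine model is the random access machine with unit cost for assignments, additions, (truncated) subtractions, comparisons and indirectly addressed memory accesses. The input consists of $n=|V|$, $|E|$, the colors of the vertices, and a list of the edges, each edge once; its size is the number of machine words it occupies. **Proposition.** MGR, restricted to colored graphs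 $(G,\varphi)$ whose cluster graph is convex bipartite, is in FPT when parameterized by the cluster size $\ell$ and the spread $d$. More precisely, there is one algorithm that receives only $(G,\varphi)$ (neither the parts, nor the ordering, nor $\ell$ and $d$) such that, for every colored graph $(G,\varphi)$ and every choice of the ordered part $X$ for which $G_\varphi$ is convex bipartite, with $d$ the spread with respect to $X$, the algorithm decides correctly whether $G_\varphi$ has a multicolored realization, and 1. it runs in time $f(\ell,d)\cdot N^{c}$, where $N$ is the size of the input, $f$ is a computable function and $c$ is a constant; 2. if $n\ge 1$ and $d\ge 1$, it runs in time $O\big((nd+\ell^2)\,\ell^{d}\big)$, with an absolute constant in the $O$; if $n\ge1$ and $d=0$, this bound holds with $d$ replaced by $1$. -/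

import Mathlib

/-! ### Multicolored graph realization -/

/-- The cluster graph of a colored graph: its nodes are the colors that are used, and two distinct
colors are adjacent when some edge joins their color classes. -/
def clusterGraph {V : Type*} (G : SimpleGraph V) (φ : V → ℕ) : SimpleGraph (Set.range φ) where
  Adj i j := i ≠ j ∧ ∃ u v : V, G.Adj u v ∧ φ u = i ∧ φ v = j
  symm := ⟨by
    rintro i j ⟨hne, u, v, huv, hu, hv⟩
    exact ⟨hne.symm, v, u, huv.symm, hv, hu⟩⟩
  loopless := ⟨fun _ h => h.1 rfl⟩

/-- `S` contains exactly one vertex of each color class. -/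
def IsMulticolored {V : Type*} (φ : V → ℕ) (S : Set V) : Prop :=
  ∀ c ∈ Set.range φ, ∃! u, u ∈ S ∧ φ u = c

/-- `S` is multicolored and `φ` restricted to `S` is an isomorphism from the graph induced by `S`
onto the cluster graph. -/
def IsRealization {V : Type*} (G : SimpleGraph V) (φ : V → ℕ) (S : Set V) : Prop :=
  IsMulticolored φ S ∧
    ∀ u ∈ S, ∀ v ∈ S,
      (G.Adj u v ↔ (clusterGraph G φ).Adj ⟨φ u, Set.mem_range_self u⟩ ⟨φ v, Set.mem_range_self v⟩)

/-- The question asked by the multicolored graph realization problem. -/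
def HasRealization {V : Type*} (G : SimpleGraph V) (φ : V → ℕ) : Prop :=
  ∃ S : Set V, IsRealization G φ S

/-- The largest number of vertices in a color class. -/
def clusterSize {V : Type*} [Fintype V] (φ : V → ℕ) : ℕ :=
  Finset.univ.sup fun v => (Finset.univ.filter fun u => φ u = φ v).card

/-! ### Convex bipartite graphs -/

/-- `H` is bipartite with parts `X` and `Y = Xᶜ`, and `X` has an ordering in which the
neighbours of every vertex of `Y` are consecutive. -/
def IsConvexBipartiteWith {W : Type*} (H : SimpleGraph W) (X : Set W) : Prop :=
  H.IsBipartiteWith X Xᶜ ∧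
    ∃ (α : ℕ) (x : Fin α ≃ X), ∀ y ∈ Xᶜ, ∀ i j k : Fin α, i ≤ j → j ≤ k →
      H.Adj y (x i) → H.Adj y (x k) → H.Adj y (x j)

open Classical in
/-- The maximum degree of the vertices outside the ordered part `X` (zero if there are none). -/
noncomputable def spread {W : Type*} [Fintype W] (H : SimpleGraph W) (X : Set W) : ℕ :=
  (Finset.univ.filter fun y => y ∈ Xᶜ).sup fun y => (H.neighborSet y).ncard

/-! ### Random access machines

A machine has registers and arrays, indexed by constants of the program, so that a program uses
finitely many of both. All cells hold natural numbers, array cells are addressed by registers, and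
every assignment, addition, truncated subtraction, array access and comparison costs one step. There
is no multiplication, so that running times are polynomially related to those of Turing machines. -/

structure RamState where
  reg : ℕ → ℕ
  arr : ℕ → ℕ → ℕ

def RamState.setReg (s : RamState) (x v : ℕ) : RamState :=
  { s with reg := Function.update s.reg x v }

def RamState.setArr (s : RamState) (a i v : ℕ) : RamState :=
  { s with arr := Function.update s.arr a (Function.update (s.arr a) i v) }

inductive RamProgram where
  | skip
  /-- `x := c` for a constant `c` -/
  | const (x c : ℕ)
  /-- `x := y` -/
  | copy (x y : ℕ)
  /-- `x := y + z` -/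
  | plus (x y z : ℕ)
  /-- `x := y - z`, truncated at zero -/
  | minus (x y z : ℕ)
  /-- `x := a[y]` -/
  | fetch (x a y : ℕ)
  /-- `a[x] := y` -/
  | store (a x y : ℕ)
  | seq (P Q : RamProgram)
  /-- `if x < y then P else Q` -/
  | branch (x y : ℕ) (P Q : RamProgram)
  /-- `while x < y do P` -/
  | loop (x y : ℕ) (P : RamProgram)

/-- `RamExec P s t s'`: started in `s`, the program `P` halts in `s'` after `t` steps. -/
inductive RamExec : RamProgram → RamState → ℕ → RamState → Prop
  | skip (s) : RamExec .skip s 1 s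
  | const (s x c) : RamExec (.const x c) s 1 (s.setReg x c)
  | copy (s x y) : RamExec (.copy x y) s 1 (s.setReg x (s.reg y))
  | plus (s x y z) : RamExec (.plus x y z) s 1 (s.setReg x (s.reg y + s.reg z))
  | minus (s x y z) : RamExec (.minus x y z) s 1 (s.setReg x (s.reg y - s.reg z))
  | fetch (s x a y) : RamExec (.fetch x a y) s 1 (s.setReg x (s.arr a (s.reg y)))
  | store (s a x y) : RamExec (.store a x y) s 1 (s.setArr a (s.reg x) (s.reg y))
  | seq {P Q s s₁ s₂ t₁ t₂} (h₁ : RamExec P s t₁ s₁) (h₂ : RamExec Q s₁ t₂ s₂) :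
      RamExec (.seq P Q) s (t₁ + t₂) s₂
  | branch_then {x y P Q s s₁ t} (hlt : s.reg x < s.reg y) (h : RamExec P s t s₁) :
      RamExec (.branch x y P Q) s (t + 1) s₁
  | branch_else {x y P Q s s₁ t} (hge : ¬ s.reg x < s.reg y) (h : RamExec Q s t s₁) :
      RamExec (.branch x y P Q) s (t + 1) s₁
  | loop_stop {x y P s} (hge : ¬ s.reg x < s.reg y) : RamExec (.loop x y P) s 1 s
  | loop_step {x y P s s₁ s₂ t₁ t₂} (hlt : s.reg x < s.reg y) (h₁ : RamExec P s t₁ s₁)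
      (h₂ : RamExec (.loop x y P) s₁ t₂ s₂) : RamExec (.loop x y P) s (t₁ + t₂ + 1) s₂

/-- Started in `s`, the program halts within `T` steps, and register `0` then holds `1` if and only
if `answer` is true. -/
def RamProgram.DecidesWithin (P : RamProgram) (s : RamState) (answer : Prop) (T : ℕ) : Prop :=
  ∃ (t : ℕ) (s' : RamState), RamExec P s t s' ∧ t ≤ T ∧ (s'.reg 0 = 1 ↔ answer)

/-! ### Fixed-parameter tractability -/

/-- A decision problem with two parameters: its instances, their representation in the memory of
a machine, their size, their parameters, and the yes-instances. -/
structure ParamProblem where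
  Inst : Type
  input : Inst → RamState
  size : Inst → ℕ
  param : Inst → ℕ × ℕ
  yes : Inst → Prop

/-- `P` decides the problem in time `f(parameters) * size ^ c` for a computable function `f` and
a constant `c`. -/
def RamProgram.IsFPTAlgorithm (P : RamProgram) (L : ParamProblem) : Prop :=
  ∃ (f : ℕ × ℕ → ℕ) (c : ℕ), Computable f ∧
    ∀ I : L.Inst, P.DecidesWithin (L.input I) (L.yes I) (f (L.param I) * L.size I ^ c)

/-! ### Colored graphs as inputs -/

/-- A colored graph on the vertices `0, …, n - 1` with a list of its edges, each edge occurring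
exactly once, with its ends in either order. -/
structure ColoredGraph where
  n : ℕ
  graph : SimpleGraph (Fin n)
  color : Fin n → ℕ
  edges : List (Fin n × Fin n)
  edges_nodup : (edges.map fun p => s(p.1, p.2)).Nodup
  mem_edges : ∀ e : Sym2 (Fin n), e ∈ edges.map (fun p => s(p.1, p.2)) ↔ e ∈ graph.edgeSet

/-- Registers `0` and `1` hold the numbers of vertices and of edges, array `0` the colors of the
vertices, arrays `1` and `2` the first and the second ends of the edges in the list; all other
cells are zero. -/
def ColoredGraph.toState (I : ColoredGraph) : RamState where
  reg x := if x = 0 then I.n else if x = 1 then I.edges.length else 0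
  arr a i :=
    if a = 0 then (if h : i < I.n then I.color ⟨i, h⟩ else 0)
    else if a = 1 then (if h : i < I.edges.length then ((I.edges[i]'h).1 : ℕ) else 0)
    else if a = 2 then (if h : i < I.edges.length then ((I.edges[i]'h).2 : ℕ) else 0)
    else 0

/-- The number of machine words in the input. -/
def ColoredGraph.size (I : ColoredGraph) : ℕ := 2 + I.n + 2 * I.edges.length

/-- A colored graph whose cluster graph is convex bipartite. The ordered part `X` only serves to
define the spread: it is not part of the input of an algorithm. -/
structure ConvexColoredGraph extends ColoredGraph where
  X : Set (Set.range color)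
  convex : IsConvexBipartiteWith (clusterGraph graph color) X

/-- Cluster size of the colored graph. -/
def ConvexColoredGraph.ell (I : ConvexColoredGraph) : ℕ := clusterSize I.color

/-- Spread of the cluster graph with respect to the ordered part. -/
noncomputable def ConvexColoredGraph.d (I : ConvexColoredGraph) : ℕ :=
  spread (clusterGraph I.graph I.color) I.X

/-- Multicolored graph realization on colored graphs with a convex bipartite cluster graph,
parameterized by the cluster size and the spread. -/
noncomputable def convexMGR : ParamProblem where
  Inst := ConvexColoredGraph
  input I := I.toColoredGraph.toState
  size I := I.toColoredGraph.size
  param I := (I.ell, I.d)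
  yes I := HasRealization I.graph I.color

/-!
A realization selects one vertex from each color class such that the selected vertices of adjacent
classes are adjacent: the selected vertices never have other edges, by the definition of the cluster
graph (`Numbered.hasRealization_iff`). So the question is a binary constraint satisfaction problem
with one variable, of at most `ℓ` values, for each node of the cluster graph `H`. It is solved by
eliminating the variables one after the other. The table of an eliminated node tells which values of
its alive neighbors extend to this node and to the nodes eliminated below it
(`elimination_step`, `ElimInv`).

The order of elimination has to be found without knowing the ordered part `X`. In each component of
`H` the side with the smaller maximum degree supplies the constraint nodes. Let `Y` be the set of
all constraint nodes and `K` their maximum degree. One side of each component lies outside `X`, so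
`K ≤ d`. The nodes of `Y` are eliminated first. This makes any two neighbors of a node of `Y`
dependent on each other; such pairs are added to `H` as fill edges. The remaining nodes, joined by
fill edges, form a chordal graph, whether they lie in `X` or not: among any set of them the first one
in the ordering of `X`, or, if all lie outside `X` and thus are intervals, one with the leftmost
right end, has all its neighbors inside a single neighborhood of a node of `Y`
(`ConvexNodes.exists_peak`). Hence there is always a node to eliminate whose alive neighbors form a
clique, elimination creates no further edges, and cliques have at most `K` nodes
(`ConvexNodes.fillGraph`). Such nodes are found with a stack: a node that fails the test is put back
only when one of its neighbors is eliminated (`elimPhaseX_runs`).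

A constraint node has at most `K` neighbors, so its table has at most `ℓ ^ K` entries, for each of
which all vertices of its class are tried; summed over the classes these are `n` vertices. Any other
node is eliminated when it has fewer than `K` alive neighbors (or none), so that its table needs
at most `ℓ ^ max K 1` trials. All tables are therefore computed in time `O(n d ℓ ^ d)` if `d ≥ 1`.
The fill edges add at most `2 d ^ 2` neighbors to a node
(`ConvexNodes.card_share_le`), and the search for simplicial nodes costs a polynomial in `d` for
each node, which is absorbed by `2 ^ d ≤ ℓ ^ d` (`pow_five_le`, `mainPhase_time`). If `ℓ = 1` this
estimate fails, but then the answer is always yes. The number of edges is at most `n (d + 1) ℓ`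
(`card_edges_le`), so reading them is no obstacle.

The algorithm is written in a small language with named variables and arrays, whose time-annotated
semantics is carried over to the machine by compilation (`Cmd.comp_exec_aux`). The time bounds and
the correctness are derived together with Hoare-style rules for total correctness (`Runs`,
`Runs.loop`).
-/

/-! ### A structured language over the random access machine -/

/-- Scalar variables of the structured language; the variable with constructor index `k` lives in
register `k`. In particular `vN` and `vM` hold the numbers of vertices and of edges, and the answer
is returned in `vN`. -/
inductive Var
  | vN | vM | vQ | vEll | vK | vI | vJ | vC | vU | vW | vA | vB | vX | vY | vZ | vT | vS | vR
  | vV | vTop | vAns | vBad | vLen | vOk | vFound | vCode | vH | vP | vAcc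
deriving DecidableEq

/-- Array variables of the structured language; the first three are the input arrays. Later `aMem`
and `aSz` hold the color classes, `aGadj` the adjacency matrix of the graph, `aFn` and `aFl` the
neighbor lists of the cluster graph with its fill edges, `aFadj` their adjacency matrix, `aY` the
constraint nodes, `aDead` the eliminated nodes, `aUp` and `aUpl` the lists of their neighbors alive
at the elimination, `aTab` their tables, and `aCl` marks the tables that have been used. -/
inductive Arr
  | aColor | aEu | aEv | aRow | aLab | aCid | aMem | aSz | aGadj | aFadj | aFn | aFl | aHl
  | aSd | aSp | aStk | aDm | aY | aPw | aRem | aQuot | aMul | aTb | aTab | aDead | aCl | aUp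
  | aUpl | aCh | aCur
deriving DecidableEq

open Var Arr

/-- States of the structured language. -/
structure St where
  v : Var → ℕ
  a : Arr → ℕ → ℕ

/-- Assignment to a variable. -/
def St.set (s : St) (x : Var) (k : ℕ) : St := { s with v := Function.update s.v x k }

/-- Assignment to an array cell. -/
def St.put (s : St) (b : Arr) (i k : ℕ) : St :=
  { s with a := Function.update s.a b (Function.update (s.a b) i k) }

@[simp] theorem St.set_v (s : St) (x y : Var) (k : ℕ) :
    (s.set x k).v y = if y = x then k else s.v y := by
  simp [St.set, Function.update_apply]

@[simp] theorem St.set_a (s : St) (x : Var) (k : ℕ) : (s.set x k).a = s.a := rfl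

@[simp] theorem St.put_v (s : St) (b : Arr) (i k : ℕ) : (s.put b i k).v = s.v := rfl

@[simp] theorem St.put_a (s : St) (b c : Arr) (i k : ℕ) :
    (s.put b i k).a c = if c = b then Function.update (s.a b) i k else s.a c := by
  simp [St.put, Function.update_apply]

/-- Expressions: literals, variables, sums, truncated differences, array accesses. -/
inductive AExp
  | lit (k : ℕ)
  | var (x : Var)
  | add (e f : AExp)
  | sub (e f : AExp)
  | get (b : Arr) (e : AExp)

prefix:max "↟" => AExp.var
infixl:65 " +ₑ " => AExp.add
infixl:65 " -ₑ " => AExp.sub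
notation:max b "⟪" e "⟫" => AExp.get b e

@[simp] def AExp.eval (s : St) : AExp → ℕ
  | .lit k => k
  | .var x => s.v x
  | .add e f => e.eval s + f.eval s
  | .sub e f => e.eval s - f.eval s
  | .get b e => s.a b (e.eval s)

/-- Number of machine steps for evaluating an expression. -/
@[simp] def AExp.cost : AExp → ℕ
  | .lit _ => 1
  | .var _ => 1
  | .add e f => e.cost + f.cost + 1
  | .sub e f => e.cost + f.cost + 1
  | .get _ e => e.cost + 1

/-- Commands of the structured language; `ite e f` and `loop e f` test whether `e < f`. -/
inductive Cmd
  | skip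
  | set (x : Var) (e : AExp)
  | put (b : Arr) (e f : AExp)
  | seq (c d : Cmd)
  | ite (e f : AExp) (c d : Cmd)
  | loop (e f : AExp) (c : Cmd)

infixr:60 " ;; " => Cmd.seq

/-- `for i = e, …, f - 1 do c` -/
def Cmd.for (i : Var) (e f : AExp) (c : Cmd) : Cmd :=
  .set i e ;; .loop ↟i f (c ;; .set i (↟i +ₑ .lit 1))

/-- Big-step semantics of commands, with the number of machine steps. -/
inductive Exec : Cmd → St → ℕ → St → Prop
  | skip (s) : Exec .skip s 1 s
  | set (s x e) : Exec (.set x e) s (e.cost + 1) (s.set x (e.eval s))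
  | put (s b e f) : Exec (.put b e f) s (e.cost + f.cost + 1) (s.put b (e.eval s) (f.eval s))
  | seq {c d s s₁ s₂ t₁ t₂} (h₁ : Exec c s t₁ s₁) (h₂ : Exec d s₁ t₂ s₂) :
      Exec (.seq c d) s (t₁ + t₂) s₂
  | ite_then {e f c d s s₁ t} (hlt : e.eval s < f.eval s) (h : Exec c s t s₁) :
      Exec (.ite e f c d) s (t + (e.cost + f.cost + 1)) s₁
  | ite_else {e f c d s s₁ t} (hge : ¬ e.eval s < f.eval s) (h : Exec d s t s₁) :
      Exec (.ite e f c d) s (t + (e.cost + f.cost + 1)) s₁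
  | loop_exit {e f c s} (hge : ¬ e.eval s < f.eval s) :
      Exec (.loop e f c) s (e.cost + f.cost + 1) s
  | loop_step {e f c s s₁ s₂ t₁ t₂} (hlt : e.eval s < f.eval s) (h₁ : Exec c s t₁ s₁)
      (h₂ : Exec (.loop e f c) s₁ t₂ s₂) :
      Exec (.loop e f c) s (t₁ + (e.cost + f.cost + 1) + t₂) s₂

/-! ### Compilation -/

/-- Evaluates the expression into register `k`, using the registers from `k` on. -/
def AExp.comp (k : ℕ) : AExp → RamProgram
  | .lit c => .const k c
  | .var x => .copy k x.ctorIdx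
  | .add e f => .seq (e.comp k) (.seq (f.comp (k + 1)) (.plus k k (k + 1)))
  | .sub e f => .seq (e.comp k) (.seq (f.comp (k + 1)) (.minus k k (k + 1)))
  | .get b e => .seq (e.comp k) (.fetch k b.ctorIdx k)

/-- Compilation of commands. The registers from `100` on are temporary. A loop evaluates the two
sides of its test before the loop and again at the end of its body. -/
def Cmd.comp : Cmd → RamProgram
  | .skip => .skip
  | .set x e => .seq (e.comp 100) (.copy x.ctorIdx 100)
  | .put b e f => .seq (e.comp 100) (.seq (f.comp 101) (.store b.ctorIdx 100 101))
  | .seq c d => .seq c.comp d.comp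
  | .ite e f c d => .seq (e.comp 100) (.seq (f.comp 101) (.branch 100 101 c.comp d.comp))
  | .loop e f c => .seq (e.comp 100) (.seq (f.comp 101)
      (.loop 100 101 (.seq c.comp (.seq (e.comp 100) (f.comp 101)))))

/-- The machine state `r` represents `s`. -/
def Represents (s : St) (r : RamState) : Prop :=
  (∀ x : Var, r.reg x.ctorIdx = s.v x) ∧ ∀ b : Arr, r.arr b.ctorIdx = s.a b

theorem Var.ctorIdx_lt (x : Var) : x.ctorIdx < 100 := by cases x <;> decide

theorem Var.ctorIdx_inj {x y : Var} (h : x.ctorIdx = y.ctorIdx) : x = y := by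
  rw [← Var.ofNat_ctorIdx x, ← Var.ofNat_ctorIdx y, h]

theorem Arr.ctorIdx_inj {x y : Arr} (h : x.ctorIdx = y.ctorIdx) : x = y := by
  rw [← Arr.ofNat_ctorIdx x, ← Arr.ofNat_ctorIdx y, h]

theorem RamExec.cast {P : RamProgram} {r r' : RamState} {t t' : ℕ} (h : RamExec P r t r')
    (ht : t = t') : RamExec P r t' r' := ht ▸ h

/-- A compiled expression leaves the registers below `k` alone, so that operands computed earlier
survive. -/
theorem AExp.comp_exec (e : AExp) {s : St} : ∀ {k : ℕ} {r : RamState}, 100 ≤ k →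
    Represents s r → ∃ r', RamExec (e.comp k) r e.cost r' ∧ r'.reg k = e.eval s ∧
      (∀ y < k, r'.reg y = r.reg y) ∧ r'.arr = r.arr := by
  have keep : ∀ {k : ℕ} {r r' : RamState}, 100 ≤ k → Represents s r →
      (∀ y < k, r'.reg y = r.reg y) → r'.arr = r.arr → Represents s r' := by
    intro k r r' hk hr h₁ h₂
    exact ⟨fun x => (h₁ _ (x.ctorIdx_lt.trans_le hk)).trans (hr.1 x), fun b => h₂ ▸ hr.2 b⟩
  induction e with
  | lit c =>
    intro k r hk hr
    refine ⟨_, RamExec.const r k c, ?_, ?_, rfl⟩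
    · simp [RamState.setReg]
    · intro y hy; simp [RamState.setReg, Function.update_of_ne hy.ne]
  | var x =>
    intro k r hk hr
    refine ⟨_, RamExec.copy r k x.ctorIdx, ?_, ?_, rfl⟩
    · simp [RamState.setReg, hr.1 x]
    · intro y hy; simp [RamState.setReg, Function.update_of_ne hy.ne]
  | add e f he hf =>
    intro k r hk hr
    obtain ⟨r₁, h₁, v₁, o₁, a₁⟩ := he hk hr
    obtain ⟨r₂, h₂, v₂, o₂, a₂⟩ := hf (by omega : 100 ≤ k + 1) (keep hk hr o₁ a₁)
    refine ⟨_, (RamExec.seq h₁ (.seq h₂ (.plus r₂ k k (k + 1)))).cast (add_assoc _ _ _).symm, ?_, ?_,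
      a₂.trans a₁⟩
    · simp [RamState.setReg, v₂, o₂ k (by omega), v₁]
    · intro y hy
      simp [RamState.setReg, Function.update_of_ne hy.ne, o₂ y (by omega), o₁ y hy]
  | sub e f he hf =>
    intro k r hk hr
    obtain ⟨r₁, h₁, v₁, o₁, a₁⟩ := he hk hr
    obtain ⟨r₂, h₂, v₂, o₂, a₂⟩ := hf (by omega : 100 ≤ k + 1) (keep hk hr o₁ a₁)
    refine ⟨_, (RamExec.seq h₁ (.seq h₂ (.minus r₂ k k (k + 1)))).cast (add_assoc _ _ _).symm,
      ?_, ?_, a₂.trans a₁⟩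
    · simp [RamState.setReg, v₂, o₂ k (by omega), v₁]
    · intro y hy
      simp [RamState.setReg, Function.update_of_ne hy.ne, o₂ y (by omega), o₁ y hy]
  | get b e he =>
    intro k r hk hr
    obtain ⟨r₁, h₁, v₁, o₁, a₁⟩ := he hk hr
    refine ⟨_, .seq h₁ (.fetch r₁ k b.ctorIdx k), ?_, ?_, a₁⟩
    · simp [RamState.setReg, v₁, a₁, hr.2 b]
    · intro y hy
      simp [RamState.setReg, Function.update_of_ne hy.ne, o₁ y hy]

theorem AExp.comp_exec_pair (e f : AExp) {s : St} {r : RamState} (hr : Represents s r) :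
    ∃ r₁ r₂, RamExec (e.comp 100) r e.cost r₁ ∧ RamExec (f.comp 101) r₁ f.cost r₂ ∧
      r₂.reg 100 = e.eval s ∧ r₂.reg 101 = f.eval s ∧ Represents s r₂ := by
  obtain ⟨r₁, h₁, v₁, o₁, a₁⟩ := e.comp_exec le_rfl hr
  have hr₁ : Represents s r₁ :=
    ⟨fun x => (o₁ _ x.ctorIdx_lt).trans (hr.1 x), fun b => a₁ ▸ hr.2 b⟩
  obtain ⟨r₂, h₂, v₂, o₂, a₂⟩ := f.comp_exec (by norm_num : 100 ≤ 101) hr₁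
  exact ⟨r₁, r₂, h₁, h₂, (o₂ _ (by norm_num)).trans v₁, v₂,
    ⟨fun x => (o₂ _ (x.ctorIdx_lt.trans (by norm_num))).trans (hr₁.1 x), fun b => a₂ ▸ hr₁.2 b⟩⟩

/-- The compiled command behaves as the command, with the same number of steps. For a loop the
induction speaks about the machine loop after its test has been evaluated, whence the second
clause. -/
theorem Cmd.comp_exec_aux {c : Cmd} {s s' : St} {t : ℕ} (h : Exec c s t s') :
    (∀ r, Represents s r → ∃ r', RamExec c.comp r t r' ∧ Represents s' r') ∧
    ∀ e f d, c = .loop e f d → ∀ r, Represents s r → r.reg 100 = e.eval s →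
      r.reg 101 = f.eval s → ∃ r' t', RamExec (.loop 100 101
        (.seq d.comp (.seq (e.comp 100) (f.comp 101)))) r t' r' ∧
        t = t' + (e.cost + f.cost) ∧ Represents s' r' := by
  induction h with
  | skip s =>
    exact ⟨fun r hr => ⟨r, .skip r, hr⟩, by intro e f d h; cases h⟩
  | set s x e =>
    refine ⟨fun r hr => ?_, by intro e f d h; cases h⟩
    obtain ⟨r₁, h₁, v₁, o₁, a₁⟩ := e.comp_exec le_rfl hr
    refine ⟨_, .seq h₁ (.copy r₁ x.ctorIdx 100), fun y => ?_, fun b => ?_⟩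
    · by_cases hy : y = x
      · subst hy; simp [RamState.setReg, v₁]
      · have : y.ctorIdx ≠ x.ctorIdx := fun h => hy (Var.ctorIdx_inj h)
        simp [RamState.setReg, Function.update_of_ne this, hy, o₁ _ y.ctorIdx_lt, hr.1 y]
    · simp [RamState.setReg, a₁, hr.2 b]
  | put s b e f =>
    refine ⟨fun r hr => ?_, by intro e f d h; cases h⟩
    obtain ⟨r₁, r₂, h₁, h₂, v₁, v₂, hr₂⟩ := e.comp_exec_pair f hr
    refine ⟨_, (RamExec.seq h₁ (.seq h₂ (.store r₂ b.ctorIdx 100 101))).cast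
      (add_assoc _ _ _).symm,
      fun y => ?_, fun b' => ?_⟩
    · simp [RamState.setArr, hr₂.1 y]
    · by_cases hb : b' = b
      · subst hb; simp [RamState.setArr, v₁, v₂, hr₂.2 b']
      · have : b'.ctorIdx ≠ b.ctorIdx := fun h => hb (Arr.ctorIdx_inj h)
        simp [RamState.setArr, Function.update_of_ne this, hb, hr₂.2 b']
  | seq h₁ h₂ ih₁ ih₂ =>
    refine ⟨fun r hr => ?_, by intro e f d h; cases h⟩
    obtain ⟨r₁, e₁, hr₁⟩ := ih₁.1 r hr
    obtain ⟨r₂, e₂, hr₂⟩ := ih₂.1 r₁ hr₁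
    exact ⟨r₂, .seq e₁ e₂, hr₂⟩
  | @ite_then e f c d s s₁ t hlt h ih =>
    refine ⟨fun r hr => ?_, by intro e f d h; cases h⟩
    obtain ⟨r₁, r₂, h₁, h₂, v₁, v₂, hr₂⟩ := e.comp_exec_pair f hr
    obtain ⟨r₃, h₃, hr₃⟩ := ih.1 r₂ hr₂
    have := RamExec.seq h₁ (.seq h₂
      (.branch_then (x := 100) (y := 101) (Q := d.comp) (by rwa [v₁, v₂]) h₃))
    exact ⟨r₃, this.cast (by omega), hr₃⟩
  | @ite_else e f c d s s₁ t hge h ih =>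
    refine ⟨fun r hr => ?_, by intro e f d h; cases h⟩
    obtain ⟨r₁, r₂, h₁, h₂, v₁, v₂, hr₂⟩ := e.comp_exec_pair f hr
    obtain ⟨r₃, h₃, hr₃⟩ := ih.1 r₂ hr₂
    have := RamExec.seq h₁ (.seq h₂
      (.branch_else (x := 100) (y := 101) (P := c.comp) (by rwa [v₁, v₂]) h₃))
    exact ⟨r₃, this.cast (by omega), hr₃⟩
  | @loop_exit e f c s hge =>
    constructor
    · intro r hr
      obtain ⟨r₁, r₂, h₁, h₂, v₁, v₂, hr₂⟩ := e.comp_exec_pair f hr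
      have := RamExec.seq h₁ (.seq h₂ (RamExec.loop_stop (x := 100) (y := 101)
        (P := .seq c.comp (.seq (e.comp 100) (f.comp 101))) (by rwa [v₁, v₂])))
      exact ⟨r₂, this.cast (by omega), hr₂⟩
    · intro e' f' d h r hr v₁ v₂
      cases h
      exact ⟨r, 1, RamExec.loop_stop (by rwa [v₁, v₂]), by omega, hr⟩
  | @loop_step e f c s s₁ s₂ t₁ t₂ hlt h₁ h₂ ih₁ ih₂ =>
    have key : ∀ r, Represents s r → r.reg 100 = e.eval s → r.reg 101 = f.eval s →
        ∃ r' t', RamExec (.loop 100 101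
          (.seq c.comp (.seq (e.comp 100) (f.comp 101)))) r t' r' ∧
          t₁ + (e.cost + f.cost + 1) + t₂ = t' + (e.cost + f.cost) ∧ Represents s₂ r' := by
      intro r hr v₁ v₂
      obtain ⟨r₁, e₁, hr₁⟩ := ih₁.1 r hr
      obtain ⟨r₂, r₃, e₂, e₃, w₁, w₂, hr₃⟩ := e.comp_exec_pair f hr₁
      obtain ⟨r₄, t', e₄, ht', hr₄⟩ := ih₂.2 e f c rfl r₃ hr₃ w₁ w₂
      exact ⟨r₄, _, .loop_step (by rwa [v₁, v₂]) (.seq e₁ (.seq e₂ e₃)) e₄, by omega, hr₄⟩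
    constructor
    · intro r hr
      obtain ⟨r₁, r₂, h₁, h₂, v₁, v₂, hr₂⟩ := e.comp_exec_pair f hr
      obtain ⟨r', t', h₃, ht', hr'⟩ := key r₂ hr₂ v₁ v₂
      have := RamExec.seq h₁ (.seq h₂ h₃)
      exact ⟨r', this.cast (by omega), hr'⟩
    · intro e' f' d h r hr v₁ v₂
      cases h
      exact key r hr v₁ v₂

/-! ### Total correctness with running times -/

/-- Started in `s`, the command halts in a state and after a number of steps that satisfy `Q`. -/
def Runs (c : Cmd) (s : St) (Q : St → ℕ → Prop) : Prop :=
  ∃ t s', Exec c s t s' ∧ Q s' t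

theorem Runs.mono {c : Cmd} {s : St} {Q Q' : St → ℕ → Prop} (h : Runs c s Q)
    (hQ : ∀ s' t, Q s' t → Q' s' t) : Runs c s Q' := by
  obtain ⟨t, s', he, hq⟩ := h
  exact ⟨t, s', he, hQ _ _ hq⟩

@[simp] theorem runs_skip {s : St} {Q : St → ℕ → Prop} : Runs .skip s Q ↔ Q s 1 := by
  constructor
  · rintro ⟨_, _, ⟨⟩, h⟩; exact h
  · exact fun h => ⟨_, _, .skip s, h⟩

@[simp] theorem runs_set {s : St} {Q : St → ℕ → Prop} {x : Var} {e : AExp} :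
    Runs (.set x e) s Q ↔ Q (s.set x (e.eval s)) (e.cost + 1) := by
  constructor
  · rintro ⟨_, _, ⟨⟩, h⟩; exact h
  · exact fun h => ⟨_, _, .set s x e, h⟩

@[simp] theorem runs_put {s : St} {Q : St → ℕ → Prop} {b : Arr} {e f : AExp} :
    Runs (.put b e f) s Q ↔ Q (s.put b (e.eval s) (f.eval s)) (e.cost + f.cost + 1) := by
  constructor
  · rintro ⟨_, _, ⟨⟩, h⟩; exact h
  · exact fun h => ⟨_, _, .put s b e f, h⟩

@[simp] theorem runs_seq {s : St} {Q : St → ℕ → Prop} {c d : Cmd} :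
    Runs (.seq c d) s Q ↔ Runs c s (fun s₁ t₁ => Runs d s₁ (fun s₂ t₂ => Q s₂ (t₁ + t₂))) := by
  constructor
  · rintro ⟨_, _, h, hq⟩
    cases h with
    | seq h₁ h₂ => exact ⟨_, _, h₁, _, _, h₂, hq⟩
  · rintro ⟨_, _, h₁, _, _, h₂, hq⟩
    exact ⟨_, _, .seq h₁ h₂, hq⟩

theorem runs_ite {s : St} {Q : St → ℕ → Prop} {e f : AExp} {c d : Cmd} :
    Runs (.ite e f c d) s Q ↔
      (e.eval s < f.eval s → Runs c s (fun s' t => Q s' (t + (e.cost + f.cost + 1)))) ∧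
      (¬ e.eval s < f.eval s → Runs d s (fun s' t => Q s' (t + (e.cost + f.cost + 1)))) := by
  constructor
  · rintro ⟨_, _, h, hq⟩
    cases h with
    | ite_then hlt h => exact ⟨fun _ => ⟨_, _, h, hq⟩, fun hn => absurd hlt hn⟩
    | ite_else hge h => exact ⟨fun hlt => absurd hlt hge, fun _ => ⟨_, _, h, hq⟩⟩
  · rintro ⟨h₁, h₂⟩
    by_cases hlt : e.eval s < f.eval s
    · obtain ⟨_, _, h, hq⟩ := h₁ hlt
      exact ⟨_, _, .ite_then hlt h, hq⟩
    · obtain ⟨_, _, h, hq⟩ := h₂ hlt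
      exact ⟨_, _, .ite_else hlt h, hq⟩

/-- Whether a command may write to a variable. -/
def Cmd.wv : Cmd → Var → Bool
  | .skip, _ => false
  | .set x _, y => y = x
  | .put _ _ _, _ => false
  | .seq c d, y => c.wv y || d.wv y
  | .ite _ _ c d, y => c.wv y || d.wv y
  | .loop _ _ c, y => c.wv y

/-- Whether a command may write to an array. -/
def Cmd.wa : Cmd → Arr → Bool
  | .skip, _ => false
  | .set _ _, _ => false
  | .put b _ _, b' => b' = b
  | .seq c d, b => c.wa b || d.wa b
  | .ite _ _ c d, b => c.wa b || d.wa b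
  | .loop _ _ c, b => c.wa b

/-- Outside the variables and arrays that `c` may write to, the two states agree. -/
def Agree (c : Cmd) (s s' : St) : Prop :=
  (∀ x, c.wv x = false → s'.v x = s.v x) ∧ ∀ b, c.wa b = false → s'.a b = s.a b

theorem Agree.refl (c : Cmd) (s : St) : Agree c s s := ⟨fun _ _ => rfl, fun _ _ => rfl⟩

theorem Agree.trans {c : Cmd} {s s₁ s₂ : St} (h₁ : Agree c s s₁) (h₂ : Agree c s₁ s₂) :
    Agree c s s₂ :=
  ⟨fun x hx => (h₂.1 x hx).trans (h₁.1 x hx), fun b hb => (h₂.2 b hb).trans (h₁.2 b hb)⟩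

theorem Agree.of_le {c d : Cmd} {s s' : St} (h : Agree c s s')
    (hv : ∀ x, d.wv x = false → c.wv x = false) (ha : ∀ b, d.wa b = false → c.wa b = false) :
    Agree d s s' :=
  ⟨fun x hx => h.1 x (hv x hx), fun b hb => h.2 b (ha b hb)⟩

theorem Exec.agree {c : Cmd} {s s' : St} {t : ℕ} (h : Exec c s t s') : Agree c s s' := by
  induction h with
  | skip s => exact Agree.refl _ _
  | set s x e => exact ⟨fun y hy => by simp_all [Cmd.wv], fun _ _ => rfl⟩
  | put s b e f => exact ⟨fun _ _ => rfl, fun y hy => by simp_all [Cmd.wa]⟩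
  | seq _ _ ih₁ ih₂ =>
    exact (ih₁.of_le (by simp_all [Cmd.wv]) (by simp_all [Cmd.wa])).trans
      (ih₂.of_le (by simp_all [Cmd.wv]) (by simp_all [Cmd.wa]))
  | ite_then _ _ ih => exact ih.of_le (by simp_all [Cmd.wv]) (by simp_all [Cmd.wa])
  | ite_else _ _ ih => exact ih.of_le (by simp_all [Cmd.wv]) (by simp_all [Cmd.wa])
  | loop_exit _ => exact Agree.refl _ _
  | loop_step _ _ _ ih₁ ih₂ =>
    exact (ih₁.of_le (by simp_all [Cmd.wv]) (by simp_all [Cmd.wa])).trans ih₂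

/-- A command leaves alone what it does not write to. -/
theorem Runs.frame {c : Cmd} {s : St} {Q : St → ℕ → Prop} (h : Runs c s Q) :
    Runs c s (fun s' t => Agree c s s' ∧ Q s' t) := by
  obtain ⟨t, s', he, hq⟩ := h
  exact ⟨t, s', he, he.agree, hq⟩

/-- The frame condition may be assumed of the final state. -/
theorem Runs.of_agree {c : Cmd} {s : St} {Q : St → ℕ → Prop}
    (h : Runs c s (fun s' t => Agree c s s' → Q s' t)) : Runs c s Q :=
  h.frame.mono fun _ _ h => h.2 h.1

/-- The rule for loops: an invariant that also speaks about the time spent so far, and a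
decreasing measure. -/
theorem Runs.loop {e f : AExp} {c : Cmd} {s : St} {Q : St → ℕ → Prop}
    (Inv : St → ℕ → Prop) (μ : St → ℕ) (h0 : Inv s 0)
    (step : ∀ s' T, Agree c s s' → Inv s' T → e.eval s' < f.eval s' →
      Runs c s' (fun s'' t => Inv s'' (T + (t + (e.cost + f.cost + 1))) ∧ μ s'' < μ s'))
    (post : ∀ s' T, Agree c s s' → Inv s' T → ¬ e.eval s' < f.eval s' →
      Q s' (T + (e.cost + f.cost + 1))) :
    Runs (.loop e f c) s Q := by
  have key : ∀ (k : ℕ) (s' : St) (T : ℕ), μ s' < k → Agree c s s' → Inv s' T →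
      Runs (.loop e f c) s' (fun s'' t => Q s'' (T + t)) := by
    intro k
    induction k with
    | zero => intro s' T hk; omega
    | succ k ih =>
      intro s' T hk ha hI
      by_cases hlt : e.eval s' < f.eval s'
      · obtain ⟨t, s₁, h₁, ha₁, hI₁, hμ⟩ := (step s' T ha hI hlt).frame
        obtain ⟨t₂, s₂, h₂, hq⟩ := ih s₁ _ (by omega) (ha.trans ha₁) hI₁
        exact ⟨_, s₂, .loop_step hlt h₁ h₂, by convert hq using 1; omega⟩
      · exact ⟨_, s', .loop_exit hlt, post s' T ha hI hlt⟩
  have := key (μ s + 1) s 0 (by omega) (Agree.refl _ _) h0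
  simpa using this

/-- The rule for counting loops with an invariant that speaks about the time spent so far. -/
theorem Runs.forT {i : Var} {e f : AExp} {c : Cmd} {s : St} {Q : St → ℕ → Prop}
    (Inv : ℕ → St → ℕ → Prop) (l u : ℕ) (hlu : l ≤ u) (hi : c.wv i = false)
    (hl : e.eval s = l)
    (hu : ∀ k s' T, Agree (.for i e f c) s s' → Inv k s' T → f.eval s' = u)
    (h0 : Inv l (s.set i l) (e.cost + 1))
    (step : ∀ k s' T, l ≤ k → k < u → Agree (.for i e f c) s s' → s'.v i = k → Inv k s' T →
      Runs c s' (fun s'' t => Inv (k + 1) (s''.set i (k + 1)) (T + t + (f.cost + 6))))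
    (post : ∀ s' T, Agree (.for i e f c) s s' → s'.v i = u → Inv u s' T →
      Q s' (T + (f.cost + 2))) :
    Runs (.for i e f c) s Q := by
  have hagree : ∀ s', Agree (c ;; .set i (↟i +ₑ .lit 1)) (s.set i l) s' →
      Agree (.for i e f c) s s' := by
    intro s' h
    constructor
    · intro x hx
      simp only [Cmd.for, Cmd.wv, Bool.or_eq_false_iff, decide_eq_false_iff_not] at hx
      rw [h.1 x (by simp [Cmd.wv, hx])]
      simp [hx.1]
    · intro b hb
      rw [h.2 b (by simpa [Cmd.for, Cmd.wa] using hb)]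
      rfl
  unfold Cmd.for
  rw [runs_seq, runs_set, hl]
  refine Runs.loop (fun s' T => ∃ k, l ≤ k ∧ k ≤ u ∧ s'.v i = k ∧ Inv k s' (T + (e.cost + 1)))
    (fun s' => u - s'.v i) ⟨l, le_rfl, hlu, by simp, by simpa using h0⟩ ?_ ?_
  · rintro s' T ha ⟨k, hk, hku, hik, hI⟩ hlt
    have hf := hu k s' _ (hagree s' ha) hI
    simp only [AExp.eval, hik, hf] at hlt
    rw [runs_seq]
    refine (step k s' _ hk hlt (hagree s' ha) hik hI).frame.mono ?_
    rintro s'' t ⟨hc, hI'⟩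
    have : s''.v i = k := (hc.1 i hi).trans hik
    simp only [runs_set, AExp.eval, this, AExp.cost]
    refine ⟨⟨k + 1, by omega, by omega, by simp, ?_⟩, by simp [hik]; omega⟩
    convert hI' using 1
    omega
  · rintro s' T ha ⟨k, hk, hku, hik, hI⟩ hlt
    have hf := hu k s' _ (hagree s' ha) hI
    simp only [AExp.eval, hik, hf, not_lt] at hlt
    obtain rfl : k = u := le_antisymm hku hlt
    have := post s' _ (hagree s' ha) hik hI
    simp only [AExp.cost]
    convert this using 1
    omega

/-- The rule for counting loops whose body takes at most `B` steps. -/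
theorem Runs.forB {i : Var} {e f : AExp} {c : Cmd} {s : St} {Q : St → ℕ → Prop}
    (Inv : ℕ → St → Prop) (l u B : ℕ) (hlu : l ≤ u) (hi : c.wv i = false)
    (hl : e.eval s = l)
    (hu : ∀ k s', Agree (.for i e f c) s s' → Inv k s' → f.eval s' = u)
    (h0 : Inv l (s.set i l))
    (step : ∀ k s', l ≤ k → k < u → Agree (.for i e f c) s s' → s'.v i = k → Inv k s' →
      Runs c s' (fun s'' t => Inv (k + 1) (s''.set i (k + 1)) ∧ t ≤ B))
    (post : ∀ s' T, Agree (.for i e f c) s s' → s'.v i = u → Inv u s' →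
      T ≤ (u - l) * (B + (f.cost + 6)) + (e.cost + f.cost + 3) → Q s' T) :
    Runs (.for i e f c) s Q := by
  refine Runs.forT (fun k s' T => Inv k s' ∧ T ≤ (k - l) * (B + (f.cost + 6)) + (e.cost + 1))
    l u hlu hi hl (fun k s' T ha h => hu k s' ha h.1) ⟨h0, by simp⟩ ?_ ?_
  · rintro k s' T hk hku ha hik ⟨hI, hT⟩
    refine (step k s' hk hku ha hik hI).mono ?_
    rintro s'' t ⟨hI', ht⟩
    refine ⟨hI', ?_⟩
    have : k + 1 - l = k - l + 1 := by omega
    rw [this, add_mul]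
    omega
  · rintro s' T ha hiu ⟨hI, hT⟩
    exact post s' _ ha hiu hI (by omega)

/-! ### The algorithm -/

/-- `if e < f then c` -/
def Cmd.when (e f : AExp) (c : Cmd) : Cmd := .ite e f c .skip

/-- Numbers the colors that occur and collects the vertices of each color class. Two-dimensional
arrays have rows of length `n`; `aRow` holds the multiples of `n`. -/
def classPhase : Cmd :=
  .for vI (.lit 0) ↟vN
    (.put aRow ↟vI ↟vAcc ;;
     .set vAcc (↟vAcc +ₑ ↟vN) ;;
     .set vC (aColor⟪↟vI⟫) ;;
     .when (aLab⟪↟vC⟫) (.lit 1) (.set vQ (↟vQ +ₑ .lit 1) ;; .put aLab ↟vC ↟vQ) ;;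
     .set vC (aLab⟪↟vC⟫ -ₑ .lit 1) ;;
     .put aCid ↟vI ↟vC ;;
     .put aMem (aRow⟪↟vC⟫ +ₑ aSz⟪↟vC⟫) ↟vI ;;
     .put aSz ↟vC (aSz⟪↟vC⟫ +ₑ .lit 1) ;;
     .when ↟vEll (aSz⟪↟vC⟫) (.set vEll (aSz⟪↟vC⟫)))

/-- Appends `y` to the neighbor list of `x`, unless it is there already. -/
def addNbr (x y : Var) : Cmd :=
  .when (aFadj⟪aRow⟪↟x⟫ +ₑ ↟y⟫) (.lit 1)
    (.put aFadj (aRow⟪↟x⟫ +ₑ ↟y) (.lit 1) ;;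
     .put aFn (aRow⟪↟x⟫ +ₑ aFl⟪↟x⟫) ↟y ;;
     .put aFl ↟x (aFl⟪↟x⟫ +ₑ .lit 1))

/-- Builds the adjacency matrix of the graph and the neighbor lists of the cluster graph. -/
def edgePhase : Cmd :=
  .for vI (.lit 0) ↟vM
    (.set vU (aEu⟪↟vI⟫) ;; .set vW (aEv⟪↟vI⟫) ;;
     .put aGadj (aRow⟪↟vU⟫ +ₑ ↟vW) (.lit 1) ;;
     .put aGadj (aRow⟪↟vW⟫ +ₑ ↟vU) (.lit 1) ;;
     .set vA (aCid⟪↟vU⟫) ;; .set vB (aCid⟪↟vW⟫) ;;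
     .when (.lit 0) ((↟vA -ₑ ↟vB) +ₑ (↟vB -ₑ ↟vA)) (addNbr vA vB ;; addNbr vB vA))

/-- Visits the neighbors of the node `vC`. -/
def visitNbrs : Cmd :=
  .for vJ (.lit 0) (aFl⟪↟vC⟫)
    (.set vB (aFn⟪aRow⟪↟vC⟫ +ₑ ↟vJ⟫) ;;
     .when (aSd⟪↟vB⟫) (.lit 1)
       (.put aSd ↟vB (aSp⟪↟vC⟫) ;; .put aSp ↟vB (aSd⟪↟vC⟫) ;;
        .put aStk ↟vTop ↟vB ;; .set vTop (↟vTop +ₑ .lit 1)))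

/-- Graph search in the cluster graph. The two sides of each connected component get two
consecutive numbers; `aSd` holds the number of the side of a node, `aSp` that of the other side. -/
def sidePhase : Cmd :=
  .set vK (.lit 1) ;;
  .for vR (.lit 0) ↟vQ
    (.when (aSd⟪↟vR⟫) (.lit 1)
      (.put aSd ↟vR ↟vK ;; .put aSp ↟vR (↟vK +ₑ .lit 1) ;; .set vK (↟vK +ₑ .lit 2) ;;
       .put aStk (.lit 0) ↟vR ;; .set vTop (.lit 1) ;;
       .loop (.lit 0) ↟vTop
         (.set vTop (↟vTop -ₑ .lit 1) ;; .set vC (aStk⟪↟vTop⟫) ;; visitNbrs)))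

/-- Computes the maximum degree of each side, and saves the lengths of the neighbor lists. -/
def degreePhase : Cmd :=
  .for vC (.lit 0) ↟vQ
    (.put aHl ↟vC (aFl⟪↟vC⟫) ;;
     .when (aDm⟪aSd⟪↟vC⟫⟫) (aFl⟪↟vC⟫) (.put aDm (aSd⟪↟vC⟫) (aFl⟪↟vC⟫)))

/-- Marks the node `vC` as constraint node and updates the maximum degree `vP` of these nodes. -/
def markNode : Cmd :=
  .put aY ↟vC (.lit 1) ;; .when ↟vP (aFl⟪↟vC⟫) (.set vP (aFl⟪↟vC⟫))

/-- In each component, the side with the smaller maximum degree becomes the side of the constraint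
nodes. -/
def choosePhase : Cmd :=
  .for vC (.lit 0) ↟vQ
    (.set vA (aDm⟪aSd⟪↟vC⟫⟫) ;; .set vB (aDm⟪aSp⟪↟vC⟫⟫) ;;
     .ite ↟vA ↟vB markNode
      (.ite ↟vB ↟vA .skip (.when (aSd⟪↟vC⟫) (aSp⟪↟vC⟫) markNode)))

/-- Makes any two neighbors of a constraint node adjacent. -/
def fillPhase : Cmd :=
  .for vC (.lit 0) ↟vQ
    (.when (.lit 0) (aY⟪↟vC⟫)
      (.for vI (.lit 0) (aHl⟪↟vC⟫)
        (.for vJ (.lit 0) (aHl⟪↟vC⟫)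
          (.set vA (aFn⟪aRow⟪↟vC⟫ +ₑ ↟vI⟫) ;; .set vB (aFn⟪aRow⟪↟vC⟫ +ₑ ↟vJ⟫) ;;
           .when (.lit 0) ((↟vA -ₑ ↟vB) +ₑ (↟vB -ₑ ↟vA)) (addNbr vA vB)))))

/-- The powers of `ℓ`, quotients, remainders and products with respect to `ℓ`, and the offsets of
the tables of the nodes. -/
def tablePhase : Cmd :=
  .put aPw (.lit 0) (.lit 1) ;;
  .for vI (.lit 0) ↟vP
    (.set vX (.lit 0) ;;
     .for vJ (.lit 0) ↟vEll (.set vX (↟vX +ₑ aPw⟪↟vI⟫)) ;;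
     .put aPw (↟vI +ₑ .lit 1) ↟vX) ;;
  .set vX (.lit 0) ;; .set vY (.lit 0) ;; .set vZ (.lit 0) ;;
  .for vT (.lit 0) (aPw⟪↟vP⟫)
    (.put aRem ↟vT ↟vX ;; .put aQuot ↟vT ↟vY ;; .put aMul ↟vT ↟vZ ;;
     .set vZ (↟vZ +ₑ ↟vEll) ;; .set vX (↟vX +ₑ .lit 1) ;;
     .ite ↟vX ↟vEll .skip (.set vX (.lit 0) ;; .set vY (↟vY +ₑ .lit 1))) ;;
  .set vAcc (.lit 0) ;;
  .for vC (.lit 0) ↟vQ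
    (.put aTb ↟vC ↟vAcc ;; .set vAcc (↟vAcc +ₑ aPw⟪↟vP⟫))

/-- Splits the neighbors of `vV`: those that are alive form the list `aUp`, the eliminated ones
whose tables have not been used form the list `aCh`. -/
def gatherNbrs : Cmd :=
  .set vLen (.lit 0) ;;
  .for vJ (.lit 0) (aFl⟪↟vV⟫)
    (.set vW (aFn⟪aRow⟪↟vV⟫ +ₑ ↟vJ⟫) ;;
     .ite (.lit 0) (aDead⟪↟vW⟫)
       (.when (aCl⟪↟vW⟫) (.lit 1)
         (.put aCl ↟vW (.lit 1) ;; .put aCh ↟vLen ↟vW ;; .set vLen (↟vLen +ₑ .lit 1)))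
       (.put aUp (aRow⟪↟vV⟫ +ₑ aUpl⟪↟vV⟫) ↟vW ;; .put aUpl ↟vV (aUpl⟪↟vV⟫ +ₑ .lit 1)))

/-- Writes the digits of `vT` into `aCur`, one for each node in the list of `vV`. -/
def decodeTuple : Cmd :=
  .set vX ↟vT ;;
  .for vJ (.lit 0) (aUpl⟪↟vV⟫)
    (.put aCur (aUp⟪aRow⟪↟vV⟫ +ₑ ↟vJ⟫) (aRem⟪↟vX⟫) ;; .set vX (aQuot⟪↟vX⟫))

/-- Checks that the selected vertex of the constraint node `vV` is adjacent to the selected vertices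
of its neighbors. -/
def checkAdj : Cmd :=
  .for vJ (.lit 0) (aUpl⟪↟vV⟫)
    (.set vZ (aUp⟪aRow⟪↟vV⟫ +ₑ ↟vJ⟫) ;;
     .set vB (aMem⟪aRow⟪↟vZ⟫ +ₑ aCur⟪↟vZ⟫⟫) ;;
     .when (.lit 0) (aY⟪↟vV⟫)
       (.when (aGadj⟪aRow⟪↟vA⟫ +ₑ ↟vB⟫) (.lit 1) (.set vOk (.lit 0))))

/-- Encodes the current tuple on the list of `vW` as a number. -/
def encodeTuple : Cmd :=
  .set vCode (.lit 0) ;;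
  .set vH (aUpl⟪↟vW⟫) ;;
  .loop (.lit 0) ↟vH
    (.set vH (↟vH -ₑ .lit 1) ;;
     .set vCode (aMul⟪↟vCode⟫ +ₑ aCur⟪aUp⟪aRow⟪↟vW⟫ +ₑ ↟vH⟫⟫))

/-- Checks the current tuple against the tables of the nodes in `aCh`. -/
def checkTables : Cmd :=
  .for vJ (.lit 0) ↟vLen
    (.set vW (aCh⟪↟vJ⟫) ;; encodeTuple ;;
     .when (aTab⟪aTb⟪↟vW⟫ +ₑ ↟vCode⟫) (.lit 1) (.set vOk (.lit 0)))

/-- Tries all vertices of the class `vV` for the current tuple. -/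
def tryVertices : Cmd :=
  .set vFound (.lit 0) ;;
  .for vI (.lit 0) (aSz⟪↟vV⟫)
    (.put aCur ↟vV ↟vI ;; .set vA (aMem⟪aRow⟪↟vV⟫ +ₑ ↟vI⟫) ;; .set vOk (.lit 1) ;;
     checkAdj ;; checkTables ;;
     .when (.lit 0) ↟vOk (.set vFound (.lit 1)))

/-- Eliminates the node `vV`: its table tells, for every choice of vertices for its alive
neighbors, whether the choice extends to `vV` and all nodes eliminated below it. -/
def eliminate : Cmd :=
  .put aDead ↟vV (.lit 1) ;;
  gatherNbrs ;;
  .for vT (.lit 0) (aPw⟪aUpl⟪↟vV⟫⟫)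
    (decodeTuple ;; tryVertices ;; .put aTab (aTb⟪↟vV⟫ +ₑ ↟vT) ↟vFound) ;;
  .when (aUpl⟪↟vV⟫) (.lit 1) (.when (aTab⟪aTb⟪↟vV⟫⟫) (.lit 1) (.set vAns (.lit 0)))

/-- Sets `vBad` to `1` if two alive neighbors of `vV` on its side are not adjacent. -/
def checkSimplicial : Cmd :=
  .set vBad (.lit 0) ;;
  .for vI (aHl⟪↟vV⟫) (aFl⟪↟vV⟫)
    (.set vA (aFn⟪aRow⟪↟vV⟫ +ₑ ↟vI⟫) ;;
     .for vJ (aHl⟪↟vV⟫) (aFl⟪↟vV⟫)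
      (.set vB (aFn⟪aRow⟪↟vV⟫ +ₑ ↟vJ⟫) ;;
       .when (aDead⟪↟vA⟫) (.lit 1) (.when (aDead⟪↟vB⟫) (.lit 1)
        (.when (.lit 0) ((↟vA -ₑ ↟vB) +ₑ (↟vB -ₑ ↟vA))
         (.when (aFadj⟪aRow⟪↟vA⟫ +ₑ ↟vB⟫) (.lit 1) (.set vBad (.lit 1)))))))

/-- Puts the alive neighbors of `vV` on the stack. -/
def pushNbrs : Cmd :=
  .for vJ (.lit 0) (aUpl⟪↟vV⟫)
    (.put aStk ↟vTop (aUp⟪aRow⟪↟vV⟫ +ₑ ↟vJ⟫) ;; .set vTop (↟vTop +ₑ .lit 1))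

/-- Eliminates the constraint nodes, in any order. -/
def elimPhaseY : Cmd :=
  .for vV (.lit 0) ↟vQ (.when (.lit 0) (aY⟪↟vV⟫) eliminate)

/-- Puts the other nodes on the stack. -/
def pushPhase : Cmd :=
  .set vTop (.lit 0) ;;
  .for vV (.lit 0) ↟vQ
    (.when (aY⟪↟vV⟫) (.lit 1) (.put aStk ↟vTop ↟vV ;; .set vTop (↟vTop +ₑ .lit 1)))

/-- Eliminates the other nodes, each at a time when its alive neighbors are pairwise adjacent. -/
def elimPhaseX : Cmd :=
  .loop (.lit 0) ↟vTop
    (.set vTop (↟vTop -ₑ .lit 1) ;; .set vV (aStk⟪↟vTop⟫) ;;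
     .when (aDead⟪↟vV⟫) (.lit 1)
      (checkSimplicial ;; .when ↟vBad (.lit 1) (eliminate ;; pushNbrs)))

/-- The algorithm for colored graphs with a color class of at least two vertices, once the classes
are known. -/
def mainPhase : Cmd :=
  edgePhase ;; sidePhase ;; degreePhase ;; choosePhase ;; fillPhase ;; tablePhase ;;
  .set vAns (.lit 1) ;; elimPhaseY ;; pushPhase ;; elimPhaseX ;; .set vN ↟vAns

/-- The algorithm for multicolored graph realization. If all color classes are singletons, then the
answer is yes. -/
def mgrAlgorithm : Cmd :=
  classPhase ;; .ite ↟vEll (.lit 2) (.set vN (.lit 1)) mainPhase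

theorem runs_when {s : St} {Q : St → ℕ → Prop} {e f : AExp} {c : Cmd} :
    Runs (.when e f c) s Q ↔
      (e.eval s < f.eval s → Runs c s (fun s' t => Q s' (t + (e.cost + f.cost + 1)))) ∧
      (¬ e.eval s < f.eval s → Q s (1 + (e.cost + f.cost + 1))) := by
  unfold Cmd.when
  rw [runs_ite, runs_skip]

/-! ### Lists stored in arrays -/

/-- The list of the first `len` values of `A`. -/
def arrList (A : ℕ → ℕ) (len : ℕ) : List ℕ := (List.range len).map A

/-- Row `c` of the two-dimensional array `A` with rows of length `n`. -/
def row (A : ℕ → ℕ) (n c : ℕ) : ℕ → ℕ := fun i => A (c * n + i)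

@[simp] theorem arrList_length (A : ℕ → ℕ) (len : ℕ) : (arrList A len).length = len := by
  simp [arrList]

@[simp] theorem arrList_zero (A : ℕ → ℕ) : arrList A 0 = [] := rfl

theorem arrList_succ (A : ℕ → ℕ) (len : ℕ) : arrList A (len + 1) = arrList A len ++ [A len] := by
  simp [arrList, List.range_succ]

theorem mem_arrList {A : ℕ → ℕ} {len x : ℕ} : x ∈ arrList A len ↔ ∃ i < len, A i = x := by
  simp [arrList]

theorem arrList_congr {A B : ℕ → ℕ} {len : ℕ} (h : ∀ i < len, A i = B i) :
    arrList A len = arrList B len := by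
  simpa [arrList] using h

theorem arrList_update (A : ℕ → ℕ) {len i : ℕ} (x : ℕ) (h : len ≤ i) :
    arrList (Function.update A i x) len = arrList A len :=
  arrList_congr fun j hj => Function.update_of_ne (by omega) _ _

theorem arrList_push (A : ℕ → ℕ) (len x : ℕ) :
    arrList (Function.update A len x) (len + 1) = arrList A len ++ [x] := by
  rw [arrList_succ, arrList_update A x le_rfl, Function.update_self]

theorem arrList_take (A : ℕ → ℕ) {k len : ℕ} (h : k ≤ len) :
    (arrList A len).take k = arrList A k := by
  simp [arrList, ← List.map_take, List.take_range, h]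

theorem arrList_nodup_of_le {A : ℕ → ℕ} {k len : ℕ} (hn : (arrList A len).Nodup) (h : k ≤ len) :
    (arrList A k).Nodup := by
  rw [← arrList_take A h]
  exact hn.sublist (List.take_sublist _ _)

theorem arrList_notMem {A : ℕ → ℕ} {k len : ℕ} (hn : (arrList A len).Nodup) (h : k < len) :
    A k ∉ arrList A k := by
  have := arrList_nodup_of_le hn (show k + 1 ≤ len from h)
  rw [arrList_succ] at this
  intro hk
  exact (List.disjoint_of_nodup_append this) hk (by simp)

theorem mul_add_inj {n c d i j : ℕ} (hi : i < n) (hj : j < n) :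
    c * n + i = d * n + j ↔ c = d ∧ i = j := by
  constructor
  · intro h
    have hn : 0 < n := by omega
    have h₁ : (c * n + i) / n = c := by
      rw [mul_comm, Nat.mul_add_div hn, Nat.div_eq_of_lt hi]; rfl
    have h₂ : (d * n + j) / n = d := by
      rw [mul_comm, Nat.mul_add_div hn, Nat.div_eq_of_lt hj]; rfl
    have : c = d := by rw [← h₁, ← h₂, h]
    subst this
    exact ⟨rfl, by omega⟩
  · rintro ⟨rfl, rfl⟩; rfl

theorem row_update_self (A : ℕ → ℕ) (n c i x : ℕ) :
    row (Function.update A (c * n + i) x) n c = Function.update (row A n c) i x := by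
  funext j
  by_cases h : j = i
  · subst h; simp [row]
  · rw [Function.update_of_ne h, row, row, Function.update_of_ne (by omega)]

theorem row_update_of_ne (A : ℕ → ℕ) {n c d i j : ℕ} (x : ℕ) (hc : d ≠ c) (hi : i < n)
    (hj : j < n) : row (Function.update A (c * n + i) x) n d j = row A n d j := by
  rw [row, row, Function.update_of_ne]
  rw [Ne, mul_add_inj hj hi]
  exact fun h => hc h.1

theorem arrList_row_update (A : ℕ → ℕ) {n c d i len : ℕ} (x : ℕ) (hc : d ≠ c) (hi : i < n)
    (hlen : len ≤ n) : arrList (row (Function.update A (c * n + i) x) n d) len =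
      arrList (row A n d) len :=
  arrList_congr fun _ hj => row_update_of_ne A x hc hi (by omega)

/-! ### Eliminating one node -/

/-- The data that stay unchanged during the elimination: `q` classes of at most `ell` vertices, the
neighbor lists of a graph `F` on the classes, and arithmetic tables for numbers with at most `K`
digits in base `ell`. -/
structure Env (s : St) (n q ell K : ℕ) (F : ℕ → ℕ → Prop) : Prop where
  vQ : s.v vQ = q
  le : q ≤ n
  K_le : K ≤ n
  two_le : 2 ≤ ell
  rowA : ∀ i < n, s.a aRow i = i * n
  sz : ∀ c < q, s.a aSz c ≤ ell
  mem : ∀ c < q, ∀ i < s.a aSz c, row (s.a aMem) n c i < n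
  fl : ∀ c < q, s.a aFl c ≤ n
  nodup : ∀ c < q, (arrList (row (s.a aFn) n c) (s.a aFl c)).Nodup
  nbr : ∀ c < q, ∀ b, b ∈ arrList (row (s.a aFn) n c) (s.a aFl c) ↔ F c b
  lt : ∀ a b, F a b → a < q ∧ b < q
  symm : ∀ a b, F a b → F b a
  irrefl : ∀ a, ¬ F a a
  pw : ∀ p ≤ K, s.a aPw p = ell ^ p
  rem : ∀ t < ell ^ K, s.a aRem t = t % ell
  quot : ∀ t < ell ^ K, s.a aQuot t = t / ell
  mul : ∀ t < ell ^ K, s.a aMul t = t * ell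
  tb : ∀ c < q, s.a aTb c = c * ell ^ K

/-- The command does not write to the data of `Env`. -/
def Cmd.keepsEnv (c : Cmd) : Bool :=
  !(c.wv vQ || c.wa aRow || c.wa aSz || c.wa aMem || c.wa aFl ||
    c.wa aFn || c.wa aPw || c.wa aRem || c.wa aQuot || c.wa aMul || c.wa aTb)

/-- Commands that do not write to the relevant data keep `Env`; the hypothesis `hc` is decided by
evaluation. -/
theorem Env.agree {s s' : St} {n q ell K : ℕ} {F : ℕ → ℕ → Prop} (h : Env s n q ell K F) {c : Cmd}
    (ha : Agree c s s') (hc : c.keepsEnv = true) : Env s' n q ell K F := by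
  simp only [Cmd.keepsEnv, Bool.not_eq_true', Bool.or_eq_false_iff, and_assoc] at hc
  obtain ⟨h1, h2, h3, h4, h5, h6, h7, h8, h9, h10, h11⟩ := hc
  have e1 := ha.1 _ h1
  have e2 := ha.2 _ h2
  have e3 := ha.2 _ h3
  have e4 := ha.2 _ h4
  have e5 := ha.2 _ h5
  have e6 := ha.2 _ h6
  have e7 := ha.2 _ h7
  have e8 := ha.2 _ h8
  have e9 := ha.2 _ h9
  have e10 := ha.2 _ h10
  have e11 := ha.2 _ h11
  obtain ⟨a0, a1, a2, a3, a4, a5, a6, a7, a8, a9, a10, a11, a12, a13, a14, a15, a16, a17⟩ := h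
  constructor <;> (try simp only [e1, e2, e3, e4, e5, e6, e7, e8, e9, e10, e11]) <;> assumption

/-- The neighbors of `v` are divided into those alive and the eliminated ones whose tables have not
been used; the latter are marked as used. -/
theorem gatherNbrs_runs {s : St} {Q : St → ℕ → Prop} {n q ell K v : ℕ} {F : ℕ → ℕ → Prop}
    (he : Env s n q ell K F) (hv : v < q) (hvV : s.v vV = v) (hupl : s.a aUpl v = 0)
    (post : ∀ s' T, Agree gatherNbrs s s' →
      arrList (row (s'.a aUp) n v) (s'.a aUpl v) =
        (arrList (row (s.a aFn) n v) (s.a aFl v)).filter (fun w => s.a aDead w = 0) →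
      arrList (s'.a aCh) (s'.v vLen) = (arrList (row (s.a aFn) n v) (s.a aFl v)).filter
        (fun w => s.a aDead w ≠ 0 ∧ s.a aCl w = 0) →
      (∀ w, s'.a aCl w = if w ∈ arrList (s'.a aCh) (s'.v vLen) then 1 else s.a aCl w) →
      (∀ c, c ≠ v → s'.a aUpl c = s.a aUpl c) →
      (∀ c i, c ≠ v → i < n → row (s'.a aUp) n c i = row (s.a aUp) n c i) →
      T ≤ s.a aFl v * 50 + 10 → Q s' T) :
    Runs gatherNbrs s Q := by
  refine Runs.of_agree ?_
  unfold gatherNbrs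
  rw [runs_seq, runs_set]
  set L := fun k => arrList (row (s.a aFn) n v) k with hL
  refine Runs.forB (fun k s' =>
      arrList (row (s'.a aUp) n v) (s'.a aUpl v) = (L k).filter (fun w => s.a aDead w = 0) ∧
      arrList (s'.a aCh) (s'.v vLen) = (L k).filter (fun w => s.a aDead w ≠ 0 ∧ s.a aCl w = 0) ∧
      (∀ w, s'.a aCl w = if w ∈ arrList (s'.a aCh) (s'.v vLen) then 1 else s.a aCl w) ∧
      (∀ c, c ≠ v → s'.a aUpl c = s.a aUpl c) ∧
      (∀ c i, c ≠ v → i < n → row (s'.a aUp) n c i = row (s.a aUp) n c i))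
    0 (s.a aFl v) 40 (Nat.zero_le _) rfl rfl ?_ ?_ ?_ ?_
  · intro k s' ha _
    simp [ha.2 aFl rfl, ha.1 vV rfl, hvV]
  · simp [hL, hupl]
  · rintro k s' - hk ha hj ⟨h1, h2, h3, h4, h5⟩
    have eV : s'.v vV = v := by rw [ha.1 vV rfl]; simpa using hvV
    have eD : s'.a aDead = s.a aDead := by rw [ha.2 aDead rfl]; rfl
    have eF : s'.a aFn = s.a aFn := by rw [ha.2 aFn rfl]; rfl
    have eR : s'.a aRow v = v * n := by rw [ha.2 aRow rfl]; exact he.rowA v (hv.trans_le he.le)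
    have hfl := he.fl v hv
    have hu : s'.a aUpl v < n := by
      have := congrArg List.length h1
      rw [arrList_length] at this
      have h6 := List.length_filter_le (fun w => decide (s.a aDead w = 0)) (L k)
      have h7 : (L k).length = k := arrList_length _ _
      omega
    have hnot : row (s.a aFn) n v k ∉ L k := arrList_notMem (he.nodup v hv) hk
    have hLs : L (k + 1) = L k ++ [s.a aFn (v * n + k)] := arrList_succ _ _
    have hx : s.a aFn (v * n + k) ∉ L k := hnot
    rw [hLs]
    set x := s.a aFn (v * n + k) with hxdef
    simp only [runs_seq, runs_set, AExp.eval, runs_ite, runs_when, runs_put, St.set_v, St.set_a,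
      St.put_a, St.put_v, reduceCtorEq, if_true, if_false, AExp.cost, eV, eD, eF, eR, hj, ← hxdef]
    refine ⟨fun hdead => ⟨fun hcl => ?_, fun hcl => ?_⟩, fun hdead => ?_⟩
    · have hclx : s.a aCl x = 0 := by
        rw [h3] at hcl
        split_ifs at hcl <;> omega
      refine ⟨⟨?_, ?_, ?_, ?_, ?_⟩, by norm_num⟩
      · simp [h1, List.filter_append, List.filter_cons]
        omega
      · rw [arrList_push, h2]
        simp [List.filter_append, List.filter_cons, hclx]
        omega
      · intro w
        rw [arrList_push]
        simp only [Function.update_apply, h3, List.mem_append, List.mem_singleton]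
        by_cases hw : w = x
        · simp [hw]
        · simp [hw]
      · exact h4
      · exact h5
    · have hclx : s.a aCl x ≠ 0 := by
        rw [h3] at hcl
        split_ifs at hcl with hmem
        · rw [h2] at hmem
          exact absurd (List.mem_filter.1 hmem).1 hx
        · omega
      refine ⟨⟨?_, ?_, ?_, ?_, ?_⟩, by norm_num⟩
      · simp [h1, List.filter_append, List.filter_cons]
        omega
      · simp [h2, List.filter_append, hclx]
      · exact h3
      · exact h4
      · exact h5
    · have hd : s.a aDead x = 0 := by omega
      refine ⟨⟨?_, ?_, ?_, ?_, ?_⟩, by norm_num⟩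
      · simp [row_update_self, arrList_push, h1, List.filter_append, hd]
      · simp [h2, List.filter_append, hd]
      · simpa using h3
      · intro c hc
        simp [Function.update_of_ne hc, h4 c hc]
      · intro c i hc hi
        rw [row_update_of_ne _ _ hc hu hi, h5 c i hc hi]
  · rintro s' T ha hj ⟨h1, h2, h3, h4, h5⟩ hT hag
    refine post s' _ hag h1 h2 h3 h4 h5 ?_
    simp at hT ⊢
    omega

/-- The number with digits `a z`, for `z` in the list, in base `ell`. -/
def encode (ell : ℕ) (a : ℕ → ℕ) (zs : List ℕ) : ℕ := Nat.ofDigits ell (zs.map a)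

theorem encode_lt {ell : ℕ} {a : ℕ → ℕ} {zs : List ℕ} (hl : 2 ≤ ell) (h : ∀ z ∈ zs, a z < ell) :
    encode ell a zs < ell ^ zs.length := by
  simpa [encode] using Nat.ofDigits_lt_base_pow_length (b := ell) (l := zs.map a) (by omega)
    (by simpa using h)

theorem encode_cons (ell : ℕ) (a : ℕ → ℕ) (z : ℕ) (zs : List ℕ) :
    encode ell a (z :: zs) = a z + ell * encode ell a zs := by
  simp [encode, Nat.ofDigits_cons]

theorem encode_append (ell : ℕ) (a : ℕ → ℕ) (zs ys : List ℕ) :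
    encode ell a (zs ++ ys) = encode ell a zs + ell ^ zs.length * encode ell a ys := by
  simp [encode, Nat.ofDigits_append]

theorem encode_congr {ell : ℕ} {a b : ℕ → ℕ} {zs : List ℕ} (h : ∀ z ∈ zs, a z = b z) :
    encode ell a zs = encode ell b zs := by
  rw [encode, encode, List.map_congr_left h]

theorem encode_inj {ell : ℕ} {a b : ℕ → ℕ} {zs : List ℕ} (ha : ∀ z ∈ zs, a z < ell)
    (hb : ∀ z ∈ zs, b z < ell) (h : encode ell a zs = encode ell b zs) : ∀ z ∈ zs, a z = b z := by
  induction zs with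
  | nil => simp
  | cons x xs ih =>
    rw [encode_cons, encode_cons] at h
    have hax := ha x (by simp)
    have hbx := hb x (by simp)
    have hmod := congrArg (· % ell) h
    simp only [Nat.add_mul_mod_self_left, Nat.mod_eq_of_lt hax, Nat.mod_eq_of_lt hbx] at hmod
    have hdiv : encode ell a xs = encode ell b xs := by
      rw [hmod] at h
      exact Nat.eq_of_mul_eq_mul_left (by omega : 0 < ell) (by omega)
    intro z hz
    rcases List.mem_cons.1 hz with rfl | hz
    · exact hmod
    · exact ih (fun z hz => ha z (by simp [hz])) (fun z hz => hb z (by simp [hz])) hdiv z hz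

theorem decodeTuple_runs {s : St} {Q : St → ℕ → Prop} {n q ell K v : ℕ} {F : ℕ → ℕ → Prop}
    {zs : List ℕ}
    (he : Env s n q ell K F) (hv : v < q) (hvV : s.v vV = v)
    (hzs : arrList (row (s.a aUp) n v) (s.a aUpl v) = zs) (hnd : zs.Nodup)
    (hK : zs.length ≤ K) (ht : s.v vT < ell ^ zs.length)
    (post : ∀ s' T, Agree decodeTuple s s' → encode ell (s'.a aCur) zs = s.v vT →
      (∀ z ∈ zs, s'.a aCur z < ell) → T ≤ zs.length * 30 + 10 → Q s' T) :
    Runs decodeTuple s Q := by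
  refine Runs.of_agree ?_
  unfold decodeTuple
  rw [runs_seq, runs_set]
  have hlen : s.a aUpl v = zs.length := by rw [← hzs, arrList_length]
  have hell := he.two_le
  refine Runs.forB (fun k s' =>
      encode ell (s'.a aCur) (zs.take k) + ell ^ k * s'.v vX = s.v vT ∧
      (∀ z ∈ zs.take k, s'.a aCur z < ell))
    0 zs.length 14 (Nat.zero_le _) rfl rfl ?_ ?_ ?_ ?_
  · intro k s' ha _
    simp [ha.2 aUpl rfl, ha.1 vV rfl, hvV, hlen]
  · simp [encode]
  · rintro k s' - hk ha hj ⟨h1, h2⟩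
    have eV : s'.v vV = v := by rw [ha.1 vV rfl]; simpa using hvV
    have eU : s'.a aUp = s.a aUp := by rw [ha.2 aUp rfl]; rfl
    have eR : s'.a aRow v = v * n := by rw [ha.2 aRow rfl]; exact he.rowA v (hv.trans_le he.le)
    have hxlt : s'.v vX < ell ^ K := by
      have : s'.v vX ≤ s.v vT := by
        rw [← h1]
        exact le_add_left (Nat.le_mul_of_pos_left _ (by positivity))
      exact this.trans_lt (ht.trans_le (Nat.pow_le_pow_right (by omega) hK))
    have eQ : s'.a aQuot (s'.v vX) = s'.v vX / ell := by
      rw [ha.2 aQuot rfl]; exact he.quot _ hxlt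
    have eM : s'.a aRem (s'.v vX) = s'.v vX % ell := by
      rw [ha.2 aRem rfl]; exact he.rem _ hxlt
    have hz : s.a aUp (v * n + k) = zs[k] := by
      simp [← hzs, arrList, row]
    have hnot : zs[k] ∉ zs.take k := by
      intro hmem
      obtain ⟨i, hi, hik⟩ := List.mem_take_iff_getElem.1 hmem
      have := (List.Nodup.getElem_inj_iff hnd).1 hik
      omega
    simp only [runs_seq, runs_set, AExp.eval, runs_put, St.set_v, St.set_a, eQ, eM,
      St.put_a, St.put_v, reduceCtorEq, if_true, if_false, AExp.cost, eV, eU, eR, hj, hz]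
    have hcur : ∀ z ∈ zs.take k,
        Function.update (s'.a aCur) zs[k] (s'.v vX % ell) z = s'.a aCur z :=
      fun z hz => Function.update_of_ne (fun h => hnot (by rwa [← h])) _ _
    refine ⟨⟨?_, ?_⟩, by norm_num⟩
    · rw [← h1, List.take_succ_eq_append_getElem hk, encode_append, encode_congr hcur, encode_cons]
      simp only [List.length_take, min_eq_left hk.le, Function.update_self, encode, List.map_nil,
        Nat.ofDigits_nil, mul_zero, add_zero, pow_succ]
      rw [add_assoc, mul_assoc, ← mul_add, Nat.mod_add_div]
    · intro z hz
      rw [List.take_succ_eq_append_getElem hk, List.mem_append, List.mem_singleton] at hz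
      rcases hz with hz | rfl
      · rw [hcur z hz]; exact h2 z hz
      · rw [Function.update_self]; exact Nat.mod_lt _ (by omega)
  · rintro s' T ha hj ⟨h1, h2⟩ hT hag
    rw [List.take_length] at h1 h2
    refine post s' _ hag ?_ h2 ?_
    · have hx : s'.v vX = 0 := by
        by_contra hne
        have : ell ^ zs.length * 1 ≤ ell ^ zs.length * s'.v vX :=
          Nat.mul_le_mul_left _ (by omega)
        omega
      rw [← h1, hx]; simp
    · simp at hT ⊢
      omega

theorem checkAdj_runs {s : St} {Q : St → ℕ → Prop} {n q ell K v : ℕ} {F : ℕ → ℕ → Prop}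
    {zs : List ℕ}
    (he : Env s n q ell K F) (hv : v < q) (hvV : s.v vV = v)
    (hzs : arrList (row (s.a aUp) n v) (s.a aUpl v) = zs) (hzq : ∀ z ∈ zs, z < q)
    (hA : s.v vA < n)
    (post : ∀ s' T, Agree checkAdj s s' → (s'.v vOk ≠ 0 ↔ s.v vOk ≠ 0 ∧
        (s.a aY v ≠ 0 → ∀ z ∈ zs,
          s.a aGadj (s.v vA * n + row (s.a aMem) n z (s.a aCur z)) ≠ 0)) →
      T ≤ zs.length * 50 + 10 → Q s' T) :
    Runs checkAdj s Q := by
  refine Runs.of_agree ?_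
  unfold checkAdj
  have hlen : s.a aUpl v = zs.length := by rw [← hzs, arrList_length]
  refine Runs.forB (fun k s' => (s'.v vOk ≠ 0 ↔ s.v vOk ≠ 0 ∧
        (s.a aY v ≠ 0 → ∀ z ∈ zs.take k,
          s.a aGadj (s.v vA * n + row (s.a aMem) n z (s.a aCur z)) ≠ 0)))
    0 zs.length 40 (Nat.zero_le _) rfl rfl ?_ ?_ ?_ ?_
  · intro k s' ha _
    simp [ha.2 aUpl rfl, ha.1 vV rfl, hvV, hlen]
  · simp
  · rintro k s' - hk ha hj h1
    have eV : s'.v vV = v := by rw [ha.1 vV rfl, hvV]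
    have eA : s'.v vA = s.v vA := ha.1 vA rfl
    have eU : s'.a aUp = s.a aUp := ha.2 aUp rfl
    have eM : s'.a aMem = s.a aMem := ha.2 aMem rfl
    have eC : s'.a aCur = s.a aCur := ha.2 aCur rfl
    have eY : s'.a aY = s.a aY := ha.2 aY rfl
    have eG : s'.a aGadj = s.a aGadj := ha.2 aGadj rfl
    have eR' : s'.a aRow = s.a aRow := ha.2 aRow rfl
    have eR : s.a aRow v = v * n := he.rowA v (hv.trans_le he.le)
    have eRA : s.a aRow (s.v vA) = s.v vA * n := he.rowA _ hA
    have hz : s.a aUp (v * n + k) = zs[k] := by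
      simp [← hzs, arrList, row]
    have eRZ : s.a aRow zs[k] = zs[k] * n := he.rowA _ ((hzq _ (by simp)).trans_le he.le)
    simp only [runs_seq, runs_set, AExp.eval, St.set_v, St.set_a, runs_when, eC, eY, eG, eR', eA,
      eRA, eRZ, eM, reduceCtorEq, if_true, if_false, AExp.cost, eV, eU, eR, hj, hz]
    rw [List.take_succ_eq_append_getElem hk]
    simp only [List.mem_append, List.mem_singleton, row] at h1 ⊢
    refine ⟨fun hy => ⟨fun hg => ⟨?_, by norm_num⟩, fun hg => ⟨?_, by norm_num⟩⟩,
      fun hy => ⟨?_, by norm_num⟩⟩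
    · constructor
      · intro h; simp at h
      · rintro ⟨_, h⟩
        have := h (by omega) zs[k] (Or.inr rfl)
        omega
    · rw [h1]
      refine and_congr_right fun _ => imp_congr_right fun _ => ?_
      constructor
      · rintro h z (hz | rfl)
        · exact h z hz
        · omega
      · exact fun h z hz => h z (Or.inl hz)
    · rw [h1]
      refine and_congr_right fun _ => ?_
      constructor
      · exact fun _ h => by omega
      · exact fun _ h => by omega
  · rintro s' T ha hj h1 hT hag
    rw [List.take_length] at h1
    refine post s' _ hag h1 ?_
    simp at hT ⊢
    omega

/-- Horner evaluation, from the last digit on. -/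
theorem encodeTuple_runs {s : St} {Q : St → ℕ → Prop} {n q ell K w : ℕ} {F : ℕ → ℕ → Prop}
    {zs : List ℕ}
    (he : Env s n q ell K F) (hw : w < q) (hwV : s.v vW = w)
    (hzs : arrList (row (s.a aUp) n w) (s.a aUpl w) = zs) (hK : zs.length ≤ K)
    (hcur : ∀ z ∈ zs, s.a aCur z < ell)
    (post : ∀ s' T, Agree encodeTuple s s' → s'.v vCode = encode ell (s.a aCur) zs →
      T ≤ zs.length * 20 + 10 → Q s' T) :
    Runs encodeTuple s Q := by
  refine Runs.of_agree ?_
  unfold encodeTuple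
  have hlen : s.a aUpl w = zs.length := by rw [← hzs, arrList_length]
  rw [runs_seq, runs_set, runs_seq, runs_set]
  refine Runs.loop (fun s' T => s'.v vH ≤ zs.length ∧
      s'.v vCode = encode ell (s.a aCur) (zs.drop (s'.v vH)) ∧
      T + 20 * s'.v vH ≤ 20 * zs.length) (fun s' => s'.v vH) ?_ ?_ ?_
  · simp [hwV, hlen, encode]
  · rintro s' T ha ⟨h1, h2, h3⟩ hpos
    simp only [AExp.eval] at hpos
    obtain ⟨k, hk⟩ : ∃ k, s'.v vH = k + 1 := ⟨s'.v vH - 1, by omega⟩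
    rw [hk] at h1 h2 h3
    have eW : s'.v vW = w := by rw [ha.1 vW rfl]; simpa using hwV
    have eU : s'.a aUp = s.a aUp := by rw [ha.2 aUp rfl]; rfl
    have eC : s'.a aCur = s.a aCur := by rw [ha.2 aCur rfl]; rfl
    have eR : s'.a aRow w = w * n := by rw [ha.2 aRow rfl]; exact he.rowA w (hw.trans_le he.le)
    have hz : s.a aUp (w * n + k) = zs[k] := by
      simp [← hzs, arrList, row]
    have hlt : s'.v vCode < ell ^ K := by
      rw [h2]
      refine (encode_lt he.two_le fun z hz => hcur z (List.drop_subset _ _ hz)).trans_le ?_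
      refine Nat.pow_le_pow_right (by have := he.two_le; omega) ?_
      rw [List.length_drop]; omega
    have eM : s'.a aMul (s'.v vCode) = s'.v vCode * ell := by
      rw [ha.2 aMul rfl]; exact he.mul _ hlt
    simp only [runs_seq, runs_set, AExp.eval, St.set_v, St.set_a, hk, eW, eU, eC, eR, eM,
      reduceCtorEq, if_true, if_false, AExp.cost, Nat.add_sub_cancel, hz]
    refine ⟨⟨by omega, ?_, by omega⟩, by omega⟩
    rw [List.drop_eq_getElem_cons (by omega : k < zs.length), encode_cons, h2]
    ring
  · rintro s' T ha ⟨h1, h2, h3⟩ hpos hag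
    simp only [AExp.eval, not_lt, Nat.le_zero] at hpos
    refine post s' _ hag ?_ ?_
    · rw [h2, hpos, List.drop_zero]
    · simp [AExp.cost]
      omega

theorem checkTables_runs {s : St} {Q : St → ℕ → Prop} {n q ell K : ℕ} {F : ℕ → ℕ → Prop}
    {ch : List ℕ} (he : Env s n q ell K F)
    (hch : arrList (s.a aCh) (s.v vLen) = ch)
    (hup : ∀ w ∈ ch, w < q ∧ s.a aUpl w ≤ K ∧
      ∀ z ∈ arrList (row (s.a aUp) n w) (s.a aUpl w), s.a aCur z < ell)
    (post : ∀ s' T, Agree checkTables s s' → (s'.v vOk ≠ 0 ↔ s.v vOk ≠ 0 ∧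
        ∀ w ∈ ch, s.a aTab (w * ell ^ K +
          encode ell (s.a aCur) (arrList (row (s.a aUp) n w) (s.a aUpl w))) ≠ 0) →
      T ≤ ch.length * (20 * K + 50) + 10 → Q s' T) :
    Runs checkTables s Q := by
  refine Runs.of_agree ?_
  unfold checkTables
  have hlen : s.v vLen = ch.length := by rw [← hch, arrList_length]
  refine Runs.forB (fun k s' => (s'.v vOk ≠ 0 ↔ s.v vOk ≠ 0 ∧
        ∀ w ∈ ch.take k, s.a aTab (w * ell ^ K +
          encode ell (s.a aCur) (arrList (row (s.a aUp) n w) (s.a aUpl w))) ≠ 0))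
    0 ch.length (20 * K + 40) (Nat.zero_le _) rfl rfl ?_ ?_ ?_ ?_
  · intro k s' ha _
    simp [ha.1 vLen rfl, hlen]
  · simp
  · rintro k s' - hk ha hj h1
    have hw : s.a aCh k = ch[k] := by
      simp [← hch, arrList]
    obtain ⟨hwq, hwK, hwc⟩ := hup ch[k] (by simp)
    simp only [runs_seq, runs_set, AExp.eval, AExp.cost]
    have heS : Env (s'.set vW (s'.a aCh (s'.v vJ))) n q ell K F :=
      (he.agree ha rfl).agree (c := .set vW (.lit 0))
        ⟨fun x hx => by simp_all [Cmd.wv], fun _ _ => rfl⟩ rfl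
    have eW : s'.a aCh (s'.v vJ) = ch[k] := by rw [ha.2 aCh rfl, hj, hw]
    refine encodeTuple_runs heS hwq (by simp [eW])
      (by rw [St.set_a, ha.2 aUp rfl, ha.2 aUpl rfl]) (by simpa using hwK) ?_ ?_
    · rw [St.set_a, ha.2 aCur rfl]
      exact hwc
    intro s₁ T hg hcode hT
    have e1 : s₁.v vW = ch[k] := by rw [hg.1 vW rfl]; simp [eW]
    have e2 : s₁.a aTb ch[k] = ch[k] * ell ^ K := by
      rw [hg.2 aTb rfl, St.set_a, ha.2 aTb rfl]; exact he.tb _ hwq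
    have e3 : s₁.a aTab = s.a aTab := by rw [hg.2 aTab rfl, St.set_a, ha.2 aTab rfl]
    have e4 : s₁.v vOk = s'.v vOk := by rw [hg.1 vOk rfl]; simp
    rw [St.set_a, ha.2 aCur rfl] at hcode
    rw [arrList_length] at hT
    simp only [runs_when, runs_set, AExp.eval, AExp.cost, St.set_v, reduceCtorEq, if_true,
      if_false, e1, e2, e3, e4, hcode]
    rw [List.take_succ_eq_append_getElem hk]
    simp only [List.mem_append, List.mem_singleton]
    have hB : 20 * s.a aUpl ch[k] ≤ 20 * K := by omega
    refine ⟨fun hz => ⟨?_, by omega⟩, fun hz => ⟨?_, by omega⟩⟩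
    · constructor
      · intro h; simp at h
      · rintro ⟨_, h⟩
        have := h ch[k] (Or.inr rfl)
        omega
    · rw [h1]
      refine and_congr_right fun _ => ?_
      constructor
      · rintro h w (hw | rfl)
        · exact h w hw
        · omega
      · exact fun h w hw => h w (Or.inl hw)
  · rintro s' T ha hj h1 hT hag
    rw [List.take_length] at h1
    refine post s' _ hag h1 ?_
    simp only [AExp.cost, Nat.sub_zero] at hT
    exact hT.trans (Nat.add_le_add (Nat.mul_le_mul_left _ (by omega)) (by omega))

/-- Some vertex of the class `v` is compatible with the choice `cur` of vertices for the list `zs`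
of neighbors of `v` and with the tables of the nodes in `ch`. -/
def Extends (s : St) (n ell K v : ℕ) (zs ch : List ℕ) (cur : ℕ → ℕ) : Prop :=
  ∃ i < s.a aSz v,
    (s.a aY v ≠ 0 → ∀ z ∈ zs,
      s.a aGadj (row (s.a aMem) n v i * n + row (s.a aMem) n z (cur z)) ≠ 0) ∧
    ∀ w ∈ ch, s.a aTab (w * ell ^ K +
      encode ell (Function.update cur v i) (arrList (row (s.a aUp) n w) (s.a aUpl w))) ≠ 0

/-- The hypothesis `hup` says that a table to be consulted depends only on `v` and on the alive
neighbors `zs` of `v`. -/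
theorem tryVertices_runs {s : St} {Q : St → ℕ → Prop} {n q ell K v : ℕ} {F : ℕ → ℕ → Prop}
    {zs ch : List ℕ} (he : Env s n q ell K F) (hv : v < q) (hvV : s.v vV = v)
    (hzs : arrList (row (s.a aUp) n v) (s.a aUpl v) = zs) (hzq : ∀ z ∈ zs, z < q)
    (hvz : v ∉ zs) (hcur : ∀ z ∈ zs, s.a aCur z < ell)
    (hch : arrList (s.a aCh) (s.v vLen) = ch)
    (hup : ∀ w ∈ ch, w < q ∧ s.a aUpl w ≤ K ∧
      ∀ z ∈ arrList (row (s.a aUp) n w) (s.a aUpl w), z = v ∨ z ∈ zs)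
    (post : ∀ s' T, Agree tryVertices s s' →
      (s'.v vFound ≠ 0 ↔ Extends s n ell K v zs ch (s.a aCur)) →
      T ≤ s.a aSz v * (zs.length * 50 + ch.length * (20 * K + 50) + 70) + 10 → Q s' T) :
    Runs tryVertices s Q := by
  refine Runs.of_agree ?_
  unfold tryVertices
  rw [runs_seq, runs_set]
  refine Runs.forB (fun k s' => (∀ z, z ≠ v → s'.a aCur z = s.a aCur z) ∧
      (s'.v vFound ≠ 0 ↔ ∃ i < k,
        (s.a aY v ≠ 0 → ∀ z ∈ zs,
          s.a aGadj (row (s.a aMem) n v i * n + row (s.a aMem) n z (s.a aCur z)) ≠ 0) ∧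
        ∀ w ∈ ch, s.a aTab (w * ell ^ K + encode ell (Function.update (s.a aCur) v i)
          (arrList (row (s.a aUp) n w) (s.a aUpl w))) ≠ 0))
    0 (s.a aSz v) (zs.length * 50 + ch.length * (20 * K + 50) + 60) (Nat.zero_le _) rfl rfl
    ?_ ?_ ?_ ?_
  · intro k s' ha _
    simp [ha.2 aSz rfl, ha.1 vV rfl, hvV]
  · simp
  · rintro i s' - hi ha hj ⟨h1, h2⟩
    have eV : s'.v vV = v := by rw [ha.1 vV rfl]; simpa using hvV
    have eM : s'.a aMem = s.a aMem := by rw [ha.2 aMem rfl]; rfl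
    have eR : s'.a aRow v = v * n := by rw [ha.2 aRow rfl]; exact he.rowA v (hv.trans_le he.le)
    have eU : s'.a aUp = s.a aUp := by rw [ha.2 aUp rfl]; rfl
    have eUl : s'.a aUpl = s.a aUpl := by rw [ha.2 aUpl rfl]; rfl
    have eG : s'.a aGadj = s.a aGadj := by rw [ha.2 aGadj rfl]; rfl
    have eY : s'.a aY = s.a aY := by rw [ha.2 aY rfl]; rfl
    have eT : s'.a aTab = s.a aTab := by rw [ha.2 aTab rfl]; rfl
    have eCh : s'.a aCh = s.a aCh := by rw [ha.2 aCh rfl]; rfl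
    have eL : s'.v vLen = s.v vLen := by rw [ha.1 vLen rfl]; simp
    have hcv : Function.update (s'.a aCur) v i = Function.update (s.a aCur) v i := by
      funext z
      by_cases hz : z = v
      · simp [hz]
      · simp [hz, h1 z hz]
    simp only [runs_seq, runs_set, runs_put, AExp.eval, AExp.cost, St.set_v, St.set_a, St.put_a,
      St.put_v, reduceCtorEq, if_false, eV, eR, hj, eM]
    set s₁ := (((s'.put aCur v i).set vA (s.a aMem (v * n + i))).set vOk 1) with hs₁
    have hg₁ : Agree (.put aCur (.lit 0) (.lit 0) ;; .set vA (.lit 0) ;; .set vOk (.lit 0))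
        s' s₁ := by
      constructor
      · intro x hx
        simp [Cmd.wv] at hx
        simp [hs₁, hx]
      · intro b hb
        simp [Cmd.wa] at hb
        simp [hs₁, hb]
    have he₁ : Env s₁ n q ell K F := ((he.agree (c := .set vFound (.lit 0))
      (s' := s.set vFound (AExp.eval s (.lit 0)))
      ⟨fun x hx => by simp_all [Cmd.wv], fun _ _ => rfl⟩ rfl).agree ha rfl).agree hg₁ rfl
    have hC₁ : s₁.a aCur = Function.update (s.a aCur) v i := by simp [hs₁, hcv]
    have hA₁ : s₁.v vA = row (s.a aMem) n v i := by simp [hs₁, row]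
    refine checkAdj_runs he₁ hv (by rw [hg₁.1 vV rfl, eV])
      (by rw [hg₁.2 aUp rfl, hg₁.2 aUpl rfl, eU, eUl, hzs]) hzq
      (by rw [hA₁]; exact he.mem v hv i hi) ?_
    intro s₂ T₂ hg₂ hok₂ hT₂
    rw [hg₁.2 aY rfl, hg₁.2 aGadj rfl, hg₁.2 aMem rfl, eY, eG, eM, hA₁, hC₁] at hok₂
    have he₂ := he₁.agree hg₂ rfl
    have hC₂ : s₂.a aCur = Function.update (s.a aCur) v i := by rw [hg₂.2 aCur rfl, hC₁]
    have hU₂ : s₂.a aUp = s.a aUp := by rw [hg₂.2 aUp rfl, hg₁.2 aUp rfl, eU]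
    have hUl₂ : s₂.a aUpl = s.a aUpl := by rw [hg₂.2 aUpl rfl, hg₁.2 aUpl rfl, eUl]
    have hTab₂ : s₂.a aTab = s.a aTab := by rw [hg₂.2 aTab rfl, hg₁.2 aTab rfl, eT]
    refine checkTables_runs (ch := ch) he₂ (by
      rw [hg₂.2 aCh rfl, hg₁.2 aCh rfl, eCh, hg₂.1 vLen rfl, hg₁.1 vLen rfl, eL, hch]) ?_ ?_
    · intro w hw
      obtain ⟨ha, hb, hc⟩ := hup w hw
      rw [hUl₂, hU₂, hC₂]
      refine ⟨ha, hb, fun z hz => ?_⟩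
      by_cases hzv : z = v
      · rw [hzv, Function.update_self]
        exact hi.trans_le (he.sz v hv)
      · rw [Function.update_of_ne hzv]
        exact hcur z ((hc z hz).resolve_left hzv)
    intro s₃ T₃ hg₃ hok₃ hT₃
    rw [hUl₂, hU₂, hC₂, hTab₂] at hok₃
    have hf₃ : s₃.v vFound = s'.v vFound := by
      rw [hg₃.1 vFound rfl, hg₂.1 vFound rfl, hg₁.1 vFound rfl]
    have hC₃ : s₃.a aCur = Function.update (s.a aCur) v i := by rw [hg₃.2 aCur rfl, hC₂]
    have hOk₁ : s₁.v vOk ≠ 0 := by simp [hs₁]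
    have hiff : s₃.v vOk ≠ 0 ↔
        (s.a aY v ≠ 0 → ∀ z ∈ zs,
          s.a aGadj (row (s.a aMem) n v i * n + row (s.a aMem) n z (s.a aCur z)) ≠ 0) ∧
        ∀ w ∈ ch, s.a aTab (w * ell ^ K + encode ell (Function.update (s.a aCur) v i)
          (arrList (row (s.a aUp) n w) (s.a aUpl w))) ≠ 0 := by
      rw [hok₃, hok₂]
      refine and_congr_left fun _ => ?_
      refine ⟨fun h hy z hz => ?_, fun h => ⟨hOk₁, fun hy z hz => ?_⟩⟩
      · have := h.2 hy z hz
        rwa [Function.update_of_ne (ne_of_mem_of_not_mem hz hvz)] at this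
      · rw [Function.update_of_ne (ne_of_mem_of_not_mem hz hvz)]
        exact h hy z hz
    have hrec : (∀ z, z ≠ v → s₃.a aCur z = s.a aCur z) := by
      intro z hz
      rw [hC₃, Function.update_of_ne hz]
    have hT : T₂ + T₃ ≤ zs.length * 50 + ch.length * (20 * K + 50) + 20 := by omega
    simp only [runs_when, runs_set, AExp.eval, AExp.cost, St.set_v, St.set_a, if_true]
    refine ⟨fun h => ⟨⟨hrec, ?_⟩, by omega⟩, fun h => ⟨⟨hrec, ?_⟩, by omega⟩⟩
    · have := hiff.1 (by omega)
      simp only [ne_eq, one_ne_zero, not_false_eq_true, true_iff]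
      exact ⟨i, by omega, this⟩
    · rw [hf₃, h2]
      constructor
      · rintro ⟨j, hj, h⟩
        exact ⟨j, by omega, h⟩
      · rintro ⟨j, hj, h'⟩
        rcases Nat.lt_succ_iff_lt_or_eq.1 hj with hj | rfl
        · exact ⟨j, hj, h'⟩
        · have := hiff.2 h'
          omega
  · rintro s' T ha hj ⟨h1, h2⟩ hT hag
    refine post s' _ hag h2 ?_
    simp only [AExp.cost, Nat.sub_zero] at hT ⊢
    have : s.a aSz v * (zs.length * 50 + ch.length * (20 * K + 50) + 60 + (1 + 1 + 6)) ≤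
      s.a aSz v * (zs.length * 50 + ch.length * (20 * K + 50) + 70) :=
      Nat.mul_le_mul_left _ (by omega)
    omega

theorem Extends.congr {s s' : St} {n ell K v : ℕ} {zs ch : List ℕ} {cur cur' : ℕ → ℕ}
    (h1 : s'.a aSz v = s.a aSz v) (h2 : s'.a aY = s.a aY) (h3 : s'.a aGadj = s.a aGadj)
    (h4 : s'.a aMem = s.a aMem)
    (h5 : ∀ z ∈ zs, cur z = cur' z)
    (h6 : ∀ w ∈ ch, arrList (row (s'.a aUp) n w) (s'.a aUpl w) =
      arrList (row (s.a aUp) n w) (s.a aUpl w))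
    (h7 : ∀ w ∈ ch, ∀ z ∈ arrList (row (s.a aUp) n w) (s.a aUpl w), z = v ∨ z ∈ zs)
    (h8 : ∀ w ∈ ch, ∀ i < s.a aSz v, s'.a aTab (w * ell ^ K + encode ell (Function.update cur' v i)
        (arrList (row (s.a aUp) n w) (s.a aUpl w))) =
      s.a aTab (w * ell ^ K + encode ell (Function.update cur' v i)
        (arrList (row (s.a aUp) n w) (s.a aUpl w)))) :
    Extends s n ell K v zs ch cur ↔ Extends s' n ell K v zs ch cur' := by
  unfold Extends
  rw [h1, h2, h3, h4]
  refine exists_congr fun i => and_congr_right fun hi => and_congr ?_ ?_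
  · refine imp_congr_right fun _ => forall₂_congr fun z hz => ?_
    rw [h5 z hz]
  · refine forall₂_congr fun w hw => ?_
    rw [h6 w hw, h8 w hw i hi, encode_congr]
    intro z hz
    by_cases hzv : z = v
    · simp [hzv]
    · simp [hzv, h5 z ((h7 w hw z hz).resolve_left hzv)]

/-- Elimination of a node `v` with the alive neighbors `zs` and the tables of `ch` to be used. -/
theorem eliminate_runs {s : St} {Q : St → ℕ → Prop} {n q ell K v : ℕ} {F : ℕ → ℕ → Prop}
    {zs ch : List ℕ} (he : Env s n q ell K F) (hv : v < q) (hvV : s.v vV = v)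
    (hupl : s.a aUpl v = 0)
    (hzs : (arrList (row (s.a aFn) n v) (s.a aFl v)).filter (fun w => s.a aDead w = 0) = zs)
    (hch : (arrList (row (s.a aFn) n v) (s.a aFl v)).filter
        (fun w => s.a aDead w ≠ 0 ∧ s.a aCl w = 0) = ch)
    (hK : zs.length ≤ K)
    (hup : ∀ w ∈ ch, s.a aUpl w ≤ K ∧
      ∀ z ∈ arrList (row (s.a aUp) n w) (s.a aUpl w), z = v ∨ z ∈ zs)
    (post : ∀ s' T, Agree eliminate s s' →
      s'.a aDead = Function.update (s.a aDead) v 1 →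
      (∀ w, s'.a aCl w = if w ∈ ch then 1 else s.a aCl w) →
      arrList (row (s'.a aUp) n v) (s'.a aUpl v) = zs →
      (∀ c, c ≠ v → s'.a aUpl c = s.a aUpl c) →
      (∀ c i, c ≠ v → i < n → row (s'.a aUp) n c i = row (s.a aUp) n c i) →
      (∀ w x, w ≠ v → x < ell ^ K → s'.a aTab (w * ell ^ K + x) = s.a aTab (w * ell ^ K + x)) →
      (∀ cur, (∀ z ∈ zs, cur z < ell) → (s'.a aTab (v * ell ^ K + encode ell cur zs) ≠ 0 ↔
        Extends s n ell K v zs ch cur)) →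
      (s'.v vAns = if zs = [] ∧ s'.a aTab (v * ell ^ K) = 0 then 0 else s.v vAns) →
      T ≤ s.a aFl v * 50 + ell ^ zs.length *
        (s.a aSz v * (zs.length * 50 + ch.length * (20 * K + 50) + 70) + zs.length * 30 + 50)
          + 50 → Q s' T) :
    Runs eliminate s Q := by
  have hell := he.two_le
  have hpow : ell ^ zs.length ≤ ell ^ K := Nat.pow_le_pow_right (by omega) hK
  have hzF : ∀ z ∈ zs, F v z := by
    intro z hz
    rw [← hzs] at hz
    exact (he.nbr v hv z).1 (List.mem_filter.1 hz).1
  have hchF : ∀ z ∈ ch, F v z := by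
    intro z hz
    rw [← hch] at hz
    exact (he.nbr v hv z).1 (List.mem_filter.1 hz).1
  have hvz : v ∉ zs := fun h => he.irrefl v (hzF v h)
  have hvch : v ∉ ch := fun h => he.irrefl v (hchF v h)
  have hzq : ∀ z ∈ zs, z < q := fun z hz => (he.lt _ _ (hzF z hz)).2
  have hchq : ∀ z ∈ ch, z < q := fun z hz => (he.lt _ _ (hchF z hz)).2
  have hznd : zs.Nodup := hzs ▸ (he.nodup v hv).filter _
  refine Runs.of_agree ?_
  unfold eliminate
  rw [runs_seq, runs_put]
  set s₀ := s.put aDead (AExp.eval s ↟vV) (AExp.eval s (.lit 1)) with hs₀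
  have hg₀ : Agree (.put aDead (.lit 0) (.lit 0)) s s₀ := by
    constructor
    · intro x hx
      rfl
    · intro b hb
      simp [Cmd.wa] at hb
      simp [hs₀, hb]
  have he₀ := he.agree hg₀ rfl
  have hD₀ : s₀.a aDead = Function.update (s.a aDead) v 1 := by simp [hs₀, hvV]
  have hL₀ : ∀ w ∈ arrList (row (s.a aFn) n v) (s.a aFl v), s₀.a aDead w = s.a aDead w := by
    intro w hw
    rw [hD₀, Function.update_of_ne]
    rintro rfl
    exact he.irrefl w ((he.nbr w hv w).1 hw)
  rw [runs_seq]
  refine gatherNbrs_runs he₀ hv hvV (by rw [hg₀.2 aUpl rfl, hupl]) ?_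
  intro s₁ T₁ hg₁ hup₁ hch₁ hcl₁ hupl₁ hupr₁ hT₁
  have hzs₁ : arrList (row (s₁.a aUp) n v) (s₁.a aUpl v) = zs := by
    rw [hup₁, ← hzs, hg₀.2 aFn rfl, hg₀.2 aFl rfl]
    refine List.filter_congr fun w hw => ?_
    rw [hL₀ w hw]
  have hch₁' : arrList (s₁.a aCh) (s₁.v vLen) = ch := by
    rw [hch₁, ← hch, hg₀.2 aFn rfl, hg₀.2 aFl rfl, hg₀.2 aCl rfl]
    refine List.filter_congr fun w hw => ?_
    rw [hL₀ w hw]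
  rw [hch₁', hg₀.2 aCl rfl] at hcl₁
  rw [hg₀.2 aUpl rfl] at hupl₁
  rw [hg₀.2 aUp rfl] at hupr₁
  rw [hg₀.2 aFl rfl] at hT₁
  have he₁ := he₀.agree hg₁ rfl
  have hV₁ : s₁.v vV = v := by rw [hg₁.1 vV rfl, hg₀.1 vV rfl, hvV]
  have hlen₁ : s₁.a aUpl v = zs.length := by rw [← hzs₁, arrList_length]
  have hpw₁ : s₁.a aPw (s₁.a aUpl v) = ell ^ zs.length := by rw [hlen₁]; exact he₁.pw _ hK
  -- the lists of the children are the old ones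
  have hupw : ∀ w ∈ ch, arrList (row (s₁.a aUp) n w) (s₁.a aUpl w) =
      arrList (row (s.a aUp) n w) (s.a aUpl w) := by
    intro w hw
    have hwv := ne_of_mem_of_not_mem hw hvch
    rw [hupl₁ w hwv]
    exact arrList_congr fun i hi =>
      hupr₁ w i hwv (hi.trans_le ((hup w hw).1.trans he.K_le))
  have htab : ∀ w x, w ≠ v → x < ell ^ K → ∀ t < ell ^ zs.length,
      w * ell ^ K + x ≠ v * ell ^ K + t := by
    intro w x hw hx t ht h
    exact hw ((mul_add_inj hx (ht.trans_le hpow)).1 h).1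
  rw [runs_seq]
  refine Runs.forB (fun t s' =>
      (∀ w x, w ≠ v → x < ell ^ K → s'.a aTab (w * ell ^ K + x) = s.a aTab (w * ell ^ K + x)) ∧
      (∀ cur, (∀ z ∈ zs, cur z < ell) → encode ell cur zs < t →
        (s'.a aTab (v * ell ^ K + encode ell cur zs) ≠ 0 ↔ Extends s n ell K v zs ch cur)))
    0 (ell ^ zs.length)
    (s.a aSz v * (zs.length * 50 + ch.length * (20 * K + 50) + 70) + zs.length * 30 + 30)
    (Nat.zero_le _) rfl rfl ?_ ?_ ?_ ?_
  · intro k s' ha _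
    simp [ha.1 vV rfl, ha.2 aPw rfl, ha.2 aUpl rfl, hV₁, hpw₁]
  · refine ⟨fun w x _ _ => ?_, fun _ _ h => absurd h (Nat.not_lt_zero _)⟩
    rw [St.set_a, hg₁.2 aTab rfl, hg₀.2 aTab rfl]
  · rintro t s₂ - ht hg₂ hvT ⟨hI, hI'⟩
    have he₂ := he₁.agree hg₂ rfl
    have hV₂ : s₂.v vV = v := by rw [hg₂.1 vV rfl, hV₁]
    rw [runs_seq]
    refine decodeTuple_runs he₂ hv hV₂ (by rw [hg₂.2 aUp rfl, hg₂.2 aUpl rfl, hzs₁]) hznd hK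
      (by rwa [hvT]) ?_
    intro s₃ T₃ hg₃ hcode hdig hT₃
    have he₃ := he₂.agree hg₃ rfl
    have hV₃ : s₃.v vV = v := by rw [hg₃.1 vV rfl, hV₂]
    have hU₃ : s₃.a aUp = s₁.a aUp := by rw [hg₃.2 aUp rfl, hg₂.2 aUp rfl]
    have hUl₃ : s₃.a aUpl = s₁.a aUpl := by rw [hg₃.2 aUpl rfl, hg₂.2 aUpl rfl]
    have hSz : s₃.a aSz = s.a aSz := by
      rw [hg₃.2 aSz rfl, hg₂.2 aSz rfl, hg₁.2 aSz rfl, hg₀.2 aSz rfl]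
    have hTab₃ : s₃.a aTab = s₂.a aTab := hg₃.2 aTab rfl
    rw [runs_seq]
    refine tryVertices_runs (ch := ch) he₃ hv hV₃ (by rw [hU₃, hUl₃, hzs₁]) hzq hvz hdig
      (by rw [hg₃.2 aCh rfl, hg₂.2 aCh rfl, hg₃.1 vLen rfl, hg₂.1 vLen rfl, hch₁']) ?_ ?_
    · intro w hw
      rw [hU₃, hUl₃, hupw w hw]
      refine ⟨hchq w hw, ?_, (hup w hw).2⟩
      rw [hupl₁ w (ne_of_mem_of_not_mem hw hvch)]
      exact (hup w hw).1
    intro s₄ T₄ hg₄ hfound hT₄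
    have hV₄ : s₄.v vV = v := by rw [hg₄.1 vV rfl, hV₃]
    have hvT₄ : s₄.v vT = t := by rw [hg₄.1 vT rfl, hg₃.1 vT rfl, hvT]
    have hTb₄ : s₄.a aTb v = v * ell ^ K := (he₃.agree hg₄ rfl).tb v hv
    have hTab₄ : s₄.a aTab = s₂.a aTab := by rw [hg₄.2 aTab rfl, hTab₃]
    rw [hvT] at hcode
    rw [hSz] at hT₄
    simp only [runs_put, AExp.eval, AExp.cost, St.set_a, St.put_a, if_true, hV₄, hvT₄, hTb₄, hTab₄]
    refine ⟨⟨?_, ?_⟩, by omega⟩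
    · intro w x hw hx
      rw [Function.update_of_ne (htab w x hw hx t ht), hI w x hw hx]
    · intro cur hcur hlt
      rcases Nat.lt_succ_iff_lt_or_eq.1 hlt with hlt | heq
      · rw [Function.update_of_ne (by omega), hI' cur hcur hlt]
      · rw [heq, Function.update_self, hfound]
        refine (Extends.congr (by rw [hSz]) ?_ ?_ ?_ ?_ ?_ ?_ ?_).symm
        · rw [hg₃.2 aY rfl, hg₂.2 aY rfl, hg₁.2 aY rfl, hg₀.2 aY rfl]
        · rw [hg₃.2 aGadj rfl, hg₂.2 aGadj rfl, hg₁.2 aGadj rfl, hg₀.2 aGadj rfl]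
        · rw [hg₃.2 aMem rfl, hg₂.2 aMem rfl, hg₁.2 aMem rfl, hg₀.2 aMem rfl]
        · exact encode_inj hcur hdig (heq.trans hcode.symm)
        · intro w hw
          rw [hU₃, hUl₃, hupw w hw]
        · exact fun w hw => (hup w hw).2
        · intro w hw i hi
          rw [hTab₃]
          refine hI w _ (ne_of_mem_of_not_mem hw hvch) ?_
          refine (encode_lt hell fun z hz => ?_).trans_le (Nat.pow_le_pow_right (by omega) ?_)
          · by_cases hzv : z = v
            · rw [hzv, Function.update_self]
              exact hi.trans_le (he.sz v hv)
            · rw [Function.update_of_ne hzv]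
              exact hdig z (((hup w hw).2 z hz).resolve_left hzv)
          · rw [arrList_length]
            exact (hup w hw).1
  · rintro s₂ T₂ hg₂ hvT ⟨hI, hI'⟩ hT₂
    have hV₂ : s₂.v vV = v := by rw [hg₂.1 vV rfl, hV₁]
    have hTb₂ : s₂.a aTb v = v * ell ^ K := (he₁.agree hg₂ rfl).tb v hv
    have hUl₂ : s₂.a aUpl = s₁.a aUpl := hg₂.2 aUpl rfl
    have hUp₂ : s₂.a aUp = s₁.a aUp := hg₂.2 aUp rfl
    have hAns₂ : s₂.v vAns = s.v vAns := by
      rw [hg₂.1 vAns rfl, hg₁.1 vAns rfl, hg₀.1 vAns rfl]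
    have hfin : ∀ s' T', s'.a = s₂.a → (s'.v vAns = if zs = [] ∧ s₂.a aTab (v * ell ^ K) = 0
        then 0 else s.v vAns) → T' ≤ 20 →
        Agree eliminate s s' → Q s' (1 + 1 + 1 + (T₁ + (T₂ + T'))) := by
      intro s' T' ha hans hT' hag
      refine post s' _ hag ?_ ?_ ?_ ?_ ?_ ?_ ?_ ?_ ?_
      · rw [ha, hg₂.2 aDead rfl, hg₁.2 aDead rfl, hD₀]
      · rw [ha, hg₂.2 aCl rfl]; exact hcl₁
      · rw [ha, hUp₂, hUl₂, hzs₁]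
      · rw [ha, hUl₂]; exact hupl₁
      · rw [ha, hUp₂]; exact hupr₁
      · rw [ha]; exact hI
      · rw [ha]
        exact fun cur hcur => hI' cur hcur (encode_lt hell hcur)
      · rw [ha]; exact hans
      · simp only [AExp.cost, Nat.sub_zero] at hT₂
        have : ell ^ zs.length * (s.a aSz v * (zs.length * 50 + ch.length * (20 * K + 50) + 70) +
          zs.length * 30 + 30 + (1 + 1 + 1 + 6)) ≤ ell ^ zs.length *
          (s.a aSz v * (zs.length * 50 + ch.length * (20 * K + 50) + 70) + zs.length * 30 + 50) :=
          Nat.mul_le_mul_left _ (by omega)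
        omega
    simp only [runs_when, runs_set, AExp.eval, AExp.cost,
      hV₂, hTb₂, hUl₂, hlen₁]
    refine ⟨fun h1 => ⟨fun h2 => ?_, fun h2 => ?_⟩, fun h1 => ?_⟩
    · refine hfin _ _ rfl ?_ (by norm_num)
      have : zs = [] := List.length_eq_zero_iff.1 (by omega)
      simp [this]
      intro h; omega
    · refine hfin _ _ rfl ?_ (by norm_num)
      rw [hAns₂, if_neg]
      rintro ⟨_, h⟩; omega
    · refine hfin _ _ rfl ?_ (by norm_num)
      rw [hAns₂, if_neg]
      rintro ⟨h, _⟩; simp [h] at h1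

/-! ### The invariant of the elimination -/

/-- The elimination step, apart from its implementation. `D` is the set of eliminated nodes, `U` the
set of those whose tables `M` have not been used. An assignment of the nodes that are not eliminated
extends to one that satisfies the constraints of the eliminated constraint nodes if and only if it
passes all unused tables. -/
theorem elimination_step {q v : ℕ} {sz : ℕ → ℕ} {F : ℕ → ℕ → Prop} {Y D U : ℕ → Prop}
    {R : ℕ → ℕ → ℕ → ℕ → Prop} {M M' : ℕ → (ℕ → ℕ) → Prop} (hv : v < q) (hvD : ¬ D v)
    (hvF : ¬ F v v)
    (hY : Y v → ∀ z, F v z → ¬ D z)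
    (hU : ∀ w, U w → w ≠ v)
    (hM : ∀ w a i, (∀ c < q, a c < sz c) → i < sz v → U w → ¬ F v w →
      (M w (Function.update a v i) ↔ M w a))
    (hM' : ∀ w a, (∀ c < q, a c < sz c) → U w → ¬ F v w → (M' w a ↔ M w a))
    (hMv : ∀ a, (∀ c < q, a c < sz c) → (M' v a ↔ ∃ i < sz v,
      (Y v → ∀ z, F v z → R v i z (a z)) ∧ ∀ w, U w → F v w → M w (Function.update a v i)))
    (hinv : ∀ a, (∀ c < q, a c < sz c) → ((∃ a' : ℕ → ℕ, (∀ c < q, a' c < sz c) ∧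
      (∀ c, ¬ D c → a' c = a c) ∧ ∀ c, Y c → D c → ∀ z, F c z → R c (a' c) z (a' z)) ↔
      ∀ w, U w → M w a)) (a : ℕ → ℕ) (ha : ∀ c < q, a c < sz c) :
    (∃ a' : ℕ → ℕ, (∀ c < q, a' c < sz c) ∧ (∀ c, ¬ (D c ∨ c = v) → a' c = a c) ∧
      ∀ c, Y c → (D c ∨ c = v) → ∀ z, F c z → R c (a' c) z (a' z)) ↔
      ∀ w, ((U w ∧ ¬ F v w) ∨ w = v) → M' w a := by
  have hval : ∀ i < sz v, ∀ c < q, Function.update a v i c < sz c := by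
    intro i hi c hc
    by_cases h : c = v
    · subst h; simpa using hi
    · simpa [h] using ha c hc
  trans ∃ i < sz v, (∃ a' : ℕ → ℕ, (∀ c < q, a' c < sz c) ∧
      (∀ c, ¬ D c → a' c = Function.update a v i c) ∧
      ∀ c, Y c → D c → ∀ z, F c z → R c (a' c) z (a' z)) ∧
      (Y v → ∀ z, F v z → R v i z (a z))
  · constructor
    · rintro ⟨a', h1, h2, h3⟩
      refine ⟨a' v, h1 v hv, ⟨a', h1, fun c hc => ?_, fun c hc hD => h3 c hc (Or.inl hD)⟩, ?_⟩
      · by_cases h : c = v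
        · subst h; simp
        · simpa [h] using h2 c (by tauto)
      · intro hy z hz
        have hzv : z ≠ v := by rintro rfl; exact hvF hz
        rw [← h2 z (by have := hY hy z hz; tauto)]
        exact h3 v hy (Or.inr rfl) z hz
    · rintro ⟨i, hi, ⟨a', h1, h2, h3⟩, h4⟩
      have hav : a' v = i := by simpa using h2 v hvD
      refine ⟨a', h1, fun c hc => ?_, ?_⟩
      · push Not at hc
        simpa [hc.2] using h2 c hc.1
      · rintro c hc (hD | rfl) z hz
        · exact h3 c hc hD z hz
        · have hzv : z ≠ c := by rintro rfl; exact hvF hz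
          have := h2 z (hY hc z hz)
          rw [Function.update_of_ne hzv] at this
          rw [hav, this]
          exact h4 hc z hz
  · constructor
    · rintro ⟨i, hi, h1, h2⟩ w hw
      rw [hinv _ (hval i hi)] at h1
      rcases hw with ⟨hw, hF⟩ | rfl
      · rw [hM' w a ha hw hF, ← hM w a i ha hi hw hF]
        exact h1 w hw
      · rw [hMv a ha]
        exact ⟨i, hi, h2, fun w hw _ => h1 w hw⟩
    · intro h
      obtain ⟨i, hi, h1, h2⟩ := (hMv a ha).1 (h v (Or.inr rfl))
      refine ⟨i, hi, (hinv _ (hval i hi)).2 fun w hw => ?_, h1⟩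
      by_cases hF : F v w
      · exact h2 w hw hF
      · rw [hM w a i ha hi hw hF, ← hM' w a ha hw hF]
        exact h w (Or.inl ⟨hw, hF⟩)

/-- The list of the alive neighbors that a node had when it was eliminated. -/
def upList (s : St) (n c : ℕ) : List ℕ := arrList (row (s.a aUp) n c) (s.a aUpl c)

/-- The `i`-th vertex of the class `c` and the `j`-th vertex of the class `z` are adjacent. -/
def Compat (s : St) (n c i z j : ℕ) : Prop :=
  s.a aGadj (row (s.a aMem) n c i * n + row (s.a aMem) n z j) ≠ 0

/-- The invariant of the elimination. -/
structure ElimInv (s : St) (n q ell K : ℕ) (F : ℕ → ℕ → Prop) : Prop where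
  alive : ∀ c, s.a aDead c = 0 → s.a aCl c = 0 ∧ s.a aUpl c = 0
  mem_up : ∀ w < q, s.a aDead w ≠ 0 → s.a aCl w = 0 →
    ∀ z, z ∈ upList s n w ↔ s.a aDead z = 0 ∧ F w z
  clique : ∀ w < q, s.a aDead w ≠ 0 → s.a aCl w = 0 →
    ∀ z ∈ upList s n w, ∀ z' ∈ upList s n w, z ≠ z' → F z z'
  upl_le : ∀ w < q, s.a aDead w ≠ 0 → s.a aCl w = 0 → s.a aUpl w ≤ K
  sem : ∀ a : ℕ → ℕ, (∀ c < q, a c < s.a aSz c) →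
    ((∃ a' : ℕ → ℕ, (∀ c < q, a' c < s.a aSz c) ∧ (∀ c, ¬ s.a aDead c ≠ 0 → a' c = a c) ∧
      ∀ c, s.a aY c ≠ 0 → s.a aDead c ≠ 0 → ∀ z, F c z → Compat s n c (a' c) z (a' z)) ↔
    ∀ w, (w < q ∧ s.a aDead w ≠ 0 ∧ s.a aCl w = 0) →
      s.a aTab (w * ell ^ K + encode ell a (upList s n w)) ≠ 0)
  ans_le : s.v vAns ≤ 1
  ans : s.v vAns ≠ 0 ↔ ∀ w < q, s.a aDead w ≠ 0 → s.a aCl w = 0 → s.a aUpl w = 0 →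
    s.a aTab (w * ell ^ K) ≠ 0

/-- The number of nodes whose tables have been used. -/
def usedTables (s : St) (q : ℕ) : ℕ := ((Finset.range q).filter fun w => s.a aCl w ≠ 0).card

/-- The alive neighbors of the node `v`. -/
def aliveNbrs (s : St) (n v : ℕ) : List ℕ :=
  (arrList (row (s.a aFn) n v) (s.a aFl v)).filter (fun w => s.a aDead w = 0)

theorem Env.mem_aliveNbrs {s : St} {n q ell K v : ℕ} {F : ℕ → ℕ → Prop}
    (he : Env s n q ell K F) (hv : v < q) (z : ℕ) :
    z ∈ aliveNbrs s n v ↔ s.a aDead z = 0 ∧ F v z := by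
  simp [aliveNbrs, List.mem_filter, he.nbr v hv, and_comm]

/-- Eliminating a node whose alive neighbors form a clique keeps the invariant: by the clique
property a table that involves `v` only involves alive neighbors of `v` besides. The number `cn`
counts the tables used; each table is used once, which bounds the total time for lookups. -/
theorem eliminate_inv {s : St} {Q : St → ℕ → Prop} {n q ell K v : ℕ} {F : ℕ → ℕ → Prop}
    (he : Env s n q ell K F) (hI : ElimInv s n q ell K F) (hv : v < q) (hvV : s.v vV = v)
    (halive : s.a aDead v = 0) (hK : (aliveNbrs s n v).length ≤ K)
    (hclique : ∀ z z', s.a aDead z = 0 → F v z → s.a aDead z' = 0 → F v z' → z ≠ z' → F z z')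
    (hY : s.a aY v ≠ 0 → ∀ z, F v z → s.a aDead z = 0)
    (post : ∀ s' T cn, Agree eliminate s s' → ElimInv s' n q ell K F →
      s'.a aDead = Function.update (s.a aDead) v 1 →
      upList s' n v = aliveNbrs s n v →
      usedTables s' q = usedTables s q + cn →
      ((∀ z, F v z → s.a aDead z = 0) → cn = 0) →
      T ≤ s.a aFl v * 50 + ell ^ (aliveNbrs s n v).length *
        (s.a aSz v * ((aliveNbrs s n v).length * 50 + cn * (20 * K + 50) + 70) +
          (aliveNbrs s n v).length * 30 + 50) + 50 → Q s' T) :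
    Runs eliminate s Q := by
  have hell := he.two_le
  set zs := aliveNbrs s n v with hzs
  set ch := (arrList (row (s.a aFn) n v) (s.a aFl v)).filter
        (fun w => s.a aDead w ≠ 0 ∧ s.a aCl w = 0) with hch
  have hmz : ∀ z, z ∈ zs ↔ s.a aDead z = 0 ∧ F v z := he.mem_aliveNbrs hv
  have hmc : ∀ w, w ∈ ch ↔ F v w ∧ s.a aDead w ≠ 0 ∧ s.a aCl w = 0 := by
    intro w
    simp [hch, List.mem_filter, he.nbr v hv]
  have hchq : ∀ w ∈ ch, w < q := fun w hw => (he.lt _ _ ((hmc w).1 hw).1).2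
  have hchnd : ch.Nodup := (he.nodup v hv).filter _
  have hvch : v ∉ ch := fun h => he.irrefl v ((hmc v).1 h).1
  refine eliminate_runs he hv hvV (hI.alive v halive).2 hzs.symm hch.symm hK ?_ ?_
  · intro w hw
    have hw' := (hmc w).1 hw
    have hwq := hchq w hw
    refine ⟨hI.upl_le w hwq hw'.2.1 hw'.2.2, fun z hz => ?_⟩
    by_cases hzv : z = v
    · exact Or.inl hzv
    · right
      have hm := hI.mem_up w hwq hw'.2.1 hw'.2.2
      have hv' : v ∈ upList s n w := (hm v).2 ⟨halive, he.symm _ _ hw'.1⟩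
      exact (hmz z).2 ⟨((hm z).1 hz).1,
        hI.clique w hwq hw'.2.1 hw'.2.2 v hv' z hz (Ne.symm hzv)⟩
  · intro s' T hg hdead hcl hup_v hupl hupr htab htabv hans hT
    have eSz : s'.a aSz = s.a aSz := hg.2 aSz rfl
    have eY : s'.a aY = s.a aY := hg.2 aY rfl
    have eG : s'.a aGadj = s.a aGadj := hg.2 aGadj rfl
    have eM : s'.a aMem = s.a aMem := hg.2 aMem rfl
    have hdead' : ∀ c, s'.a aDead c ≠ 0 ↔ s.a aDead c ≠ 0 ∨ c = v := by
      intro c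
      rw [hdead]
      by_cases h : c = v
      · simp [h]
      · simp [h]
    have hdead0 : ∀ c, s'.a aDead c = 0 ↔ s.a aDead c = 0 ∧ c ≠ v := by
      intro c
      have := hdead' c
      tauto
    have hclv : s'.a aCl v = 0 := by rw [hcl, if_neg hvch]; exact (hI.alive v halive).1
    -- the nodes with unused tables afterwards
    have hU : ∀ w, (w < q ∧ s'.a aDead w ≠ 0 ∧ s'.a aCl w = 0) ↔
        ((w < q ∧ s.a aDead w ≠ 0 ∧ s.a aCl w = 0) ∧ ¬ F v w) ∨ w = v := by
      intro w
      by_cases hwv : w = v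
      · subst hwv
        simp [hv, hclv, (hdead' w).2]
      · rw [hdead' w, hcl w]
        have := hmc w
        by_cases hwc : w ∈ ch
        · simp [hwc, hwv]
          tauto
        · simp [hwc, hwv]
          tauto
    have hupw : ∀ w < q, w ≠ v → s.a aUpl w ≤ K → upList s' n w = upList s n w := by
      intro w hw hwv hle
      unfold upList
      rw [hupl w hwv]
      exact arrList_congr fun i hi => hupr w i hwv (by have := he.K_le; omega)
    have hUne : ∀ w, (w < q ∧ s.a aDead w ≠ 0 ∧ s.a aCl w = 0) → w ≠ v := by
      rintro w hw rfl
      exact hw.2.1 halive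
    have hsame : ∀ w, (w < q ∧ s.a aDead w ≠ 0 ∧ s.a aCl w = 0) → upList s' n w = upList s n w :=
      fun w hw => hupw w hw.1 (hUne w hw) (hI.upl_le w hw.1 hw.2.1 hw.2.2)
    have hupv : upList s' n v = zs := hup_v
    have henc : ∀ w a, (∀ c < q, a c < s.a aSz c) → (w < q ∧ s.a aDead w ≠ 0 ∧ s.a aCl w = 0) →
        encode ell a (upList s n w) < ell ^ K := by
      intro w a ha hw
      refine (encode_lt hell fun z hz => ?_).trans_le (Nat.pow_le_pow_right (by omega) ?_)
      · have hzq := (he.lt _ _ ((hI.mem_up w hw.1 hw.2.1 hw.2.2 z).1 hz).2).2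
        exact (ha z hzq).trans_le (he.sz z hzq)
      · rw [upList, arrList_length]
        exact hI.upl_le w hw.1 hw.2.1 hw.2.2
    refine post s' T ch.length hg ⟨?_, ?_, ?_, ?_, ?_, ?_, ?_⟩ hdead hup_v ?_ ?_ hT
    · intro c hc
      rw [hdead0] at hc
      have h := hI.alive c hc.1
      rw [hcl, hupl c hc.2, if_neg (fun hm => ((hmc c).1 hm).2.1 hc.1)]
      exact h
    · intro w hw h1 h2 z
      rcases (hU w).1 ⟨hw, h1, h2⟩ with ⟨hold, hF⟩ | rfl
      · rw [hsame w hold, hI.mem_up w hw hold.2.1 hold.2.2, hdead0]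
        refine ⟨fun h => ⟨⟨h.1, ?_⟩, h.2⟩, fun h => ⟨h.1.1, h.2⟩⟩
        rintro rfl
        exact hF (he.symm _ _ h.2)
      · rw [hupv, hmz, hdead0]
        refine ⟨fun h => ⟨⟨h.1, ?_⟩, h.2⟩, fun h => ⟨h.1.1, h.2⟩⟩
        rintro rfl
        exact he.irrefl _ h.2
    · intro w hw h1 h2
      rcases (hU w).1 ⟨hw, h1, h2⟩ with ⟨hold, hF⟩ | rfl
      · rw [hsame w hold]
        exact hI.clique w hw hold.2.1 hold.2.2
      · rw [hupv]
        intro z hz z' hz'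
        rw [hmz] at hz hz'
        exact hclique z z' hz.1 hz.2 hz'.1 hz'.2
    · intro w hw h1 h2
      rcases (hU w).1 ⟨hw, h1, h2⟩ with ⟨hold, hF⟩ | rfl
      · rw [hupl w (hUne w hold)]
        exact hI.upl_le w hw hold.2.1 hold.2.2
      · have := congrArg List.length hupv
        rw [upList, arrList_length] at this
        omega
    · intro a ha
      rw [eSz] at ha
      have key := elimination_step (q := q) (v := v) (sz := s.a aSz) (F := F)
        (Y := fun c => s.a aY c ≠ 0) (D := fun c => s.a aDead c ≠ 0)
        (U := fun w => w < q ∧ s.a aDead w ≠ 0 ∧ s.a aCl w = 0) (R := Compat s n)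
        (M := fun w a => s.a aTab (w * ell ^ K + encode ell a (upList s n w)) ≠ 0)
        (M' := fun w a => s'.a aTab (w * ell ^ K + encode ell a (upList s' n w)) ≠ 0)
        hv (by simpa using halive) (he.irrefl v) (fun hy z hz => by simpa using hY hy z hz) hUne
        ?_ ?_ ?_ hI.sem a ha
      · simp only [hU]
        simp only [hdead', eSz, eY]
        rw [← key]
        simp only [Compat, eG, eM]
      · intro w a i ha hi hw hF
        have : encode ell (Function.update a v i) (upList s n w) = encode ell a (upList s n w) := by
          refine encode_congr fun z hz => Function.update_of_ne ?_ _ _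
          rintro rfl
          exact hF (he.symm _ _ ((hI.mem_up w hw.1 hw.2.1 hw.2.2 z).1 hz).2)
        rw [this]
      · intro w a ha hw hF
        rw [hsame w hw, htab w _ (hUne w hw) (henc w a ha hw)]
      · intro a ha
        rw [hupv, htabv a (fun z hz => by
          have hzq := (he.lt _ _ ((hmz z).1 hz).2).2
          exact (ha z hzq).trans_le (he.sz z hzq))]
        refine exists_congr fun i => and_congr_right fun hi => and_congr ?_ ?_
        · refine imp_congr_right fun hy => forall_congr' fun z => ?_
          rw [hmz]
          have := hY hy z
          unfold Compat
          tauto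
        · refine forall_congr' fun w => ?_
          rw [hmc]
          have : F v w → w < q := fun h => (he.lt _ _ h).2
          unfold upList
          tauto
    · rw [hans]
      split_ifs
      · omega
      · exact hI.ans_le
    · have hzl : s'.a aUpl v = zs.length := by rw [← hupv, upList, arrList_length]
      have hstep : (∀ w < q, s'.a aDead w ≠ 0 → s'.a aCl w = 0 → s'.a aUpl w = 0 →
          s'.a aTab (w * ell ^ K) ≠ 0) ↔
        (s.v vAns ≠ 0 ∧ (zs = [] → s'.a aTab (v * ell ^ K) ≠ 0)) := by
        rw [hI.ans]
        constructor
        · intro h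
          refine ⟨fun w hw h1 h2 h3 => ?_, fun hz => ?_⟩
          · have hF : ¬ F v w := by
              intro hF
              have := (hI.mem_up w hw h1 h2 v).2 ⟨halive, he.symm _ _ hF⟩
              rw [upList, h3] at this
              simp at this
            have hwv := hUne w ⟨hw, h1, h2⟩
            have hnew := (hU w).2 (Or.inl ⟨⟨hw, h1, h2⟩, hF⟩)
            have := h w hw hnew.2.1 hnew.2.2 (by rw [hupl w hwv, h3])
            have ht := htab w 0 hwv (by positivity)
            simp only [add_zero] at ht
            rwa [ht] at this
          · have hnew := (hU v).2 (Or.inr rfl)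
            exact h v hv hnew.2.1 hnew.2.2 (by simp [hzl, hz])
        · rintro ⟨h, h'⟩ w hw h1 h2 h3
          rcases (hU w).1 ⟨hw, h1, h2⟩ with ⟨hold, hF⟩ | rfl
          · have hwv := hUne w hold
            have ht := htab w 0 hwv (by positivity)
            simp only [add_zero] at ht
            rw [ht]
            exact h w hw hold.2.1 hold.2.2 (by rw [← hupl w hwv, h3])
          · exact h' (List.length_eq_zero_iff.1 (by omega))
      rw [hstep, hans]
      split_ifs with h
      · simp [h.1, h.2]
      · push Not at h
        simp only [ne_eq, iff_self_and]
        exact fun _ => h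
    · unfold usedTables
      have : (Finset.range q).filter (fun w => s'.a aCl w ≠ 0) =
          (Finset.range q).filter (fun w => s.a aCl w ≠ 0) ∪ ch.toFinset := by
        ext w
        simp only [Finset.mem_filter, Finset.mem_range, Finset.mem_union, List.mem_toFinset, hcl]
        have := hchq w
        by_cases hw : w ∈ ch
        · simp [hw, this hw]
        · simp [hw]
      rw [this, Finset.card_union_of_disjoint, List.toFinset_card_of_nodup hchnd]
      rw [Finset.disjoint_left]
      intro w hw hw'
      rw [List.mem_toFinset] at hw'
      exact (Finset.mem_filter.1 hw).2 ((hmc w).1 hw').2.2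
    · intro h
      have : ch = [] := List.eq_nil_iff_forall_not_mem.2 fun w hw => by
        have h1 := (hmc w).1 hw
        exact h1.2.1 (h w h1.1)
      rw [this]; rfl

/-! ### Eliminating all nodes -/

/-- What the elimination needs to know about the graph `F`: the constraint nodes are independent and
simplicial, the other nodes induce a chordal graph without large cliques. Of the neighbor list of
another node, the part from position `aHl` on holds the neighbors that are not constraint nodes. -/
structure FillGraph (s : St) (n q K Δ : ℕ) (F : ℕ → ℕ → Prop) : Prop where
  fadj : ∀ a < q, ∀ b < q, s.a aFadj (a * n + b) ≠ 0 ↔ F a b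
  indep : ∀ y z, s.a aY y ≠ 0 → F y z → s.a aY z = 0
  simplicial : ∀ y z z', s.a aY y ≠ 0 → F y z → F y z' → z ≠ z' → F z z'
  deg : ∀ y < q, s.a aY y ≠ 0 → s.a aFl y ≤ K
  hl_le : ∀ x < q, s.a aHl x ≤ s.a aFl x
  fl_le : ∀ x < q, s.a aY x = 0 → s.a aFl x ≤ s.a aHl x + Δ
  mem : ∀ x < q, s.a aY x = 0 → ∀ z, (∃ i, s.a aHl x ≤ i ∧ i < s.a aFl x ∧
    row (s.a aFn) n x i = z) ↔ F x z ∧ s.a aY z = 0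
  exists_simplicial : ∀ S : Set ℕ, S.Nonempty → (∀ x ∈ S, x < q ∧ s.a aY x = 0) →
    ∃ x ∈ S, ∀ z ∈ S, ∀ z' ∈ S, F x z → F x z' → z ≠ z' → F z z'
  clique_card : ∀ C : Finset ℕ, (∀ x ∈ C, s.a aY x = 0) →
    (∀ z ∈ C, ∀ z' ∈ C, z ≠ z' → F z z') → 2 ≤ C.card → C.card ≤ K

/-- The command does not write to the data of `FillGraph`. -/
def Cmd.keepsFill (c : Cmd) : Bool :=
  !(c.wa aFadj || c.wa aY || c.wa aFl || c.wa aHl || c.wa aFn)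

theorem FillGraph.agree {s s' : St} {n q K Δ : ℕ} {F : ℕ → ℕ → Prop} (h : FillGraph s n q K Δ F)
    {c : Cmd} (ha : Agree c s s') (hc : c.keepsFill = true) : FillGraph s' n q K Δ F := by
  simp only [Cmd.keepsFill, Bool.not_eq_true', Bool.or_eq_false_iff, and_assoc] at hc
  obtain ⟨h1, h2, h3, h4, h5⟩ := hc
  have e1 := ha.2 _ h1
  have e2 := ha.2 _ h2
  have e3 := ha.2 _ h3
  have e4 := ha.2 _ h4
  have e5 := ha.2 _ h5
  obtain ⟨a1, a2, a3, a4, a5, a6, a7, a8, a9⟩ := h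
  constructor <;> (try simp only [e1, e2, e3, e4, e5]) <;> assumption

theorem sub_add_sub_pos {a b : ℕ} : 0 < a - b + (b - a) ↔ a ≠ b := by omega

/-- Only the neighbors outside the constraint nodes are compared, those from position `aHl` on. -/
theorem checkSimplicial_runs {s : St} {Q : St → ℕ → Prop} {n q ell K Δ v : ℕ} {F : ℕ → ℕ → Prop}
    (he : Env s n q ell K F) (hF : FillGraph s n q K Δ F) (hv : v < q) (hvV : s.v vV = v)
    (hvY : s.a aY v = 0)
    (post : ∀ s' T, Agree checkSimplicial s s' →
      (s'.v vBad = 0 ↔ ∀ z z', F v z → s.a aY z = 0 → s.a aDead z = 0 → F v z' → s.a aY z' = 0 →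
        s.a aDead z' = 0 → z ≠ z' → F z z') →
      T ≤ 100 * (Δ + 1) ^ 2 → Q s' T) :
    Runs checkSimplicial s Q := by
  refine Runs.of_agree ?_
  unfold checkSimplicial
  rw [runs_seq, runs_set]
  set f := row (s.a aFn) n v with hf
  -- the condition on the positions `i` and `j` of the neighbor list
  let P : ℕ → ℕ → Prop := fun i j => s.a aDead (f i) = 0 → s.a aDead (f j) = 0 → f i ≠ f j →
    s.a aFadj (f i * n + f j) ≠ 0
  have hhl := hF.hl_le v hv
  have hfl := hF.fl_le v hv hvY
  have hfq : ∀ i, s.a aHl v ≤ i → i < s.a aFl v → f i < q := fun i h1 h2 =>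
    (he.lt _ _ ((hF.mem v hv hvY _).1 ⟨i, h1, h2, rfl⟩).1).2
  refine Runs.forB (fun k s' => s'.v vBad = 0 ↔ ∀ i j, s.a aHl v ≤ i → i < k → s.a aHl v ≤ j →
    j < s.a aFl v → P i j)
    (s.a aHl v) (s.a aFl v) (Δ * 60 + 30) hhl rfl (by simp [hvV]) ?_ ?_ ?_ ?_
  · intro k s' ha _
    simp [ha.2 aFl rfl, ha.1 vV rfl, hvV]
  · simp
    intro i j h1 h2; omega
  · rintro i s' hi hi' ha hj h1
    have eV : s'.v vV = v := by rw [ha.1 vV rfl]; simpa using hvV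
    have eR : s'.a aRow v = v * n := by rw [ha.2 aRow rfl]; exact he.rowA v (hv.trans_le he.le)
    have eF : s'.a aFn = s.a aFn := by rw [ha.2 aFn rfl]; rfl
    have eHl : s'.a aHl = s.a aHl := by rw [ha.2 aHl rfl]; rfl
    have eFl : s'.a aFl = s.a aFl := by rw [ha.2 aFl rfl]; rfl
    rw [runs_seq, runs_set]
    have hA : AExp.eval s' (aFn⟪aRow⟪↟vV⟫ +ₑ ↟vI⟫) = f i := by
      simp [eV, eR, eF, hj, hf, row]
    rw [hA]
    refine Runs.forB (fun k s₂ => s₂.v vBad = 0 ↔ s'.v vBad = 0 ∧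
      ∀ j, s.a aHl v ≤ j → j < k → P i j)
      (s.a aHl v) (s.a aFl v) 50 hhl rfl (by simp [eV, eHl]) ?_ ?_ ?_ ?_
    · intro k s₂ ha₂ _
      simp [ha₂.2 aFl rfl, ha₂.1 vV rfl, eV, eFl]
    · simp
      intro _ j h1 h2; omega
    · rintro j s₂ hjl hju ha₂ hj₂ h2
      have eV₂ : s₂.v vV = v := by rw [ha₂.1 vV rfl]; simpa using eV
      have eA₂ : s₂.v vA = f i := by rw [ha₂.1 vA rfl]; simp
      have eR₂ : s₂.a aRow = s.a aRow := by rw [ha₂.2 aRow rfl, St.set_a, ha.2 aRow rfl]; rfl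
      have eF₂ : s₂.a aFn = s.a aFn := by rw [ha₂.2 aFn rfl]; exact eF
      have eD₂ : s₂.a aDead = s.a aDead := by rw [ha₂.2 aDead rfl, St.set_a, ha.2 aDead rfl]; rfl
      have eJ₂ : s₂.a aFadj = s.a aFadj := by rw [ha₂.2 aFadj rfl, St.set_a, ha.2 aFadj rfl]; rfl
      have hRv : s.a aRow v = v * n := he.rowA v (hv.trans_le he.le)
      have hRi : s.a aRow (f i) = f i * n := he.rowA _ ((hfq i hi hi').trans_le he.le)
      have hfj : s.a aFn (v * n + j) = f j := rfl
      have hsucc : (∀ j', s.a aHl v ≤ j' → j' < j + 1 → P i j') ↔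
          (∀ j', s.a aHl v ≤ j' → j' < j → P i j') ∧ P i j := by
        constructor
        · exact fun h => ⟨fun j' h1 h2 => h j' h1 (by omega), h j hjl (by omega)⟩
        · rintro ⟨h, h'⟩ j' h1 h2
          rcases Nat.lt_succ_iff_lt_or_eq.1 h2 with h2 | rfl
          · exact h j' h1 h2
          · exact h'
      rw [hsucc]
      simp only [runs_seq, runs_set, AExp.eval, AExp.cost, St.set_v, St.set_a, runs_when,
        reduceCtorEq, if_true, if_false, eV₂, eA₂, eR₂, eF₂, eD₂, eJ₂, hRv, hRi, hj₂, hfj,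
        sub_add_sub_pos]
      refine ⟨fun c1 => ⟨fun c2 => ⟨fun c3 => ⟨fun c4 => ⟨?_, by norm_num⟩,
        fun c4 => ⟨?_, by norm_num⟩⟩, fun c3 => ⟨?_, by norm_num⟩⟩, fun c2 => ⟨?_, by norm_num⟩⟩,
        fun c1 => ⟨?_, by norm_num⟩⟩
      · simp only [false_iff, not_and]
        intro _ _ hP
        exact hP (by omega) (by omega) c3 (by omega)
      all_goals
        rw [h2]
        refine and_congr_right fun _ => ⟨fun h => ⟨h, fun d1 d2 d3 => ?_⟩, fun h => h.1⟩
        omega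
    · rintro s₂ T₂ ha₂ hj₂ h2 hT₂
      constructor
      · rw [St.set_v, if_neg (by decide), h2, h1]
        constructor
        · rintro ⟨h, h'⟩ i' j' d1 d2 d3 d4
          rcases Nat.lt_succ_iff_lt_or_eq.1 d2 with d2 | rfl
          · exact h i' j' d1 d2 d3 d4
          · exact h' j' d3 d4
        · exact fun h => ⟨fun i' j' d1 d2 d3 d4 => h i' j' d1 (by omega) d3 d4,
            fun j' d3 d4 => h i j' hi (by omega) d3 d4⟩
      · simp only [AExp.cost] at hT₂ ⊢
        have : (s.a aFl v - s.a aHl v) * (50 + (1 + 1 + 6)) ≤ Δ * 60 :=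
          Nat.mul_le_mul (by omega) (by omega)
        omega
  · rintro s' T ha hj h1 hT hag
    refine post s' _ hag ?_ ?_
    · rw [h1]
      constructor
      · intro h z z' d1 d2 d3 d4 d5 d6 d7
        obtain ⟨i, hi, hi', rfl⟩ := (hF.mem v hv hvY z).2 ⟨d1, d2⟩
        obtain ⟨j, hj, hj', rfl⟩ := (hF.mem v hv hvY z').2 ⟨d4, d5⟩
        exact (hF.fadj _ (hfq i hi hi') _ (hfq j hj hj')).1 (h i j hi hi' hj hj' d3 d6 d7)
      · intro h i j hi hi' hj hj' d3 d6 d7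
        have d1 := (hF.mem v hv hvY _).1 ⟨i, hi, hi', rfl⟩
        have d4 := (hF.mem v hv hvY _).1 ⟨j, hj, hj', rfl⟩
        exact (hF.fadj _ (hfq i hi hi') _ (hfq j hj hj')).2
          (h _ _ d1.1 d1.2 d3 d4.1 d4.2 d6 d7)
    · simp only [AExp.cost] at hT ⊢
      have : (s.a aFl v - s.a aHl v) * (Δ * 60 + 30 + (1 + 1 + 6)) ≤ Δ * (Δ * 60 + 38) :=
        Nat.mul_le_mul (by omega) (by omega)
      nlinarith

theorem pushNbrs_runs {s : St} {Q : St → ℕ → Prop} {n q ell K v : ℕ} {F : ℕ → ℕ → Prop}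
    (he : Env s n q ell K F) (hv : v < q) (hvV : s.v vV = v)
    (post : ∀ s' T, Agree pushNbrs s s' → s'.v vTop = s.v vTop + (upList s n v).length →
      arrList (s'.a aStk) (s'.v vTop) = arrList (s.a aStk) (s.v vTop) ++ upList s n v →
      T ≤ (upList s n v).length * 30 + 10 → Q s' T) :
    Runs pushNbrs s Q := by
  refine Runs.of_agree ?_
  unfold pushNbrs
  have hlen : (upList s n v).length = s.a aUpl v := by simp [upList]
  rw [hlen] at post
  refine Runs.forB (fun k s' => s'.v vTop = s.v vTop + k ∧ arrList (s'.a aStk) (s'.v vTop) =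
      arrList (s.a aStk) (s.v vTop) ++ arrList (row (s.a aUp) n v) k)
    0 (s.a aUpl v) 13 (Nat.zero_le _) rfl rfl ?_ ?_ ?_ ?_
  · intro k s' ha _
    simp [ha.2 aUpl rfl, ha.1 vV rfl, hvV]
  · simp
  · rintro k s' - hk ha hj ⟨h1, h2⟩
    have eV : s'.v vV = v := by rw [ha.1 vV rfl]; simpa using hvV
    have eR : s'.a aRow v = v * n := by rw [ha.2 aRow rfl]; exact he.rowA v (hv.trans_le he.le)
    have eU : s'.a aUp = s.a aUp := ha.2 aUp rfl
    simp only [runs_seq, runs_set, runs_put, AExp.eval, AExp.cost, St.set_v, St.set_a, St.put_a,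
      St.put_v, reduceCtorEq, if_true, if_false, eV, eR, eU, hj]
    refine ⟨⟨by omega, ?_⟩, by norm_num⟩
    rw [arrList_push, h2, arrList_succ, List.append_assoc]
    rfl
  · rintro s' T ha hj ⟨h1, h2⟩ hT hag
    refine post s' _ hag h1 h2 ?_
    simp only [AExp.cost, Nat.sub_zero] at hT
    omega

/-- Bound for the time spent on eliminating one node, up to the uses of tables. -/
def nodeCost (s : St) (ell K v : ℕ) : ℕ :=
  s.a aFl v * 50 + ell ^ max K 1 * (s.a aSz v + 1) * (80 * max K 1 + 120) + 100

theorem elimInv_init {s : St} {n q ell K : ℕ} {F : ℕ → ℕ → Prop}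
    (hD : ∀ c, s.a aDead c = 0) (hC : ∀ c, s.a aCl c = 0) (hU : ∀ c, s.a aUpl c = 0)
    (hA : s.v vAns = 1) : ElimInv s n q ell K F := by
  refine ⟨fun c _ => ⟨hC c, hU c⟩, fun w _ h => absurd (hD w) h, fun w _ h => absurd (hD w) h,
    fun w _ h => absurd (hD w) h, fun a ha => ⟨fun _ w hw => absurd (hD w) hw.2.1, fun _ =>
    ⟨a, ha, fun _ _ => rfl, fun c _ h => absurd (hD c) h⟩⟩, hA.le, ?_⟩
  simp [hA, hD]

theorem elimPhaseY_runs {s : St} {Q : St → ℕ → Prop} {n q ell K Δ : ℕ} {F : ℕ → ℕ → Prop}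
    (he : Env s n q ell K F) (hF : FillGraph s n q K Δ F) (hI : ElimInv s n q ell K F)
    (hD : ∀ c, s.a aDead c = 0)
    (post : ∀ s' T, Agree elimPhaseY s s' → ElimInv s' n q ell K F →
      (∀ c, s'.a aDead c ≠ 0 ↔ c < q ∧ s.a aY c ≠ 0) →
      T ≤ ∑ v ∈ Finset.range q, nodeCost s ell K v + 10 → Q s' T) :
    Runs elimPhaseY s Q := by
  refine Runs.of_agree ?_
  unfold elimPhaseY
  refine Runs.forT (fun k s' T => ElimInv s' n q ell K F ∧
      (∀ c, s'.a aDead c ≠ 0 ↔ c < k ∧ s.a aY c ≠ 0) ∧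
      T ≤ ∑ v ∈ Finset.range k, nodeCost s ell K v + 2)
    0 q (Nat.zero_le _) rfl rfl ?_ ?_ ?_ ?_
  · intro k s' T ha _
    simp [ha.1 vQ rfl, he.vQ]
  · refine ⟨?_, by simp [hD], by simp⟩
    obtain ⟨h1, h2, h3, h4, h5, h6, h7⟩ := hI
    exact ⟨h1, h2, h3, h4, h5, by simpa using h6, by simpa using h7⟩
  · rintro v s' T - hv ha hvV ⟨hI', hD', hT⟩
    have he' := he.agree ha rfl
    have hF' := hF.agree ha rfl
    have eY : s'.a aY = s.a aY := ha.2 aY rfl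
    rw [runs_when]
    simp only [AExp.eval, AExp.cost, hvV, eY]
    have fin : ∀ s'' t, ElimInv s'' n q ell K F →
        (∀ c, s''.a aDead c ≠ 0 ↔ c < v + 1 ∧ s.a aY c ≠ 0) →
        t ≤ nodeCost s ell K v →
        ElimInv (s''.set vV (v + 1)) n q ell K F ∧
        (∀ c, (s''.set vV (v + 1)).a aDead c ≠ 0 ↔ c < v + 1 ∧ s.a aY c ≠ 0) ∧
        T + t ≤ ∑ v ∈ Finset.range (v + 1), nodeCost s ell K v + 2 := by
      intro s'' t hI'' hD'' ht
      refine ⟨?_, hD'', ?_⟩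
      · obtain ⟨h1, h2, h3, h4, h5, h6, h7⟩ := hI''
        exact ⟨h1, h2, h3, h4, h5, by simpa using h6, by simpa using h7⟩
      · rw [Finset.sum_range_succ]
        omega
    refine ⟨fun hy => ?_, fun hy => ?_⟩
    · have hy' : s'.a aY v ≠ 0 := by rw [eY]; omega
      have halive : ∀ z, F v z → s'.a aDead z = 0 := by
        intro z hz
        by_contra h
        exact ((hD' z).1 h).2 (by rw [← eY]; exact hF'.indep v z hy' hz)
      have hd : s'.a aDead v = 0 := by
        by_contra h
        have := ((hD' v).1 h).1
        omega
      have hlenfl : (aliveNbrs s' n v).length ≤ s'.a aFl v := by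
        refine (List.length_filter_le _ _).trans ?_
        rw [arrList_length]
      have hK : (aliveNbrs s' n v).length ≤ K := hlenfl.trans (hF'.deg v hv hy')
      refine eliminate_inv he' hI' hv hvV hd hK
        (fun z z' _ h1 _ h2 h3 => hF'.simplicial v z z' hy' h1 h2 h3) (fun _ => halive) ?_
      intro s'' t cn hg hI'' hdead _ _ hcn ht
      rw [hcn halive] at ht
      rw [add_assoc T]
      refine fin s'' _ hI'' ?_ ?_
      · intro c
        rw [hdead]
        by_cases hc : c = v
        · subst hc
          simp; omega
        · rw [Function.update_of_ne hc, hD' c]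
          refine and_congr_left fun _ => ?_
          omega
      · have e1 : s'.a aFl = s.a aFl := ha.2 aFl rfl
        have e2 : s'.a aSz = s.a aSz := ha.2 aSz rfl
        rw [e1, e2] at ht
        set p := (aliveNbrs s' n v).length
        have hp : p ≤ max K 1 := hK.trans (le_max_left _ _)
        have h1 : ell ^ p * (s.a aSz v * (p * 50 + 0 * (20 * K + 50) + 70) + p * 30 + 50) ≤
            ell ^ max K 1 * ((s.a aSz v + 1) * (80 * max K 1 + 120)) := by
          refine Nat.mul_le_mul (Nat.pow_le_pow_right (by have := he.two_le; omega) hp) ?_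
          nlinarith [Nat.zero_le (s.a aSz v), Nat.mul_le_mul_left (s.a aSz v) hp]
        unfold nodeCost
        rw [mul_assoc]
        omega
    · rw [add_assoc T]
      refine fin s' _ hI' ?_ ?_
      · intro c
        rw [hD' c]
        constructor
        · exact fun h => ⟨by omega, h.2⟩
        · rintro ⟨h1, h2⟩
          refine ⟨?_, h2⟩
          rcases Nat.lt_succ_iff_lt_or_eq.1 h1 with h | rfl
          · exact h
          · omega
      · unfold nodeCost; omega
  · rintro s' T ha hvV ⟨hI', hD', hT⟩ hag
    refine post s' _ hag hI' hD' ?_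
    simp only [AExp.cost]
    omega

theorem pushPhase_runs {s : St} {Q : St → ℕ → Prop} {q : ℕ} (hq : s.v vQ = q)
    (post : ∀ s' T, Agree pushPhase s s' → s'.v vTop ≤ q →
      (∀ x, x ∈ arrList (s'.a aStk) (s'.v vTop) ↔ x < q ∧ s.a aY x = 0) →
      T ≤ q * 30 + 10 → Q s' T) :
    Runs pushPhase s Q := by
  refine Runs.of_agree ?_
  unfold pushPhase
  rw [runs_seq, runs_set]
  refine Runs.forB (fun k s' => s'.v vTop ≤ k ∧
      ∀ x, x ∈ arrList (s'.a aStk) (s'.v vTop) ↔ x < k ∧ s.a aY x = 0)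
    0 q 13 (Nat.zero_le _) rfl rfl ?_ ?_ ?_ ?_
  · intro k s' ha _
    simp [ha.1 vQ rfl, hq]
  · simp
  · rintro v s' - hk ha hv ⟨h1, h2⟩
    have eY : s'.a aY = s.a aY := ha.2 aY rfl
    simp only [runs_when, runs_seq, runs_set, runs_put, AExp.eval, AExp.cost, St.set_v, St.set_a,
      St.put_a, St.put_v, reduceCtorEq, if_true, if_false, hv, eY]
    refine ⟨fun h => ⟨⟨by omega, fun x => ?_⟩, by norm_num⟩,
      fun h => ⟨⟨by omega, fun x => ?_⟩, by norm_num⟩⟩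
    · rw [arrList_push, List.mem_append, h2, List.mem_singleton]
      constructor
      · rintro (h' | rfl)
        · exact ⟨by omega, h'.2⟩
        · exact ⟨by omega, by omega⟩
      · rintro ⟨h3, h4⟩
        rcases Nat.lt_succ_iff_lt_or_eq.1 h3 with h3 | rfl
        · exact Or.inl ⟨h3, h4⟩
        · exact Or.inr rfl
    · rw [h2]
      refine and_congr_left fun h4 => ?_
      constructor
      · omega
      · intro h3
        rcases Nat.lt_succ_iff_lt_or_eq.1 h3 with h3 | rfl
        · exact h3
        · omega
  · rintro s' T ha hj ⟨h1, h2⟩ hT hag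
    refine post s' _ hag h1 h2 ?_
    simp only [AExp.cost, Nat.sub_zero] at hT ⊢
    omega

/-- Time for taking a node from the stack and testing it. -/
def popCost (Δ : ℕ) : ℕ := 100 * (Δ + 1) ^ 2 + 60

/-- Bound for the time caused by eliminating a node that is not a constraint node, up to the uses of
tables: besides the elimination, this pays for the tests of its neighbors. -/
def nodeCostX (s : St) (ell K Δ v : ℕ) : ℕ :=
  s.a aFl v * 50 + ell ^ max K 1 * (80 * max K 1 + 120) + 100 + (popCost Δ + 30) * max K 1

/-- The nodes that remain after the constraint nodes induce a chordal graph. A node whose alive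
neighbors are not pairwise adjacent is dropped from the stack, and pushed again when a neighbor is
eliminated, since only then can the situation have changed. An elimination pushes fewer than `K`
nodes, as a node and its alive neighbors form a clique; this pays for all but the first `q` tests.
-/
theorem elimPhaseX_runs {s : St} {Q : St → ℕ → Prop} {n q ell K Δ : ℕ} {F : ℕ → ℕ → Prop}
    (he : Env s n q ell K F) (hF : FillGraph s n q K Δ F) (hI : ElimInv s n q ell K F)
    (hD : ∀ c, s.a aDead c ≠ 0 ↔ c < q ∧ s.a aY c ≠ 0)
    (hS : ∀ x, x ∈ arrList (s.a aStk) (s.v vTop) ↔ x < q ∧ s.a aY x = 0)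
    (post : ∀ s' T, Agree elimPhaseX s s' → ElimInv s' n q ell K F →
      (∀ c < q, s'.a aDead c ≠ 0) →
      T ≤ popCost Δ * s.v vTop + ∑ v ∈ Finset.range q, nodeCostX s ell K Δ v +
        ell ^ max K 1 * (20 * K + 50) * q + 10 → Q s' T) :
    Runs elimPhaseX s Q := by
  refine Runs.of_agree ?_
  unfold elimPhaseX
  set deadX : St → Finset ℕ := fun s' =>
    (Finset.range q).filter fun v => s'.a aDead v ≠ 0 ∧ s.a aY v = 0 with hdeadX
  set aliveX : St → Finset ℕ := fun s' => (Finset.range q).filter fun v => s'.a aDead v = 0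
    with haliveX
  have hell := he.two_le
  -- an alive node that is not on the stack has two alive neighbors that are not adjacent; the time
  -- is paid for by the nodes taken from the stack, the eliminated nodes and the used tables
  refine Runs.loop (fun s' T => ElimInv s' n q ell K F ∧
      (∀ y < q, s.a aY y ≠ 0 → s'.a aDead y ≠ 0) ∧
      (∀ x ∈ arrList (s'.a aStk) (s'.v vTop), x < q ∧ s.a aY x = 0) ∧
      (∀ x < q, s'.a aDead x = 0 → x ∉ arrList (s'.a aStk) (s'.v vTop) →
        ∃ z z', s'.a aDead z = 0 ∧ F x z ∧ s'.a aDead z' = 0 ∧ F x z' ∧ z ≠ z' ∧ ¬ F z z') ∧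
      T + popCost Δ * s'.v vTop ≤ popCost Δ * s.v vTop + ∑ v ∈ deadX s', nodeCostX s ell K Δ v +
        ell ^ max K 1 * (20 * K + 50) * usedTables s' q)
    (fun s' => s'.v vTop + (K + 1) * (aliveX s').card) ?_ ?_ ?_
  · refine ⟨hI, fun y hy h => (hD y).2 ⟨hy, h⟩, fun x hx => (hS x).1 hx, fun x hx hd hn => ?_, ?_⟩
    · refine absurd ((hS x).2 ⟨hx, ?_⟩) hn
      by_contra h
      exact (hD x).2 ⟨hx, h⟩ hd
    · omega
  · rintro s' T ha ⟨hI', hY', hS', hN', hT⟩ hpos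
    simp only [AExp.eval] at hpos
    obtain ⟨top, htop⟩ : ∃ top, s'.v vTop = top + 1 := ⟨s'.v vTop - 1, by omega⟩
    rw [htop] at hS' hN' hT
    set v := s'.a aStk top with hvdef
    rw [arrList_succ, ← hvdef] at hS' hN'
    obtain ⟨hv, hvY⟩ := hS' v (by simp)
    simp only [runs_seq, runs_set, AExp.eval, AExp.cost, St.set_v, St.set_a, if_true, htop,
      Nat.add_sub_cancel, reduceCtorEq, if_false, runs_when (e := aDead⟪↟vV⟫), ← hvdef]
    set s₁ := (s'.set vTop top).set vV v with hs₁
    have hg₁ : Agree (.set vTop (.lit 0) ;; .set vV (.lit 0)) s' s₁ := by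
      constructor
      · intro x hx
        simp [Cmd.wv] at hx
        simp [hs₁, hx]
      · intro b hb
        rfl
    have he' := he.agree ha rfl
    have hF' := hF.agree ha rfl
    have eY' : s'.a aY = s.a aY := ha.2 aY rfl
    have e1 : s'.a aFl = s.a aFl := ha.2 aFl rfl
    have e2 : s'.a aSz = s.a aSz := ha.2 aSz rfl
    have hpc : 100 * (Δ + 1) ^ 2 + 60 = popCost Δ := rfl
    -- the node is not eliminated, because this has happened before or it is not simplicial
    have stay : ∀ s₂ t, s₂.a = s'.a → s₂.v vAns = s'.v vAns → s₂.v vTop = top →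
        (s'.a aDead v = 0 → ∃ z z', s'.a aDead z = 0 ∧ F v z ∧ s'.a aDead z' = 0 ∧ F v z' ∧
          z ≠ z' ∧ ¬ F z z') → t ≤ popCost Δ →
        (ElimInv s₂ n q ell K F ∧
        (∀ y < q, s.a aY y ≠ 0 → s₂.a aDead y ≠ 0) ∧
        (∀ x ∈ arrList (s₂.a aStk) (s₂.v vTop), x < q ∧ s.a aY x = 0) ∧
        (∀ x < q, s₂.a aDead x = 0 → x ∉ arrList (s₂.a aStk) (s₂.v vTop) →
          ∃ z z', s₂.a aDead z = 0 ∧ F x z ∧ s₂.a aDead z' = 0 ∧ F x z' ∧ z ≠ z' ∧ ¬ F z z') ∧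
        T + t + popCost Δ * s₂.v vTop ≤ popCost Δ * s.v vTop +
          ∑ v ∈ deadX s₂, nodeCostX s ell K Δ v +
          ell ^ max K 1 * (20 * K + 50) * usedTables s₂ q) ∧
        s₂.v vTop + (K + 1) * (aliveX s₂).card < top + 1 + (K + 1) * (aliveX s').card := by
      intro s₂ t hs₂ hans htop₂ hv' ht
      have hA : aliveX s₂ = aliveX s' := by simp only [haliveX, hs₂]
      have hDx : deadX s₂ = deadX s' := by simp only [hdeadX, hs₂]
      have hUs : usedTables s₂ q = usedTables s' q := by simp only [usedTables, hs₂]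
      refine ⟨⟨?_, ?_, ?_, ?_, ?_⟩, ?_⟩
      · obtain ⟨h1, h2, h3, h4, h5, h6, h7⟩ := hI'
        constructor <;> simp only [hs₂, hans, upList, Compat] <;> assumption
      · rw [hs₂]; exact hY'
      · rw [hs₂, htop₂]
        exact fun x hx => hS' x (by simp [hx])
      · rw [hs₂, htop₂]
        intro x hx hd hn
        by_cases hxv : x = v
        · subst hxv; exact hv' hd
        · exact hN' x hx hd (by simp [hn, hxv])
      · rw [hDx, hUs, htop₂]
        rw [mul_add] at hT
        omega
      · rw [hA, htop₂]; omega
    refine ⟨fun hdead => ?_, fun hdead => ?_⟩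
    swap
    · have := stay s₁ (1 + 1 + 1 + 1 + (1 + 1 + 1 + (1 + (1 + 1 + 1 + 1))) + (1 + 1 + 1)) rfl
        (by simp [hs₁]) (by simp [hs₁]) (fun h => absurd h (by omega)) (by omega)
      exact this
    have hdead : s'.a aDead v = 0 := by omega
    have he₁ := he'.agree hg₁ rfl
    have hF₁ := hF'.agree hg₁ rfl
    have hV₁ : s₁.v vV = v := by simp [hs₁]
    refine checkSimplicial_runs he₁ hF₁ hv hV₁ (by rw [hs₁, St.set_a, St.set_a, eY', hvY]) ?_
    intro s₂ T₂ hg₂ hbad hT₂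
    have ea₂ : s₂.a = s'.a := by
      funext b
      rw [hg₂.2 b (by cases b <;> rfl)]
      rfl
    have etop₂ : s₂.v vTop = top := by rw [hg₂.1 vTop rfl]; simp [hs₁]
    have eans₂ : s₂.v vAns = s'.v vAns := by rw [hg₂.1 vAns rfl]; simp [hs₁]
    have hYalive : ∀ z, F v z → s'.a aDead z = 0 → s.a aY z = 0 := by
      intro z hz hd
      by_contra h
      exact hY' z (he.lt _ _ hz).2 h hd
    have hbad' : s₂.v vBad = 0 ↔ ∀ z z', s'.a aDead z = 0 → F v z → s'.a aDead z' = 0 → F v z' →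
        z ≠ z' → F z z' := by
      rw [hbad]
      simp only [hs₁, St.set_a, eY']
      constructor
      · exact fun h z z' h1 h2 h3 h4 h5 => h z z' h2 (hYalive z h2 h1) h1 h4
          (hYalive z' h4 h3) h3 h5
      · exact fun h z z' h2 _ h1 h4 _ h3 h5 => h z z' h1 h2 h3 h4 h5
    rw [runs_when]
    simp only [AExp.eval, AExp.cost]
    refine ⟨fun hb => ?_, fun hb => ?_⟩
    swap
    · have := stay s₂ (1 + 1 + 1 + 1 + (1 + 1 + 1 + (T₂ + (1 + (1 + 1 + 1)) + (1 + 1 + 1 + 1))) +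
        (1 + 1 + 1)) ea₂ eans₂ etop₂ (fun _ => by
          by_contra hcon
          push Not at hcon
          have := hbad'.2 fun z z' h1 h2 h3 h4 h5 => hcon z z' h1 h2 h3 h4 h5
          omega) (by omega)
      exact this
    have hsimp := hbad'.1 (by omega)
    have he₂ := he₁.agree hg₂ rfl
    have hF₂ := hF₁.agree hg₂ rfl
    have hV₂ : s₂.v vV = v := by rw [hg₂.1 vV rfl, hV₁]
    have hI₂ : ElimInv s₂ n q ell K F := by
      obtain ⟨h1, h2, h3, h4, h5, h6, h7⟩ := hI'
      constructor <;> simp only [ea₂, eans₂, upList, Compat] <;> assumption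
    have hmem := he₂.mem_aliveNbrs hv
    have hnd : (aliveNbrs s₂ n v).Nodup := (he₂.nodup v hv).filter _
    -- the node and its alive neighbors form a clique
    have hcard : (aliveNbrs s₂ n v).length = 0 ∨ (aliveNbrs s₂ n v).length + 1 ≤ K := by
      rcases Nat.eq_zero_or_pos (aliveNbrs s₂ n v).length with h | h
      · exact Or.inl h
      right
      have hvn : v ∉ (aliveNbrs s₂ n v).toFinset := by
        rw [List.mem_toFinset, hmem]
        exact fun h => he.irrefl v h.2
      have hc : (insert v (aliveNbrs s₂ n v).toFinset).card = (aliveNbrs s₂ n v).length + 1 := by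
        rw [Finset.card_insert_of_notMem hvn, List.toFinset_card_of_nodup hnd]
      rw [← hc]
      refine hF.clique_card _ ?_ ?_ (by omega)
      · intro x hx
        rw [Finset.mem_insert, List.mem_toFinset, hmem, ea₂] at hx
        rcases hx with rfl | hx
        · exact hvY
        · exact hYalive x hx.2 hx.1
      · intro z hz z' hz' hne
        rw [Finset.mem_insert, List.mem_toFinset, hmem, ea₂] at hz hz'
        rcases hz with rfl | hz
        · rcases hz' with rfl | hz'
          · exact absurd rfl hne
          · exact hz'.2
        · rcases hz' with rfl | hz'
          · exact he.symm _ _ hz.2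
          · exact hsimp z z' hz.1 hz.2 hz'.1 hz'.2 hne
    set p := (aliveNbrs s₂ n v).length with hp
    have hpK : p ≤ K := by omega
    have hp1 : p + 1 ≤ max K 1 := by
      rcases hcard with h | h
      · rw [h]; exact le_max_right _ _
      · exact h.trans (le_max_left _ _)
    rw [runs_seq]
    refine eliminate_inv he₂ hI₂ hv hV₂ (by rw [ea₂, hdead]) hpK ?_ ?_ ?_
    · rw [ea₂]
      exact fun z z' h1 h2 h3 h4 h5 => hsimp z z' h1 h2 h3 h4 h5
    · rw [ea₂, eY']
      exact fun h => absurd hvY h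
    intro s₃ T₃ cn hg₃ hI₃ hdead₃ hup₃ hused₃ _ hT₃
    have he₃ := he₂.agree hg₃ rfl
    have hV₃ : s₃.v vV = v := by rw [hg₃.1 vV rfl, hV₂]
    refine pushNbrs_runs he₃ hv hV₃ ?_
    intro s₄ T₄ hg₄ htop₄ hstk₄ hT₄
    rw [hup₃, hg₃.1 vTop rfl, etop₂, hg₃.2 aStk rfl, ea₂] at hstk₄
    rw [hup₃, ← hp, hg₃.1 vTop rfl, etop₂] at htop₄
    rw [hup₃, ← hp] at hT₄
    have ea₄ : ∀ b, b ≠ aStk → s₄.a b = s₃.a b := by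
      intro b hb
      refine hg₄.2 b ?_
      cases b <;> first | rfl | exact absurd rfl hb
    have hdead₄ : s₄.a aDead = Function.update (s'.a aDead) v 1 := by
      rw [ea₄ _ (by decide), hdead₃, ea₂]
    have hd₄ : ∀ c, s₄.a aDead c = 0 ↔ s'.a aDead c = 0 ∧ c ≠ v := by
      intro c
      rw [hdead₄]
      by_cases h : c = v
      · simp [h]
      · simp [h]
    have hvD : v ∉ deadX s' := by simp [hdeadX, hdead]
    have hvA : v ∈ aliveX s' := by simp [haliveX, hdead, hv]
    have hDX : deadX s₄ = insert v (deadX s') := by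
      ext c
      simp only [hdeadX, Finset.mem_filter, Finset.mem_insert, Finset.mem_range, ne_eq, hd₄]
      by_cases h : c = v
      · subst h; simp [hv, hvY]
      · simp [h]
    have hAX : aliveX s₄ = (aliveX s').erase v := by
      ext c
      simp only [haliveX, Finset.mem_filter, Finset.mem_erase, Finset.mem_range, hd₄]
      tauto
    have hus₄ : usedTables s₄ q = usedTables s' q + cn := by
      have : usedTables s₄ q = usedTables s₃ q := by
        simp only [usedTables, ea₄ aCl (by decide)]
      rw [this, hused₃]
      simp only [usedTables, ea₂]
    refine ⟨⟨?_, ?_, ?_, ?_, ?_⟩, ?_⟩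
    · obtain ⟨h1, h2, h3, h4, h5, h6, h7⟩ := hI₃
      have := hg₄.1 vAns rfl
      constructor <;> simp only [upList, Compat, this, ea₄ aDead (by decide), ea₄ aCl (by decide),
        ea₄ aUpl (by decide), ea₄ aUp (by decide), ea₄ aTab (by decide), ea₄ aSz (by decide),
        ea₄ aGadj (by decide), ea₄ aMem (by decide), ea₄ aY (by decide)] <;> assumption
    · intro y hy hyY
      rw [Ne, hd₄]
      exact fun h => hY' y hy hyY h.1
    · rw [hstk₄]
      intro x hx
      rw [List.mem_append] at hx
      rcases hx with hx | hx
      · exact hS' x (by simp [hx])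
      · rw [hmem, ea₂] at hx
        exact ⟨(he.lt _ _ hx.2).2, hYalive x hx.2 hx.1⟩
    · rw [hstk₄]
      intro x hx hd hn
      rw [List.mem_append, not_or, hmem, ea₂] at hn
      rw [hd₄] at hd
      obtain ⟨z, z', h1, h2, h3, h4, h5⟩ := hN' x hx hd.1 (by simp [hn.1, hd.2])
      -- `x` was not pushed, so it is not a neighbor of `v`, and both witnesses stay alive
      have hxv : ¬ F x v := fun h => hn.2 ⟨hd.1, he.symm _ _ h⟩
      refine ⟨z, z', (hd₄ z).2 ⟨h1, ?_⟩, h2, (hd₄ z').2 ⟨h3, ?_⟩, h4, h5⟩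
      · rintro rfl; exact hxv h2
      · rintro rfl; exact hxv h4
    · rw [hDX, Finset.sum_insert hvD, hus₄, htop₄]
      rw [ea₂, e1, e2, ← hp] at hT₃
      have hsz := he.sz v hv
      have hE : ell ^ p * ell ≤ ell ^ max K 1 := by
        rw [← pow_succ]
        exact Nat.pow_le_pow_right (by omega) hp1
      have hE' : ell ^ p ≤ ell ^ max K 1 := Nat.pow_le_pow_right (by omega) (by omega)
      have hcost : ell ^ p * (s.a aSz v * (p * 50 + cn * (20 * K + 50) + 70) + p * 30 + 50) ≤
          ell ^ max K 1 * (80 * max K 1 + 120) + ell ^ max K 1 * (20 * K + 50) * cn := by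
        calc ell ^ p * (s.a aSz v * (p * 50 + cn * (20 * K + 50) + 70) + p * 30 + 50)
            = ell ^ p * s.a aSz v * (p * 50 + cn * (20 * K + 50) + 70) +
              ell ^ p * (p * 30 + 50) := by ring
          _ ≤ ell ^ max K 1 * (p * 50 + cn * (20 * K + 50) + 70) +
              ell ^ max K 1 * (p * 30 + 50) := by
            gcongr
            exact (Nat.mul_le_mul_left _ hsz).trans hE
          _ = ell ^ max K 1 * (80 * p + 120) + ell ^ max K 1 * (20 * K + 50) * cn := by ring
          _ ≤ _ := by gcongr; omega
      have hpush : popCost Δ * p + 30 * p ≤ (popCost Δ + 30) * max K 1 := by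
        rw [← add_mul]
        gcongr
        omega
      rw [mul_add, mul_one] at hT
      rw [mul_add, mul_add (ell ^ max K 1 * (20 * K + 50))]
      have hX : nodeCostX s ell K Δ v = s.a aFl v * 50 +
        ell ^ max K 1 * (80 * max K 1 + 120) + 100 + (popCost Δ + 30) * max K 1 := rfl
      rw [hX]
      omega
    · have := Finset.card_erase_of_mem hvA
      have hpos' : 0 < (aliveX s').card := Finset.card_pos.2 ⟨v, hvA⟩
      rw [hAX, this, htop₄]
      obtain ⟨m, hm⟩ : ∃ m, (aliveX s').card = m + 1 := ⟨_, (Nat.succ_pred_eq_of_pos hpos').symm⟩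
      rw [hm, Nat.add_sub_cancel, mul_add]
      omega
  · rintro s' T ha ⟨hI', hY', hS', hN', hT⟩ hpos hag
    simp only [AExp.eval, not_lt, Nat.le_zero] at hpos
    rw [hpos] at hN'
    refine post s' _ hag hI' ?_ ?_
    · -- if a node were alive, then the alive nodes would contain a simplicial one, but since the
      -- stack is empty each of them has two alive neighbors that are not adjacent
      by_contra hcon
      push Not at hcon
      obtain ⟨c, hc, hcd⟩ := hcon
      obtain ⟨x, hx, hxs⟩ := hF.exists_simplicial {c | c < q ∧ s'.a aDead c = 0} ⟨c, hc, hcd⟩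
        (fun x hx => ⟨hx.1, by by_contra h; exact hY' x hx.1 h hx.2⟩)
      obtain ⟨z, z', h1, h2, h3, h4, h5, h6⟩ := hN' x hx.1 hx.2 (by simp)
      exact h6 (hxs z ⟨(he.lt _ _ h2).2, h1⟩ z' ⟨(he.lt _ _ h4).2, h3⟩ h2 h4 h5)
    · have h1 : ∑ v ∈ deadX s', nodeCostX s ell K Δ v ≤
          ∑ v ∈ Finset.range q, nodeCostX s ell K Δ v :=
        Finset.sum_le_sum_of_subset (Finset.filter_subset _ _)
      have h2 : usedTables s' q ≤ q := by
        refine (Finset.card_filter_le _ _).trans ?_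
        simp
      have h3 := Nat.mul_le_mul_left (ell ^ max K 1 * (20 * K + 50)) h2
      simp only [AExp.cost]
      omega

/-! ### Arithmetic tables -/

/-- The machine has no multiplication, so products and powers are computed by repeated addition. -/
theorem tablePhase_runs {s : St} {Q : St → ℕ → Prop} {ell K q : ℕ} (hl : 2 ≤ ell)
    (hell : s.v vEll = ell) (hP : s.v vP = K) (hq : s.v vQ = q)
    (post : ∀ s' T, Agree tablePhase s s' → (∀ p ≤ K, s'.a aPw p = ell ^ p) →
      (∀ t < ell ^ K, s'.a aRem t = t % ell) → (∀ t < ell ^ K, s'.a aQuot t = t / ell) →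
      (∀ t < ell ^ K, s'.a aMul t = t * ell) → (∀ c < q, s'.a aTb c = c * ell ^ K) →
      T ≤ K * (ell * 15 + 30) + ell ^ K * 40 + q * 20 + 40 → Q s' T) :
    Runs tablePhase s Q := by
  refine Runs.of_agree ?_
  unfold tablePhase
  rw [runs_seq, runs_put, runs_seq]
  refine Runs.forB (fun k s' => ∀ p ≤ k, s'.a aPw p = ell ^ p) 0 K (ell * 15 + 20)
    (Nat.zero_le _) rfl rfl ?_ ?_ ?_ ?_
  · intro k s' ha _
    simp [ha.1 vP rfl, hP]
  · intro p hp
    obtain rfl : p = 0 := by omega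
    simp
  · rintro i s₁ - hi ha hvi h1
    have eL : s₁.v vEll = ell := by rw [ha.1 vEll rfl]; simpa using hell
    rw [runs_seq, runs_set, runs_seq]
    refine Runs.forB (fun k s' => s'.v vX = k * ell ^ i) 0 ell 5 (Nat.zero_le _) rfl rfl ?_ ?_ ?_ ?_
    · intro k s' ha' _
      simp [ha'.1 vEll rfl, eL]
    · simp
    · rintro k s₂ - hk ha' hvj h2
      have e1 : s₂.v vI = i := by rw [ha'.1 vI rfl]; simpa using hvi
      have e2 : s₂.a aPw i = ell ^ i := by rw [ha'.2 aPw rfl]; exact h1 i le_rfl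
      simp only [runs_set, AExp.eval, AExp.cost, St.set_v, reduceCtorEq, if_true, if_false, e1, e2,
        h2]
      exact ⟨by ring, by norm_num⟩
    · rintro s₂ T ha' hvj h2 hT
      have e1 : s₂.v vI = i := by rw [ha'.1 vI rfl]; simpa using hvi
      simp only [runs_put, AExp.eval, AExp.cost, St.set_a, St.put_a, if_true, e1, h2]
      refine ⟨fun p hp => ?_, ?_⟩
      · by_cases h : p = i + 1
        · rw [h, Function.update_self, pow_succ, mul_comm]
        · rw [Function.update_of_ne h, ha'.2 aPw rfl]
          exact h1 p (by omega)
      · simp only [AExp.cost, Nat.sub_zero] at hT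
        omega
  rintro s₁ T₁ ha₁ - hpw hT₁
  simp only [AExp.cost, Nat.sub_zero] at hT₁
  have eL₁ : s₁.v vEll = ell := by rw [ha₁.1 vEll rfl]; simpa using hell
  have eP₁ : s₁.v vP = K := by rw [ha₁.1 vP rfl]; simpa using hP
  have eQ₁ : s₁.v vQ = q := by rw [ha₁.1 vQ rfl]; simpa using hq
  simp only [runs_seq, runs_set, AExp.eval]
  refine Runs.forB (fun k s' => s'.v vX = k % ell ∧ s'.v vY = k / ell ∧ s'.v vZ = k * ell ∧
    (∀ t < k, s'.a aRem t = t % ell) ∧ (∀ t < k, s'.a aQuot t = t / ell) ∧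
      (∀ t < k, s'.a aMul t = t * ell)) 0 (ell ^ K) 31
    (Nat.zero_le _) rfl rfl ?_ ?_ ?_ ?_
  · intro k s' ha _
    simp [ha.1 vP rfl, ha.2 aPw rfl, eP₁, hpw]
  · simp
  · rintro k s₂ - hk ha hvk ⟨h1, h2, h3, h4, h5, h6⟩
    have eL₂ : s₂.v vEll = ell := by rw [ha.1 vEll rfl]; simpa using eL₁
    simp only [runs_seq, runs_set, runs_put, runs_ite, runs_skip, AExp.eval, AExp.cost, St.set_v,
      St.set_a, St.put_v, St.put_a, reduceCtorEq, if_true, if_false, hvk, h1, h2, h3, eL₂]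
    have hupd : ∀ (A f : ℕ → ℕ), (∀ t < k, A t = f t) →
        ∀ t < k + 1, Function.update A k (f k) t = f t := by
      intro A f h t ht
      by_cases htk : t = k
      · rw [htk, Function.update_self]
      · rw [Function.update_of_ne htk]
        exact h t (by omega)
    have hmod : k % ell < ell := Nat.mod_lt _ (by omega)
    have hdm := Nat.div_add_mod k ell
    refine ⟨fun hlt => ⟨⟨?_, ?_, by ring, hupd _ _ h4, hupd _ _ h5, hupd _ _ h6⟩, by norm_num⟩,
      fun hge => ⟨⟨?_, ?_, by ring, hupd _ _ h4, hupd _ _ h5, hupd _ _ h6⟩, by norm_num⟩⟩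
    · rw [Nat.add_mod, Nat.mod_eq_of_lt (by omega : 1 < ell), Nat.mod_eq_of_lt hlt]
    · rw [Nat.add_div (by omega), Nat.mod_eq_of_lt (by omega : 1 < ell), if_neg (by omega),
        Nat.div_eq_of_lt (by omega : 1 < ell)]
      rfl
    · have : k % ell + 1 = ell := by omega
      rw [Nat.add_mod, Nat.mod_eq_of_lt (by omega : 1 < ell), this, Nat.mod_self]
    · rw [Nat.add_div (by omega), Nat.mod_eq_of_lt (by omega : 1 < ell), if_pos (by omega),
        Nat.div_eq_of_lt (by omega : 1 < ell)]
  rintro s₂ T₂ ha₂ - ⟨-, -, -, h4, h5, h6⟩ hT₂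
  simp only [AExp.cost, Nat.sub_zero] at hT₂
  have eP₂ : s₂.v vP = K := by rw [ha₂.1 vP rfl]; simpa using eP₁
  have eQ₂ : s₂.v vQ = q := by rw [ha₂.1 vQ rfl]; simpa using eQ₁
  have eW₂ : s₂.a aPw = s₁.a aPw := by rw [ha₂.2 aPw rfl]; rfl
  refine Runs.forB (fun k s' => s'.v vAcc = k * ell ^ K ∧ (∀ c < k, s'.a aTb c = c * ell ^ K))
    0 q 9 (Nat.zero_le _) rfl rfl ?_ ?_ ?_ ?_
  · intro k s' ha _
    simp [ha.1 vQ rfl, eQ₂]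
  · simp
  · rintro c s₃ - hc ha hvc ⟨h1, h2⟩
    have e1 : s₃.v vP = K := by rw [ha.1 vP rfl]; simpa using eP₂
    have e2 : s₃.a aPw K = ell ^ K := by rw [ha.2 aPw rfl, St.set_a, eW₂]; exact hpw K le_rfl
    simp only [runs_seq, runs_set, runs_put, AExp.eval, AExp.cost, St.set_v,
      St.set_a, St.put_v, St.put_a, reduceCtorEq, if_true, if_false, hvc, h1, e1, e2]
    refine ⟨⟨by ring, fun d hd => ?_⟩, by norm_num⟩
    by_cases hdc : d = c
    · rw [hdc, Function.update_self]
    · rw [Function.update_of_ne hdc]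
      exact h2 d (by omega)
  · rintro s₃ T₃ ha₃ - ⟨-, h⟩ hT₃ hag
    simp only [AExp.cost, Nat.sub_zero] at hT₃
    refine post s₃ _ hag ?_ ?_ ?_ ?_ h ?_
    · rw [ha₃.2 aPw rfl, St.set_a, eW₂]; exact hpw
    · rw [ha₃.2 aRem rfl]; exact h4
    · rw [ha₃.2 aQuot rfl]; exact h5
    · rw [ha₃.2 aMul rfl]; exact h6
    · have a1 : K * (ell * 15 + 20 + (1 + 6)) ≤ K * (ell * 15 + 30) :=
        Nat.mul_le_mul_left _ (by omega)
      simp only [AExp.cost]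
      omega

/-! ### Color classes -/

/-- The vertices `0, …, n - 1` are divided into classes `0, …, q - 1` by `aCid`; the classes are
listed in the rows of `aMem`, their sizes are in `aSz`, and the largest size is in `vEll`. -/
structure Classes (s : St) (n q : ℕ) : Prop where
  vN : s.v vN = n
  vQ : s.v vQ = q
  le : q ≤ n
  rowA : ∀ i < n, s.a aRow i = i * n
  cid_lt : ∀ u < n, s.a aCid u < q
  surj : ∀ c < q, ∃ u < n, s.a aCid u = c
  mem : ∀ c u, u ∈ arrList (row (s.a aMem) n c) (s.a aSz c) ↔ u < n ∧ s.a aCid u = c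
  sz : ∀ c, s.a aSz c = ((Finset.range n).filter fun u => s.a aCid u = c).card
  sz_le : ∀ c, s.a aSz c ≤ s.v vEll
  ell : s.v vEll = 0 ∨ ∃ c < q, s.a aSz c = s.v vEll

theorem classPhase_runs {s : St} {Q : St → ℕ → Prop} {n : ℕ} (hn : s.v vN = n)
    (hacc : s.v vAcc = 0) (hq : s.v vQ = 0) (hell : s.v vEll = 0) (hlab : ∀ c, s.a aLab c = 0)
    (hsz : ∀ c, s.a aSz c = 0)
    (post : ∀ s' T q, Agree classPhase s s' → Classes s' n q →
      (∀ u < n, ∀ w < n, s'.a aCid u = s'.a aCid w ↔ s.a aColor u = s.a aColor w) →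
      T ≤ n * 100 + 10 → Q s' T) :
    Runs classPhase s Q := by
  refine Runs.of_agree ?_
  unfold classPhase
  set col := s.a aColor with hcol
  let I : ℕ → St → Prop := fun k s' =>
    s'.v vAcc = k * n ∧ (∀ i < k, s'.a aRow i = i * n) ∧ s'.v vQ ≤ k ∧
      (∀ x, s'.a aLab x ≤ s'.v vQ) ∧ (∀ x, s'.a aLab x = 0 ↔ ∀ u < k, col u ≠ x) ∧
      (∀ x y, s'.a aLab x = s'.a aLab y → s'.a aLab x ≠ 0 → x = y) ∧
      (∀ u < k, s'.a aCid u + 1 = s'.a aLab (col u)) ∧ (∀ c < s'.v vQ, ∃ u < k, s'.a aCid u = c) ∧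
      (∀ c u, u ∈ arrList (row (s'.a aMem) n c) (s'.a aSz c) ↔ u < k ∧ s'.a aCid u = c) ∧
      (∀ c, s'.a aSz c = ((Finset.range k).filter fun u => s'.a aCid u = c).card) ∧
      (∀ c, s'.a aSz c ≤ s'.v vEll) ∧
      (s'.v vEll = 0 ∨ ∃ c < s'.v vQ, s'.a aSz c = s'.v vEll)
  refine Runs.forB I
    0 n 80 (Nat.zero_le _) rfl rfl ?_ ?_ ?_ ?_
  · intro k s' ha _
    simp [ha.1 vN rfl, hn]
  · simp only [I]
    simp [hq, hacc, hell, hlab, hsz]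
    exact fun c => rfl
  · rintro k s' - hk ha hvi ⟨h1, h2, h3, h4, h5, h6, h7, h8, h9, h10, h11, h12⟩
    have eN : s'.v vN = n := by rw [ha.1 vN rfl, hn]
    have eC : s'.a aColor = col := ha.2 aColor rfl
    rw [runs_seq, runs_put, runs_seq, runs_set, runs_seq, runs_set, runs_seq]
    simp only [AExp.eval, St.set_v, St.set_a, St.put_a, St.put_v,
      reduceCtorEq, if_false, AExp.cost, hvi, h1, eN, eC]
    set s₁ := ((s'.put aRow k (k * n)).set vAcc (k * n + n)).set vC (col k) with hs₁
    -- the rest of the body, when the color has a label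
    have cont : ∀ (s₂ : St) (t : ℕ), (∀ b, b ≠ aLab → s₂.a b = s₁.a b) →
        (∀ y, y ≠ vQ → s₂.v y = s₁.v y) → s'.v vQ ≤ s₂.v vQ → s₂.v vQ ≤ k + 1 →
        (∀ x, s₂.a aLab x ≤ s₂.v vQ) → (∀ x, s₂.a aLab x = 0 ↔ ∀ u < k + 1, col u ≠ x) →
        (∀ x y, s₂.a aLab x = s₂.a aLab y → s₂.a aLab x ≠ 0 → x = y) →
        (∀ u < k, s'.a aCid u + 1 = s₂.a aLab (col u)) →
        (∀ c < s₂.v vQ, c + 1 = s₂.a aLab (col k) ∨ c < s'.v vQ) → t ≤ 15 →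
        Runs (.set vC (aLab⟪↟vC⟫ -ₑ .lit 1) ;; .put aCid ↟vI ↟vC ;;
          .put aMem (aRow⟪↟vC⟫ +ₑ aSz⟪↟vC⟫) ↟vI ;; .put aSz ↟vC (aSz⟪↟vC⟫ +ₑ .lit 1) ;;
          .when ↟vEll (aSz⟪↟vC⟫) (.set vEll (aSz⟪↟vC⟫))) s₂ (fun s₃ t₃ =>
          I (k + 1) (s₃.set vI (k + 1)) ∧ t + t₃ ≤ 70) := by
      intro s₂ t hb hy q1 q2 q3 q4 q5 q6 q7 ht
      have eI : s₂.v vI = k := by rw [hy _ (by decide)]; simpa [hs₁] using hvi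
      have eAcc : s₂.v vAcc = k * n + n := by rw [hy _ (by decide)]; simp [hs₁]
      have eC₂ : s₂.v vC = col k := by rw [hy _ (by decide)]; simp [hs₁]
      have eE : s₂.v vEll = s'.v vEll := by rw [hy _ (by decide)]; simp [hs₁]
      have eCid : s₂.a aCid = s'.a aCid := by rw [hb _ (by decide)]; simp [hs₁]
      have eMem : s₂.a aMem = s'.a aMem := by rw [hb _ (by decide)]; simp [hs₁]
      have eSz : s₂.a aSz = s'.a aSz := by rw [hb _ (by decide)]; simp [hs₁]
      have eRow : s₂.a aRow = Function.update (s'.a aRow) k (k * n) := by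
        rw [hb _ (by decide)]; simp [hs₁]
      have hrow : ∀ i < k + 1, s₂.a aRow i = i * n := by
        intro i hi
        rw [eRow]
        by_cases hik : i = k
        · rw [hik, Function.update_self]
        · rw [Function.update_of_ne hik]; exact h2 i (by omega)
      have hlab0 : s₂.a aLab (col k) ≠ 0 := by
        rw [Ne, q4]
        exact fun h => h k (by omega) rfl
      obtain ⟨c, hc⟩ : ∃ c, s₂.a aLab (col k) = c + 1 := ⟨_, (Nat.succ_pred hlab0).symm⟩
      have hcq : c < s₂.v vQ := by have := q3 (col k); omega
      have hcr : s₂.a aRow c = c * n := hrow c (by omega)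
      have hszk : ∀ d, s'.a aSz d ≤ k := by
        intro d
        rw [h10]
        refine (Finset.card_filter_le _ _).trans (by simp)
      have hszn : ∀ d, s'.a aSz d < n := fun d => (hszk d).trans_lt hk
      simp only [I, runs_seq, runs_set, runs_put, runs_when, AExp.eval, St.set_v, St.set_a,
        St.put_a, St.put_v, reduceCtorEq, if_true, if_false, AExp.cost, eI, eC₂, hc,
        Nat.add_sub_cancel, hcr, eSz, eMem, eE, eAcc, eCid, Function.update_self]
      have g1 : ∀ u < k + 1, Function.update (s'.a aCid) k c u + 1 = s₂.a aLab (col u) := by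
        intro u hu
        by_cases huk : u = k
        · rw [huk, Function.update_self, hc]
        · rw [Function.update_of_ne huk]; exact q6 u (by omega)
      have g2 : ∀ d < s₂.v vQ, ∃ u < k + 1, Function.update (s'.a aCid) k c u = d := by
        intro d hd
        rcases q7 d hd with h | h
        · exact ⟨k, by omega, by rw [Function.update_self]; omega⟩
        · obtain ⟨u, hu, hud⟩ := h8 d h
          exact ⟨u, by omega, by rw [Function.update_of_ne (by omega)]; exact hud⟩
      have g3 : ∀ d u, u ∈ arrList (row (Function.update (s'.a aMem) (c * n + s'.a aSz c) k) n d)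
          (Function.update (s'.a aSz) c (s'.a aSz c + 1) d) ↔
          u < k + 1 ∧ Function.update (s'.a aCid) k c u = d := by
        intro d u
        have hold := h9 d u
        by_cases hdc : d = c
        · subst hdc
          rw [Function.update_self, row_update_self, arrList_push, List.mem_append, hold,
            List.mem_singleton]
          by_cases huk : u = k
          · simp [huk]
          · rw [Function.update_of_ne huk]
            constructor
            · rintro (h | h)
              · exact ⟨by omega, h.2⟩
              · exact absurd h huk
            · exact fun h => Or.inl ⟨by omega, h.2⟩
        · rw [Function.update_of_ne hdc, arrList_row_update _ _ hdc (hszn c) (hszn d).le, hold]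
          by_cases huk : u = k
          · simp [huk, Ne.symm hdc]
          · rw [Function.update_of_ne huk]
            exact and_congr_left fun _ => by omega
      have g4 : ∀ d, Function.update (s'.a aSz) c (s'.a aSz c + 1) d =
          ((Finset.range (k + 1)).filter fun u => Function.update (s'.a aCid) k c u = d).card := by
        intro d
        have : (Finset.range k).filter (fun u => Function.update (s'.a aCid) k c u = d) =
            (Finset.range k).filter (fun u => s'.a aCid u = d) := by
          refine Finset.filter_congr fun u hu => ?_
          rw [Function.update_of_ne (Finset.mem_range.1 hu).ne]
        rw [Finset.range_add_one, Finset.filter_insert, Function.update_self, this]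
        by_cases hdc : d = c
        · subst hdc
          rw [if_pos rfl, Function.update_self, Finset.card_insert_of_notMem (by simp), ← h10]
        · rw [if_neg (Ne.symm hdc), Function.update_of_ne hdc, h10]
      have g5 : k * n + n = (k + 1) * n := by ring
      refine ⟨fun hlt => ⟨⟨g5, hrow, q2, q3, q4, q5, g1, g2, g3, g4, fun d => ?_, Or.inr
        ⟨c, hcq, Function.update_self ..⟩⟩, by omega⟩,
        fun hge => ⟨⟨g5, hrow, q2, q3, q4, q5, g1, g2,
        g3, g4, fun d => ?_, ?_⟩, by omega⟩⟩
      · by_cases hdc : d = c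
        · rw [hdc, Function.update_self]
        · rw [Function.update_of_ne hdc]
          have := h11 d
          omega
      · by_cases hdc : d = c
        · rw [hdc, Function.update_self]; omega
        · rw [Function.update_of_ne hdc]; exact h11 d
      · right
        rcases h12 with h | ⟨d, hd, h⟩
        · omega
        · have hdc : d ≠ c := by
            rintro rfl; omega
          exact ⟨d, by omega, by rw [Function.update_of_ne hdc, h]⟩
    have e1 : s₁.v vC = col k := by simp [hs₁]
    have e2 : s₁.a aLab = s'.a aLab := by simp [hs₁]
    have e3 : s₁.v vQ = s'.v vQ := by simp [hs₁]
    rw [runs_when]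
    simp only [AExp.eval, AExp.cost, e1, e2]
    refine ⟨fun hnew => ?_, fun hold => ?_⟩
    · have hnew' : s'.a aLab (col k) = 0 := by omega
      rw [runs_seq, runs_set, runs_put]
      simp only [AExp.eval, AExp.cost, e1, e3, St.set_v, reduceCtorEq, if_true, if_false]
      set s₂ := (s₁.set vQ (s'.v vQ + 1)).put aLab (col k) (s'.v vQ + 1) with hs₂
      have f1 : s₂.v vQ = s'.v vQ + 1 := by simp [hs₂]
      have f2 : s₂.a aLab = Function.update (s'.a aLab) (col k) (s'.v vQ + 1) := by simp [hs₂, e2]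
      refine (cont s₂ 15 (fun b hb => by simp [hs₂, hb]) (fun y hy => by simp [hs₂, hy])
        (by omega) (by omega) ?_ ?_ ?_ ?_ ?_ le_rfl).mono fun s₃ t₃ h => ⟨h.1, by omega⟩
      · intro x
        rw [f1, f2]
        by_cases hx : x = col k
        · rw [hx, Function.update_self]
        · rw [Function.update_of_ne hx]
          have := h4 x
          omega
      · intro x
        rw [f2]
        by_cases hx : x = col k
        · rw [hx, Function.update_self]
          simp only [Nat.add_eq_zero_iff, one_ne_zero, and_false, false_iff, not_forall]
          exact ⟨k, by omega, by simp⟩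
        · rw [Function.update_of_ne hx, h5]
          constructor
          · intro h u hu
            rcases Nat.lt_succ_iff_lt_or_eq.1 hu with hu | rfl
            · exact h u hu
            · exact fun h => hx h.symm
          · exact fun h u hu => h u (by omega)
      · intro x y
        rw [f2]
        have hbx := h4 x
        have hby := h4 y
        by_cases hx : x = col k
        · by_cases hy : y = col k
          · intros; rw [hx, hy]
          · rw [hx, Function.update_self, Function.update_of_ne hy]
            intros; omega
        · by_cases hy : y = col k
          · rw [hy, Function.update_self, Function.update_of_ne hx]
            intros; omega
          · rw [Function.update_of_ne hx, Function.update_of_ne hy]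
            exact h6 x y
      · intro u hu
        rw [f2, Function.update_of_ne, h7 u hu]
        exact (h5 (col k)).1 hnew' u hu
      · intro c hc
        rw [f2, Function.update_self]
        omega
    · refine (cont s₁ 15 (fun _ _ => rfl) (fun _ _ => rfl) (by omega) (by omega) ?_ ?_ ?_ ?_ ?_
        le_rfl).mono fun s₃ t₃ h => ⟨h.1, by omega⟩
      · rw [e2, e3]; exact h4
      · intro x
        rw [e2, h5]
        constructor
        · intro h u hu
          rcases Nat.lt_succ_iff_lt_or_eq.1 hu with hu | rfl
          · exact h u hu
          · rintro rfl
            have := (h5 (col u)).2 h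
            omega
        · exact fun h u hu => h u (by omega)
      · rw [e2]; exact h6
      · rw [e2]; exact h7
      · rw [e3]; exact fun c hc => Or.inr hc
  · rintro s' T ha hj ⟨h1, h2, h3, h4, h5, h6, h7, h8, h9, h10, h11, h12⟩ hT hag
    have hN : s'.v vN = n := by rw [hag.1 vN rfl, hn]
    refine post s' T (s'.v vQ) hag ⟨hN, rfl, h3, h2, fun u hu => ?_, h8, h9, h10, h11, h12⟩ ?_ ?_
    · have := h7 u hu
      have := h4 (col u)
      omega
    · intro u hu w hw
      have a1 := h7 u hu
      have a2 := h7 w hw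
      constructor
      · intro h
        exact h6 _ _ (by omega) (by omega)
      · intro h
        have : s.a aColor u = s.a aColor w := h
        rw [← hcol] at this
        rw [this] at a1
        omega
    · simp only [AExp.cost, Nat.sub_zero] at hT
      omega

/-! ### Neighbor lists -/

/-- The neighbor list of the node `c`. -/
def nbrList (s : St) (n c : ℕ) : List ℕ := arrList (row (s.a aFn) n c) (s.a aFl c)

/-- The adjacency matrix `aFadj` and the neighbor lists represent the relation `F`. -/
structure NbrLists (s : St) (n : ℕ) (F : ℕ → ℕ → Prop) : Prop where
  lt : ∀ a b, F a b → a < n ∧ b < n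
  fadj : ∀ a < n, ∀ b < n, s.a aFadj (a * n + b) ≠ 0 ↔ F a b
  nodup : ∀ a < n, (nbrList s n a).Nodup
  mem : ∀ a < n, ∀ b, b ∈ nbrList s n a ↔ F a b

theorem length_le_of_nodup {L : List ℕ} {n : ℕ} (hn : L.Nodup) (h : ∀ x ∈ L, x < n) :
    L.length ≤ n := by
  rw [← List.toFinset_card_of_nodup hn, ← Finset.card_range n]
  exact Finset.card_le_card fun x hx => Finset.mem_range.2 (h x (List.mem_toFinset.1 hx))

theorem NbrLists.fl_le {s : St} {n : ℕ} {F : ℕ → ℕ → Prop} (h : NbrLists s n F) {a : ℕ}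
    (ha : a < n) : s.a aFl a ≤ n := by
  have := length_le_of_nodup (h.nodup a ha) fun x hx => (h.lt a x ((h.mem a ha x).1 hx)).2
  rwa [nbrList, arrList_length] at this

theorem NbrLists.congr {s s' : St} {n : ℕ} {F F' : ℕ → ℕ → Prop} (h : NbrLists s n F)
    (h1 : s'.a aFadj = s.a aFadj) (h2 : s'.a aFn = s.a aFn) (h3 : s'.a aFl = s.a aFl)
    (hF : ∀ a b, F' a b ↔ F a b) : NbrLists s' n F' := by
  obtain rfl : F' = F := by
    funext a b
    exact propext (hF a b)
  have hl : ∀ a, nbrList s' n a = nbrList s n a := fun a => by simp only [nbrList, h2, h3]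
  exact ⟨h.lt, by rw [h1]; exact h.fadj, fun a ha => by rw [hl]; exact h.nodup a ha,
    fun a ha => by rw [hl]; exact h.mem a ha⟩

theorem addNbr_runs {s : St} {Q : St → ℕ → Prop} {n a b : ℕ} {F : ℕ → ℕ → Prop} {x y : Var}
    (hF : NbrLists s n F) (hrow : s.a aRow a = a * n) (hx : s.v x = a) (hy : s.v y = b)
    (ha : a < n) (hb : b < n)
    (post : ∀ s' T, Agree (addNbr x y) s s' →
      NbrLists s' n (fun c d => F c d ∨ (c = a ∧ d = b)) →
      (∀ c < n, nbrList s' n c = nbrList s n c ∨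
        (c = a ∧ ¬ F a b ∧ nbrList s' n c = nbrList s n c ++ [b])) →
      T ≤ 40 → Q s' T) :
    Runs (addNbr x y) s Q := by
  refine Runs.of_agree ?_
  unfold addNbr
  simp only [runs_when, runs_seq, runs_put, AExp.eval, AExp.cost, St.put_a, St.put_v,
    reduceCtorEq, if_false, hx, hy, hrow]
  have hlt : ∀ c d, (F c d ∨ (c = a ∧ d = b)) → c < n ∧ d < n := by
    rintro c d (h | ⟨rfl, rfl⟩)
    · exact hF.lt c d h
    · exact ⟨ha, hb⟩
  refine ⟨fun h hag => ?_, fun h hag => ?_⟩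
  · have hab : ¬ F a b := by
      rw [← hF.fadj a ha b hb]; omega
    have hlen : s.a aFl a < n := by
      have hn : (nbrList s n a ++ [b]).Nodup := by
        rw [List.nodup_append]
        refine ⟨hF.nodup a ha, by simp, ?_⟩
        intro c hc d hd
        rw [List.mem_singleton] at hd
        rintro rfl
        exact hab (hd ▸ (hF.mem a ha c).1 hc)
      have := length_le_of_nodup hn (n := n) (by
        intro c hc
        rw [List.mem_append, List.mem_singleton, hF.mem a ha] at hc
        rcases hc with hc | rfl
        · exact (hF.lt a c hc).2
        · exact hb)
      rw [List.length_append, nbrList, arrList_length] at this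
      simpa using this
    set s' := ((s.put aFadj (a * n + b) 1).put aFn (a * n + s.a aFl a) b).put aFl a
      (s.a aFl a + 1) with hs'
    have hself : nbrList s' n a = nbrList s n a ++ [b] := by
      simp only [nbrList, hs', St.put_a, if_true, reduceCtorEq, if_false, Function.update_self]
      rw [row_update_self, arrList_push]
    have hother : ∀ c < n, c ≠ a → nbrList s' n c = nbrList s n c := by
      intro c hc hca
      simp only [nbrList, hs', St.put_a, if_true, reduceCtorEq, if_false,
        Function.update_of_ne hca]
      exact arrList_row_update _ _ hca hlen (hF.fl_le hc)
    refine post s' _ hag ⟨hlt, ?_, ?_, ?_⟩ ?_ (by norm_num)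
    · intro c hc d hd
      have : s'.a aFadj = Function.update (s.a aFadj) (a * n + b) 1 := by simp [hs']
      rw [this]
      by_cases hcd : c = a ∧ d = b
      · rw [hcd.1, hcd.2, Function.update_self]; simp
      · rw [Function.update_of_ne (by rwa [Ne, mul_add_inj hd hb]), hF.fadj c hc d hd]
        simp [hcd]
    · intro c hc
      by_cases hca : c = a
      · subst hca
        rw [hself, List.nodup_append]
        refine ⟨hF.nodup c hc, by simp, ?_⟩
        intro d hd e he
        rw [List.mem_singleton] at he
        rintro rfl
        exact hab (he ▸ (hF.mem c hc d).1 hd)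
      · rw [hother c hc hca]; exact hF.nodup c hc
    · intro c hc d
      by_cases hca : c = a
      · subst hca
        rw [hself, List.mem_append, hF.mem c hc, List.mem_singleton]; simp
      · rw [hother c hc hca, hF.mem c hc]; simp [hca]
    · intro c hc
      by_cases hca : c = a
      · subst hca; exact Or.inr ⟨rfl, hab, hself⟩
      · exact Or.inl (hother c hc hca)
  · have hab : F a b := by
      rw [← hF.fadj a ha b hb]; omega
    refine post s _ hag (hF.congr rfl rfl rfl fun c d => ?_) (fun c _ => Or.inl rfl) (by norm_num)
    constructor
    · rintro (h | ⟨rfl, rfl⟩)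
      · exact h
      · exact hab
    · exact Or.inl

/-- One of the first `k` edges has the ends `u` and `w`. -/
def HasEdge (s : St) (k u w : ℕ) : Prop :=
  ∃ e < k, (s.a aEu e = u ∧ s.a aEv e = w) ∨ (s.a aEu e = w ∧ s.a aEv e = u)

/-- One of the first `k` edges joins the classes `a` and `b`. -/
def ClusterEdge (s : St) (k a b : ℕ) : Prop :=
  a ≠ b ∧ ∃ u w, HasEdge s k u w ∧ s.a aCid u = a ∧ s.a aCid w = b

theorem hasEdge_succ {s : St} {k u w : ℕ} : HasEdge s (k + 1) u w ↔ HasEdge s k u w ∨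
    ((s.a aEu k = u ∧ s.a aEv k = w) ∨ (s.a aEu k = w ∧ s.a aEv k = u)) := by
  constructor
  · rintro ⟨e, he, h⟩
    rcases Nat.lt_succ_iff_lt_or_eq.1 he with he | rfl
    · exact Or.inl ⟨e, he, h⟩
    · exact Or.inr h
  · rintro (⟨e, he, h⟩ | h)
    · exact ⟨e, by omega, h⟩
    · exact ⟨k, by omega, h⟩

theorem HasEdge.symm {s : St} {k u w : ℕ} (h : HasEdge s k u w) : HasEdge s k w u := by
  obtain ⟨e, he, h⟩ := h
  exact ⟨e, he, h.symm⟩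

theorem clusterEdge_succ {s : St} {k a b : ℕ} : ClusterEdge s (k + 1) a b ↔ ClusterEdge s k a b ∨
    (a ≠ b ∧ ((a = s.a aCid (s.a aEu k) ∧ b = s.a aCid (s.a aEv k)) ∨
      (a = s.a aCid (s.a aEv k) ∧ b = s.a aCid (s.a aEu k)))) := by
  unfold ClusterEdge
  simp only [hasEdge_succ]
  constructor
  · rintro ⟨hne, u, w, h | (⟨rfl, rfl⟩ | ⟨rfl, rfl⟩), rfl, rfl⟩
    · exact Or.inl ⟨hne, u, w, h, rfl, rfl⟩
    · exact Or.inr ⟨hne, Or.inl ⟨rfl, rfl⟩⟩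
    · exact Or.inr ⟨hne, Or.inr ⟨rfl, rfl⟩⟩
  · rintro (⟨hne, u, w, h, h1, h2⟩ | ⟨hne, ⟨h1, h2⟩ | ⟨h1, h2⟩⟩)
    · exact ⟨hne, u, w, Or.inl h, h1, h2⟩
    · exact ⟨hne, _, _, Or.inr (Or.inl ⟨rfl, rfl⟩), h1.symm, h2.symm⟩
    · exact ⟨hne, _, _, Or.inr (Or.inr ⟨rfl, rfl⟩), h1.symm, h2.symm⟩

theorem edgePhase_runs {s : St} {Q : St → ℕ → Prop} {n q m : ℕ} (hc : Classes s n q)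
    (hm : s.v vM = m) (heu : ∀ e < m, s.a aEu e < n) (hev : ∀ e < m, s.a aEv e < n)
    (hG : ∀ i, s.a aGadj i = 0) (hFa : ∀ i, s.a aFadj i = 0) (hFl : ∀ i, s.a aFl i = 0)
    (post : ∀ s' T, Agree edgePhase s s' → NbrLists s' n (ClusterEdge s m) →
      (∀ u < n, ∀ w < n, s'.a aGadj (u * n + w) ≠ 0 ↔ HasEdge s m u w) →
      T ≤ m * 200 + 10 → Q s' T) :
    Runs edgePhase s Q := by
  refine Runs.of_agree ?_
  unfold edgePhase
  refine Runs.forB (fun k s' => NbrLists s' n (ClusterEdge s k) ∧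
      (∀ u < n, ∀ w < n, s'.a aGadj (u * n + w) ≠ 0 ↔ HasEdge s k u w))
    0 m 180 (Nat.zero_le _) rfl rfl ?_ ?_ ?_ ?_
  · intro k s' ha _
    simp [ha.1 vM rfl, hm]
  · have hno : ∀ u w, ¬ HasEdge s 0 u w := by
      rintro u w ⟨e, he, _⟩; omega
    have hno' : ∀ a b, ¬ ClusterEdge s 0 a b := by
      rintro a b ⟨_, u, w, h, _⟩; exact hno u w h
    refine ⟨⟨fun a b h => absurd h (hno' a b), fun a _ b _ => ?_, fun a _ => ?_, fun a _ b => ?_⟩,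
      fun u _ w _ => ?_⟩
    · simp [hFa, hno']
    · simp [nbrList, hFl]
    · simp [nbrList, hFl, hno']
    · simp [hG, hno]
  · rintro k s' - hk ha hvi ⟨h1, h2⟩
    have eEu : s'.a aEu = s.a aEu := ha.2 aEu rfl
    have eEv : s'.a aEv = s.a aEv := ha.2 aEv rfl
    have eC : s'.a aCid = s.a aCid := ha.2 aCid rfl
    have eR : s'.a aRow = s.a aRow := ha.2 aRow rfl
    set u := s.a aEu k with hu
    set w := s.a aEv k with hw
    have hun : u < n := heu k hk
    have hwn : w < n := hev k hk
    set a := s.a aCid u with hadef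
    set b := s.a aCid w with hbdef
    have han : a < n := (hc.cid_lt u hun).trans_le hc.le
    have hbn : b < n := (hc.cid_lt w hwn).trans_le hc.le
    have hru : s.a aRow u = u * n := hc.rowA u hun
    have hrw : s.a aRow w = w * n := hc.rowA w hwn
    rw [runs_seq, runs_set, runs_seq, runs_set, runs_seq, runs_put, runs_seq, runs_put, runs_seq,
      runs_set, runs_seq, runs_set, runs_when]
    simp only [AExp.eval, AExp.cost, St.set_v, St.set_a, St.put_a, St.put_v, reduceCtorEq, if_true,
      if_false, hvi, eEu, eEv, eC, eR, ← hu, ← hw, ← hadef, ← hbdef, hru, hrw, sub_add_sub_pos]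
    set s₁ := (((((s'.set vU u).set vW w).put aGadj (u * n + w) 1).put aGadj (w * n + u) 1).set
      vA a).set vB b with hs₁
    have hg₁ : s₁.a aGadj = Function.update (Function.update (s'.a aGadj) (u * n + w) 1)
        (w * n + u) 1 := by simp [hs₁]
    have hN₁ : NbrLists s₁ n (ClusterEdge s k) := by
      refine h1.congr ?_ ?_ ?_ fun _ _ => Iff.rfl <;> simp [hs₁]
    have hA₁ : s₁.v vA = a := by simp [hs₁]
    have hB₁ : s₁.v vB = b := by simp [hs₁]
    have hR₁ : s₁.a aRow = s.a aRow := by simp [hs₁, eR]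
    have hgadj : ∀ x < n, ∀ y < n, s₁.a aGadj (x * n + y) ≠ 0 ↔ HasEdge s (k + 1) x y := by
      intro x hx y hy
      rw [hasEdge_succ, ← h2 x hx y hy, hg₁]
      simp only [Function.update_apply, mul_add_inj hy hun, mul_add_inj hy hwn, ← hu, ← hw]
      by_cases c1 : x = w ∧ y = u
      · simp [c1]
      · by_cases c2 : x = u ∧ y = w
        · simp [c2]
        · simp only [c1, c2, if_false]
          have c3 : ¬ (u = x ∧ w = y) := fun h => c2 ⟨h.1.symm, h.2.symm⟩
          have c4 : ¬ (u = y ∧ w = x) := fun h => c1 ⟨h.2.symm, h.1.symm⟩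
          simp [c3, c4]
    refine ⟨fun hab => ?_, fun hab => ⟨⟨?_, ?_⟩, by norm_num⟩⟩
    · rw [runs_seq]
      refine addNbr_runs hN₁ (by rw [hR₁]; exact hc.rowA a han) hA₁ hB₁ han hbn ?_
      intro s₂ T₂ hg₂ hN₂ _ hT₂
      refine addNbr_runs hN₂ (by rw [hg₂.2 aRow rfl, hR₁]; exact hc.rowA b hbn)
        (by rw [hg₂.1 vB rfl, hB₁]) (by rw [hg₂.1 vA rfl, hA₁]) hbn han ?_
      intro s₃ T₃ hg₃ hN₃ _ hT₃
      refine ⟨⟨hN₃.congr rfl rfl rfl ?_, ?_⟩, by omega⟩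
      · intro c d
        rw [clusterEdge_succ]
        constructor
        · rintro (h | ⟨_, h | h⟩)
          · exact Or.inl (Or.inl h)
          · exact Or.inl (Or.inr h)
          · exact Or.inr h
        · rintro ((h | ⟨rfl, rfl⟩) | ⟨rfl, rfl⟩)
          · exact Or.inl h
          · exact Or.inr ⟨hab, Or.inl ⟨rfl, rfl⟩⟩
          · exact Or.inr ⟨hab.symm, Or.inr ⟨rfl, rfl⟩⟩
      · rw [hg₃.2 aGadj rfl, hg₂.2 aGadj rfl]
        exact hgadj
    · refine hN₁.congr (by simp [hs₁]) (by simp [hs₁]) (by simp [hs₁]) ?_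
      intro c d
      rw [clusterEdge_succ]
      refine ⟨?_, Or.inl⟩
      rintro (h | ⟨hne, ⟨h3, h4⟩ | ⟨h3, h4⟩⟩)
      · exact h
      · exact absurd (by rw [h3, h4]; tauto) hne
      · exact absurd (by rw [h3, h4]; tauto) hne
    · exact hgadj
  · rintro s' T ha hj ⟨h1, h2⟩ hT hag
    refine post s' _ hag h1 h2 ?_
    simp only [AExp.cost, Nat.sub_zero] at hT
    omega

/-! ### The sides of the components of the cluster graph -/

/-- The nodes visited by the graph search. -/
def visited (s : St) (q : ℕ) : Finset ℕ := (Finset.range q).filter fun c => s.a aSd c ≠ 0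

/-- The stack of the machine, as a list. -/
def stackList (s : St) : List ℕ := arrList (s.a aStk) (s.v vTop)

/-- The side numbers of the visited nodes are consistent with the bipartition `X` of `H`: the sides
of component `j` have the numbers `2 * j + 1` and `2 * j + 2`, and the first of them consists of the
nodes `c` with `X c ↔ p j`. -/
structure Sides (s : St) (q J : ℕ) (H : ℕ → ℕ → Prop) (X p : ℕ → Prop) : Prop where
  good : ∀ c, s.a aSd c ≠ 0 → c < q ∧ ∃ j < J,
    (s.a aSd c = 2 * j + 1 ∧ s.a aSp c = 2 * j + 2 ∧ (X c ↔ p j)) ∨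
    (s.a aSd c = 2 * j + 2 ∧ s.a aSp c = 2 * j + 1 ∧ ¬ (X c ↔ p j))
  edge : ∀ a b, H a b → s.a aSd a ≠ 0 → s.a aSd b ≠ 0 → s.a aSd b = s.a aSp a

/-- Invariant of the graph search in component `J`: visited nodes with unvisited neighbors are on
the stack, except for the pairs in `E`. -/
structure SearchInv (s : St) (q J : ℕ) (H : ℕ → ℕ → Prop) (X p : ℕ → Prop)
    (E : ℕ → ℕ → Prop) : Prop extends Sides s q (J + 1) H X p where
  stack : ∀ x ∈ stackList s, 2 * J + 1 ≤ s.a aSd x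
  closed : ∀ a b, s.a aSd a ≠ 0 → a ∉ stackList s → H a b → E a b ∨ s.a aSd b ≠ 0

/-- The weights `w` serve to account for time and termination: with each node, its weight enters the
stack when the node becomes visited. -/
theorem visitNbrs_runs {s : St} {Q : St → ℕ → Prop} {n q J c : ℕ} {H : ℕ → ℕ → Prop}
    {X p : ℕ → Prop} (hc : c < n) (hrow : s.a aRow c = c * n) (hN : NbrLists s n H)
    (hlt : ∀ a b, H a b → a < q ∧ b < q) (hsym : ∀ a b, H a b → H b a)
    (hX : ∀ a b, H a b → (X a ↔ ¬ X b)) (hC : s.v vC = c) (hcJ : 2 * J + 1 ≤ s.a aSd c)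
    (hI : SearchInv s q J H X p fun a _ => a = c)
    (post : ∀ s' T, Agree visitNbrs s s' → SearchInv s' q J H X p (fun _ _ => False) →
      (∀ w : ℕ → ℕ, ((stackList s').map w).sum + ∑ x ∈ visited s q, w x =
        ((stackList s).map w).sum + ∑ x ∈ visited s' q, w x) →
      (∀ x, s.a aSd x ≠ 0 → s'.a aSd x ≠ 0) →
      T ≤ s.a aFl c * 60 + 20 → Q s' T) :
    Runs visitNbrs s Q := by
  refine Runs.of_agree ?_
  unfold visitNbrs
  set f := row (s.a aFn) n c with hf
  refine Runs.forB (fun j s' => SearchInv s' q J H X p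
      (fun a b => a = c ∧ ∃ i, j ≤ i ∧ i < s.a aFl c ∧ f i = b) ∧
      s'.a aSd c = s.a aSd c ∧ s'.a aSp c = s.a aSp c ∧
      (∀ x, s.a aSd x ≠ 0 → s'.a aSd x ≠ 0) ∧
      (∀ w : ℕ → ℕ, ((stackList s').map w).sum + ∑ x ∈ visited s q, w x =
        ((stackList s).map w).sum + ∑ x ∈ visited s' q, w x))
    0 (s.a aFl c) 45 (Nat.zero_le _) rfl rfl ?_ ?_ ?_ ?_
  · intro j s' ha _
    simp [ha.1 vC rfl, ha.2 aFl rfl, hC]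
  · refine ⟨⟨⟨hI.good, hI.edge⟩, hI.stack, ?_⟩, rfl, rfl, fun _ h => h, fun w => rfl⟩
    intro a b ha hs hab
    rcases hI.closed a b ha hs hab with rfl | h
    · obtain ⟨i, hi, hi'⟩ := mem_arrList.1 ((hN.mem a hc b).2 hab)
      exact Or.inl ⟨rfl, i, Nat.zero_le _, hi, hi'⟩
    · exact Or.inr h
  · rintro j s' - hj ha hvj ⟨hI', h1, h2, hmono, h3⟩
    have eFn : s'.a aFn = s.a aFn := ha.2 aFn rfl
    have eR : s'.a aRow = s.a aRow := ha.2 aRow rfl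
    have eC : s'.v vC = c := (ha.1 vC rfl).trans hC
    set b := f j with hb
    have hbe : s.a aFn (c * n + j) = b := rfl
    have hcb : H c b := (hN.mem c hc b).1 (mem_arrList.2 ⟨j, hj, rfl⟩)
    simp only [runs_seq, runs_set, runs_put, runs_when, AExp.eval, AExp.cost, St.set_v, St.set_a,
      St.put_a, St.put_v, reduceCtorEq, if_true, if_false, hvj, eFn, eR, eC, hrow, hbe, h1, h2]
    refine ⟨fun hbv => ⟨?_, by norm_num⟩, fun hbv => ⟨?_, by norm_num⟩⟩
    · have hb0 : s'.a aSd b = 0 := by omega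
      have hcv : s'.a aSd c ≠ 0 := by omega
      have hcb' : c ≠ b := by intro h; rw [h] at hcv; exact hcv hb0
      rw [Function.update_of_ne hcb', h1]
      set s₁ := (((((((s'.set vB b).put aSd b (s.a aSp c)).put aSp b (s.a aSd c)).put aStk
        (s'.v vTop) b).set vTop (s'.v vTop + 1))).set vJ (j + 1)) with hs₁
      have hsd : s₁.a aSd = Function.update (s'.a aSd) b (s.a aSp c) := by simp [hs₁]
      have hsp : s₁.a aSp = Function.update (s'.a aSp) b (s.a aSd c) := by simp [hs₁]
      have hstk : stackList s₁ = stackList s' ++ [b] := by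
        simp only [stackList, hs₁, St.set_a, St.set_v, St.put_a, St.put_v, reduceCtorEq, if_true,
          if_false]
        exact arrList_push _ _ _
      have hother : ∀ x, s'.a aSd x ≠ 0 → s₁.a aSd x = s'.a aSd x ∧ s₁.a aSp x = s'.a aSp x := by
        intro x hx
        have : x ≠ b := by rintro rfl; exact hx hb0
        rw [hsd, hsp, Function.update_of_ne this, Function.update_of_ne this]
        exact ⟨rfl, rfl⟩
      have hbsd : s₁.a aSd b = s.a aSp c := by rw [hsd, Function.update_self]
      have hbsp : s₁.a aSp b = s.a aSd c := by rw [hsp, Function.update_self]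
      have hcg : (s.a aSd c = 2 * J + 1 ∧ s.a aSp c = 2 * J + 2 ∧ (X c ↔ p J)) ∨
          (s.a aSd c = 2 * J + 2 ∧ s.a aSp c = 2 * J + 1 ∧ ¬ (X c ↔ p J)) := by
        obtain ⟨-, i, hi, h⟩ := hI'.good c hcv
        rw [h1, h2] at h
        obtain rfl : i = J := by omega
        exact h
      have hspc : s.a aSp c ≠ 0 := by omega
      have hback : ∀ x, s₁.a aSd x ≠ 0 → x = b ∨ s'.a aSd x ≠ 0 := by
        intro x hx
        by_cases hxb : x = b
        · exact Or.inl hxb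
        · rw [hsd, Function.update_of_ne hxb] at hx
          exact Or.inr hx
      have hXcb := hX c b hcb
      -- a visited neighbor of the new node lies in the current component
      have hnb : ∀ a, H a b → s'.a aSd a ≠ 0 → s'.a aSd a = s.a aSd c ∧ s'.a aSp a = s.a aSp c := by
        intro a hab hav
        have hXab := hX a b hab
        have hJ : 2 * J + 1 ≤ s'.a aSd a := by
          by_cases hst : a ∈ stackList s'
          · exact hI'.stack a hst
          · rcases hI'.closed a b hav hst hab with ⟨rfl, _⟩ | h
            · omega
            · exact absurd hb0 h
        obtain ⟨-, i, hi, h⟩ := hI'.good a hav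
        obtain rfl : i = J := by omega
        rcases h with ⟨g1, g2, g3⟩ | ⟨g1, g2, g3⟩ <;> rcases hcg with ⟨k1, k2, k3⟩ | ⟨k1, k2, k3⟩
        · omega
        · tauto
        · tauto
        · omega
      refine ⟨⟨⟨?_, ?_⟩, ?_, ?_⟩, ?_, ?_, ?_, ?_⟩
      · intro x hx
        by_cases hxb : x = b
        · rw [hxb, hbsd, hbsp]
          refine ⟨(hlt c b hcb).2, J, by omega, ?_⟩
          rcases hcg with ⟨k1, k2, k3⟩ | ⟨k1, k2, k3⟩
          · exact Or.inr ⟨k2, k1, by tauto⟩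
          · exact Or.inl ⟨k2, k1, by tauto⟩
        · have hx' := (hback x hx).resolve_left hxb
          rw [(hother x hx').1, (hother x hx').2]
          exact hI'.good x hx'
      · intro x y hxy hx hy
        rcases hback x hx with rfl | hx' <;> rcases hback y hy with rfl | hy'
        · exact absurd (hX _ _ hxy) (by tauto)
        · rw [(hother y hy').1, hbsp, (hnb y (hsym _ _ hxy) hy').1]
        · rw [(hother x hx').2, hbsd, (hnb x hxy hx').2]
        · rw [(hother x hx').2, (hother y hy').1]
          exact hI'.edge x y hxy hx' hy'
      · intro x hx
        rw [hstk, List.mem_append, List.mem_singleton] at hx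
        rcases hx with hx | rfl
        · have := hI'.stack x hx
          rw [(hother x (by omega)).1]; exact this
        · rw [hbsd]; omega
      · intro x y hx hxs hxy
        rw [hstk, List.mem_append, List.mem_singleton, not_or] at hxs
        have hx' := (hback x hx).resolve_left hxs.2
        rcases hI'.closed x y hx' hxs.1 hxy with ⟨rfl, i, hi, hi', hiy⟩ | h
        · by_cases hij : i = j
          · subst hij
            rw [← hiy]
            exact Or.inr (by rw [← hb, hbsd]; exact hspc)
          · exact Or.inl ⟨rfl, i, by omega, hi', hiy⟩
        · exact Or.inr (by rw [(hother y h).1]; exact h)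
      · rfl
      · rw [Function.update_of_ne hcb', h2]
      · intro x hx
        exact fun h => hmono x hx ((hother x (hmono x hx)).1.symm.trans h)
      · intro w
        have hvis : visited s₁ q = insert b (visited s' q) := by
          ext x
          simp only [visited, Finset.mem_filter, Finset.mem_range, Finset.mem_insert]
          constructor
          · rintro ⟨hxq, hx⟩
            exact (hback x hx).imp id fun h => ⟨hxq, h⟩
          · rintro (rfl | ⟨hxq, hx⟩)
            · exact ⟨(hlt c b hcb).2, by rw [hbsd]; exact hspc⟩
            · exact ⟨hxq, by rw [(hother x hx).1]; exact hx⟩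
        have hnot : b ∉ visited s' q := by simp [visited, hb0]
        rw [hvis, Finset.sum_insert hnot, hstk, List.map_append, List.sum_append]
        have := h3 w
        simp only [List.map_cons, List.map_nil, List.sum_cons, List.sum_nil]
        omega
    · refine ⟨⟨⟨hI'.good, hI'.edge⟩, hI'.stack, ?_⟩, trivial, trivial, hmono, h3⟩
      intro x y hx hxs hxy
      rcases hI'.closed x y hx hxs hxy with ⟨rfl, i, hi, hi', hiy⟩ | h
      · by_cases hij : i = j
        · subst hij
          rw [← hiy]
          exact Or.inr (by simp only [St.set_a, ← hb]; omega)
        · exact Or.inl ⟨rfl, i, by omega, hi', hiy⟩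
      · exact Or.inr h
  · rintro s' T ha hj ⟨hI', h1, h2, hmono, h3⟩ hT hag
    refine post s' T hag ⟨⟨hI'.good, hI'.edge⟩, hI'.stack, ?_⟩ h3 hmono ?_
    · intro x y hx hxs hxy
      rcases hI'.closed x y hx hxs hxy with ⟨_, i, hi, hi', _⟩ | h
      · omega
      · exact Or.inr h
    · simp only [AExp.cost, Nat.sub_zero] at hT
      omega

/-- The bipartition `X` is not known to the algorithm. In each component it determines the sides up
to an exchange, which is why `Sides` has the additional parameter `p`. -/
theorem sidePhase_runs {s : St} {Q : St → ℕ → Prop} {n q : ℕ} {H : ℕ → ℕ → Prop}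
    {X : ℕ → Prop} (hqn : q ≤ n) (hQ : s.v vQ = q) (hrow : ∀ c < n, s.a aRow c = c * n)
    (hN : NbrLists s n H)
    (hlt : ∀ a b, H a b → a < q ∧ b < q) (hsym : ∀ a b, H a b → H b a)
    (hX : ∀ a b, H a b → (X a ↔ ¬ X b)) (hsd : ∀ c, s.a aSd c = 0)
    (post : ∀ s' T J p, Agree sidePhase s s' → Sides s' q J H X p → (∀ c < q, s'.a aSd c ≠ 0) →
      T ≤ (∑ c ∈ Finset.range q, s.a aFl c) * 60 + q * 100 + 20 → Q s' T) :
    Runs sidePhase s Q := by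
  refine Runs.of_agree ?_
  unfold sidePhase
  rw [runs_seq, runs_set]
  set w : ℕ → ℕ := fun c => s.a aFl c * 60 + 40 with hw
  refine Runs.forT (fun r s' T => ∃ J p, Sides s' q J H X p ∧ s'.v vK = 2 * J + 1 ∧
      (∀ c < r, s'.a aSd c ≠ 0) ∧ (∀ a b, s'.a aSd a ≠ 0 → H a b → s'.a aSd b ≠ 0) ∧
      T ≤ ∑ c ∈ visited s' q, w c + r * 60 + 3)
    0 q (Nat.zero_le _) rfl rfl ?_ ?_ ?_ ?_
  · intro r s' T ha _
    simp [ha.1 vQ rfl, hQ]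
  · refine ⟨0, fun _ => True, ⟨fun c h => absurd (hsd c) h, fun a b _ h => absurd (hsd a) h⟩, ?_⟩
    simp [hsd, AExp.cost, AExp.eval]
  · rintro r s' T - hr ha hvr ⟨J, p, hS, hK, hvis, hcl, hT⟩
    have eR : s'.a aRow = s.a aRow := ha.2 aRow rfl
    have eFn : s'.a aFn = s.a aFn := ha.2 aFn rfl
    have eFl : s'.a aFl = s.a aFl := ha.2 aFl rfl
    have eFa : s'.a aFadj = s.a aFadj := ha.2 aFadj rfl
    rw [runs_when]
    simp only [AExp.eval, AExp.cost, hvr]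
    refine ⟨fun h0 => ?_, fun h0 => ?_⟩
    · have hr0 : s'.a aSd r = 0 := by omega
      simp only [runs_seq, runs_set, runs_put, AExp.eval, AExp.cost, St.set_v, St.set_a,
        St.put_v, reduceCtorEq, if_false, hvr, hK]
      set s₁ := ((((((s'.put aSd r (2 * J + 1)).put aSp r (2 * J + 1 + 1)).set vK
        (2 * J + 1 + 2)).put aStk 0 r)).set vTop 1) with hs₁
      have hsd₁ : s₁.a aSd = Function.update (s'.a aSd) r (2 * J + 1) := by simp [hs₁]
      have hsp₁ : s₁.a aSp = Function.update (s'.a aSp) r (2 * J + 2) := by simp [hs₁]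
      have hstk₁ : stackList s₁ = [r] := by simp [stackList, hs₁, arrList_succ]
      have hother : ∀ x, x ≠ r → s₁.a aSd x = s'.a aSd x ∧ s₁.a aSp x = s'.a aSp x := by
        intro x hx
        rw [hsd₁, hsp₁, Function.update_of_ne hx, Function.update_of_ne hx]
        exact ⟨rfl, rfl⟩
      have hrsd : s₁.a aSd r = 2 * J + 1 := by rw [hsd₁, Function.update_self]
      have hrsp : s₁.a aSp r = 2 * J + 2 := by rw [hsp₁, Function.update_self]
      have hvis₁ : visited s₁ q = insert r (visited s' q) := by
        ext x
        simp only [visited, Finset.mem_filter, Finset.mem_range, Finset.mem_insert]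
        by_cases hx : x = r
        · subst hx; simp [hrsd, hr]
        · rw [(hother x hx).1]; simp [hx]
      have hrnot : r ∉ visited s' q := by simp [visited, hr0]
      have hnadj : ∀ a, s'.a aSd a ≠ 0 → ¬ H a r := fun a h1 h2 => hcl a r h1 h2 hr0
      set p' : ℕ → Prop := fun j => if j = J then X r else p j with hp'
      have hI₁ : SearchInv s₁ q J H X p' fun _ _ => False := by
        refine ⟨⟨?_, ?_⟩, ?_, ?_⟩
        · intro c hc
          by_cases hcr : c = r
          · rw [hcr, hrsd, hrsp]
            exact ⟨hr, J, by omega, Or.inl ⟨rfl, rfl, by simp [hp']⟩⟩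
          · rw [(hother c hcr).1] at hc
            rw [(hother c hcr).1, (hother c hcr).2]
            obtain ⟨h1, j, hj, h⟩ := hS.good c hc
            refine ⟨h1, j, by omega, ?_⟩
            have : j ≠ J := by omega
            simpa [hp', this] using h
        · intro a b hab h1 h2
          by_cases har : a = r
          · by_cases hbr : b = r
            · have := hX a b hab
              rw [har, hbr] at this; tauto
            · rw [(hother b hbr).1] at h2
              rw [har] at hab
              exact absurd (hsym _ _ hab) (hnadj b h2)
          · rw [(hother a har).1] at h1
            by_cases hbr : b = r
            · rw [hbr] at hab
              exact absurd hab (hnadj a h1)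
            · rw [(hother b hbr).1] at h2
              rw [(hother b hbr).1, (hother a har).2]
              exact hS.edge a b hab h1 h2
        · intro x hx
          rw [hstk₁, List.mem_singleton] at hx
          rw [hx, hrsd]
        · intro a b h1 h2 hab
          rw [hstk₁, List.mem_singleton] at h2
          rw [(hother a h2).1] at h1
          have hb := hcl a b h1 hab
          have hbr : b ≠ r := by rintro rfl; exact hb hr0
          exact Or.inr (by rw [(hother b hbr).1]; exact hb)
      have eR₁ : s₁.a aRow = s.a aRow := by simp [hs₁, eR]
      have eFn₁ : s₁.a aFn = s.a aFn := by simp [hs₁, eFn]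
      have eFl₁ : s₁.a aFl = s.a aFl := by simp [hs₁, eFl]
      have eFa₁ : s₁.a aFadj = s.a aFadj := by simp [hs₁, eFa]
      refine Runs.loop (fun s₂ T₂ => SearchInv s₂ q J H X p' (fun _ _ => False) ∧
          (∀ x, s₁.a aSd x ≠ 0 → s₂.a aSd x ≠ 0) ∧
          T₂ + ((stackList s₂).map w).sum + ∑ x ∈ visited s' q, w x ≤ ∑ x ∈ visited s₂ q, w x)
        (fun s₂ => s₂.v vTop + (q - (visited s₂ q).card)) ?_ ?_ ?_
      · refine ⟨hI₁, fun _ h => h, ?_⟩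
        rw [hstk₁, hvis₁, Finset.sum_insert hrnot]
        simp
      · rintro s₂ T₂ ha₂ ⟨hI₂, hm₂, hT₂⟩ hpos
        simp only [AExp.eval] at hpos
        obtain ⟨top, htop⟩ : ∃ top, s₂.v vTop = top + 1 := ⟨s₂.v vTop - 1, by omega⟩
        set c := s₂.a aStk top with hc
        have hstk₂ : stackList s₂ = arrList (s₂.a aStk) top ++ [c] := by
          rw [stackList, htop, arrList_succ]
        have hcJ : 2 * J + 1 ≤ s₂.a aSd c := hI₂.stack c (by simp [hstk₂])
        have hcq : c < q := (hI₂.good c (by omega)).1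
        simp only [runs_seq, runs_set, AExp.eval, AExp.cost, St.set_v, St.set_a, if_true, htop,
          Nat.add_sub_cancel, ← hc]
        set s₃ := (s₂.set vTop top).set vC c with hs₃
        have ea₃ : s₃.a = s₂.a := rfl
        have hstk₃ : stackList s₃ = arrList (s₂.a aStk) top := by simp [stackList, hs₃]
        have hvis₃ : visited s₃ q = visited s₂ q := rfl
        have eFl₃ : s₃.a aFl = s.a aFl := by rw [ea₃, ha₂.2 aFl rfl, eFl₁]
        refine visitNbrs_runs (s := s₃) (hcq.trans_le hqn)
          (by rw [ea₃, ha₂.2 aRow rfl, eR₁]; exact hrow c (hcq.trans_le hqn))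
          (hN.congr (by rw [ea₃, ha₂.2 aFadj rfl, eFa₁]) (by rw [ea₃, ha₂.2 aFn rfl, eFn₁])
            eFl₃ fun _ _ => Iff.rfl) hlt hsym hX (by simp [hs₃]) hcJ (p := p') (J := J)
          ⟨⟨hI₂.good, hI₂.edge⟩, ?_, ?_⟩ ?_
        · intro x hx
          rw [hstk₃] at hx
          exact hI₂.stack x (by simp [hstk₂, hx])
        · intro a b h1 h2 hab
          rw [hstk₃] at h2
          by_cases hac : a = c
          · exact Or.inl hac
          · exact Or.inr ((hI₂.closed a b h1 (by simp [hstk₂, h2, hac]) hab).resolve_left id)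
        · intro s₄ T₄ hg₄ hI₄ hsum hm₄ hT₄
          rw [hstk₃, hvis₃] at hsum
          refine ⟨⟨hI₄, fun x hx => hm₄ x (hm₂ x hx), ?_⟩, ?_⟩
          · have := hsum w
            rw [hstk₂] at hT₂
            simp only [List.map_append, List.sum_append, List.map_cons, List.map_nil,
              List.sum_cons, List.sum_nil] at hT₂
            rw [eFl₃] at hT₄
            have hwc : w c = s.a aFl c * 60 + 40 := rfl
            omega
          · have := hsum fun _ => 1
            simp only [List.map_const', List.sum_replicate, arrList_length, stackList,
              Finset.sum_const, smul_eq_mul, mul_one] at this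
            have h5 : (visited s₄ q).card ≤ q := by
              simpa [visited] using Finset.card_le_card (Finset.filter_subset _ (Finset.range q))
            have h6 : (visited s₂ q).card ≤ q := by
              simpa [visited] using Finset.card_le_card (Finset.filter_subset _ (Finset.range q))
            omega
      · rintro s₂ T₂ ha₂ ⟨hI₂, hm₂, hT₂⟩ hpos
        simp only [AExp.eval, not_lt, Nat.le_zero] at hpos
        have hstk₂ : stackList s₂ = [] := by simp [stackList, hpos]
        rw [hstk₂] at hT₂
        refine ⟨J + 1, p', ⟨hI₂.good, hI₂.edge⟩, ?_, ?_, ?_, ?_⟩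
        · rw [ha₂.1 vK rfl]
          simp only [hs₁, St.set_v, St.put_v, reduceCtorEq, if_true, if_false]
          omega
        · intro c hc
          refine hm₂ c ?_
          by_cases hcr : c = r
          · rw [hcr, hrsd]; omega
          · rw [(hother c hcr).1]; exact hvis c (by omega)
        · intro a b h1 hab
          exact (hI₂.closed a b h1 (by simp [hstk₂]) hab).resolve_left id
        · have e : visited (s₂.set vR (r + 1)) q = visited s₂ q := rfl
          rw [e]
          simp only [List.map_nil, List.sum_nil, AExp.cost] at hT₂ ⊢
          omega
    · refine ⟨J, p, ⟨hS.good, hS.edge⟩, by simpa using hK, ?_, hcl, ?_⟩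
      · intro c hc
        rcases Nat.lt_succ_iff_lt_or_eq.1 hc with h | rfl
        · exact hvis c h
        · show s'.a aSd c ≠ 0
          omega
      · have e : visited (s'.set vR (r + 1)) q = visited s' q := rfl
        rw [e]; omega
  · rintro s' T ha hr ⟨J, p, hS, hK, hvis, hcl, hT⟩ hag
    refine post s' _ J p hag hS hvis ?_
    have : ∑ c ∈ visited s' q, w c ≤ ∑ c ∈ Finset.range q, w c :=
      Finset.sum_le_sum_of_subset (Finset.filter_subset _ _)
    have h2 : ∑ c ∈ Finset.range q, w c = (∑ c ∈ Finset.range q, s.a aFl c) * 60 + q * 40 := by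
      simp [hw, Finset.sum_add_distrib, Finset.sum_mul]
    simp only [AExp.cost]
    omega

/-! ### Constraint nodes and fill edges -/

theorem degreePhase_runs {s : St} {Q : St → ℕ → Prop} {q : ℕ} (hQ : s.v vQ = q)
    (hdm : ∀ k, s.a aDm k = 0)
    (post : ∀ s' T, Agree degreePhase s s' → (∀ c < q, s'.a aHl c = s.a aFl c) →
      (∀ c < q, s.a aFl c ≤ s'.a aDm (s.a aSd c)) →
      (∀ k, s'.a aDm k ≠ 0 → ∃ c < q, s.a aSd c = k ∧ s.a aFl c = s'.a aDm k) →
      T ≤ q * 40 + 10 → Q s' T) :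
    Runs degreePhase s Q := by
  refine Runs.of_agree ?_
  unfold degreePhase
  refine Runs.forB (fun k s' => (∀ c < k, s'.a aHl c = s.a aFl c) ∧
      (∀ c < k, s.a aFl c ≤ s'.a aDm (s.a aSd c)) ∧
      (∀ j, s'.a aDm j ≠ 0 → ∃ c < k, s.a aSd c = j ∧ s.a aFl c = s'.a aDm j))
    0 q 30 (Nat.zero_le _) rfl rfl ?_ ?_ ?_ ?_
  · intro k s' ha _
    simp [ha.1 vQ rfl, hQ]
  · exact ⟨fun c h => by omega, fun c h => by omega, fun j h => absurd (hdm j) h⟩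
  · rintro k s' - hk ha hvk ⟨h1, h2, h3⟩
    have eFl : s'.a aFl = s.a aFl := ha.2 aFl rfl
    have eSd : s'.a aSd = s.a aSd := ha.2 aSd rfl
    have hhl : ∀ c < k + 1, Function.update (s'.a aHl) k (s.a aFl k) c = s.a aFl c := by
      intro c hc
      by_cases hck : c = k
      · subst hck; rw [Function.update_self]
      · rw [Function.update_of_ne hck]; exact h1 c (by omega)
    simp only [runs_seq, runs_put, runs_when, AExp.eval, AExp.cost, St.set_a, St.put_a,
      St.put_v, reduceCtorEq, if_true, if_false, hvk, eFl, eSd]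
    refine ⟨fun hlt => ⟨⟨hhl, ?_, ?_⟩, by norm_num⟩, fun hge => ⟨⟨hhl, ?_, ?_⟩, by norm_num⟩⟩
    · intro c hc
      by_cases hs : s.a aSd c = s.a aSd k
      · rw [hs, Function.update_self]
        rcases Nat.lt_succ_iff_lt_or_eq.1 hc with h | rfl
        · have := h2 c h
          rw [hs] at this; omega
        · exact le_rfl
      · rw [Function.update_of_ne hs]
        rcases Nat.lt_succ_iff_lt_or_eq.1 hc with h | rfl
        · exact h2 c h
        · exact absurd rfl hs
    · intro j hj
      by_cases hs : j = s.a aSd k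
      · subst hs
        exact ⟨k, by omega, rfl, by rw [Function.update_self]⟩
      · rw [Function.update_of_ne hs] at hj ⊢
        obtain ⟨c, hc, h⟩ := h3 j hj
        exact ⟨c, by omega, h⟩
    · intro c hc
      rcases Nat.lt_succ_iff_lt_or_eq.1 hc with h | rfl
      · exact h2 c h
      · omega
    · intro j hj
      obtain ⟨c, hc, h⟩ := h3 j hj
      exact ⟨c, by omega, h⟩
  · rintro s' T ha hj ⟨h1, h2, h3⟩ hT hag
    refine post s' _ hag h1 h2 h3 ?_
    simp only [AExp.cost, Nat.sub_zero] at hT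
    omega

/-- The rule by which a node is chosen as constraint node: the maximum degree of its side is smaller
than that of the other side, with ties broken by the numbers of the sides. -/
def OnConstraintSide (s : St) (c : ℕ) : Prop :=
  s.a aDm (s.a aSd c) < s.a aDm (s.a aSp c) ∨
    (s.a aDm (s.a aSd c) = s.a aDm (s.a aSp c) ∧ s.a aSd c < s.a aSp c)

theorem choosePhase_runs {s : St} {Q : St → ℕ → Prop} {q : ℕ} (hQ : s.v vQ = q)
    (hP : s.v vP = 0) (hY : ∀ k, s.a aY k = 0)
    (post : ∀ s' T, Agree choosePhase s s' →
      (∀ c, s'.a aY c ≠ 0 ↔ c < q ∧ OnConstraintSide s c) →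
      (∀ c, s'.a aY c ≠ 0 → s.a aFl c ≤ s'.v vP) →
      (s'.v vP ≠ 0 → ∃ c, s'.a aY c ≠ 0 ∧ s.a aFl c = s'.v vP) →
      T ≤ q * 60 + 10 → Q s' T) :
    Runs choosePhase s Q := by
  refine Runs.of_agree ?_
  unfold choosePhase
  refine Runs.forB (fun k s' => (∀ c, s'.a aY c ≠ 0 ↔ c < k ∧ OnConstraintSide s c) ∧
      (∀ c, s'.a aY c ≠ 0 → s.a aFl c ≤ s'.v vP) ∧
      (s'.v vP ≠ 0 → ∃ c, s'.a aY c ≠ 0 ∧ s.a aFl c = s'.v vP))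
    0 q 50 (Nat.zero_le _) rfl rfl ?_ ?_ ?_ ?_
  · intro k s' ha _
    simp [ha.1 vQ rfl, hQ]
  · refine ⟨fun c => ?_, fun c h => ?_, fun h => ?_⟩
    · simp [hY]
    · simp [hY] at h
    · simp [hP] at h
  · rintro k s' - hk ha hvk ⟨h1, h2, h3⟩
    have eFl : s'.a aFl = s.a aFl := ha.2 aFl rfl
    have eSd : s'.a aSd = s.a aSd := ha.2 aSd rfl
    have eSp : s'.a aSp = s.a aSp := ha.2 aSp rfl
    have eDm : s'.a aDm = s.a aDm := ha.2 aDm rfl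
    rw [runs_seq, runs_set, runs_seq, runs_set]
    simp only [AExp.eval, AExp.cost, St.set_v, St.set_a, reduceCtorEq,
      if_false, hvk, eSd, eSp, eDm]
    set s₁ := (s'.set vA (s.a aDm (s.a aSd k))).set vB (s.a aDm (s.a aSp k)) with hs₁
    have ea₁ : s₁.a = s'.a := rfl
    have eP₁ : s₁.v vP = s'.v vP := by simp [hs₁]
    have eC₁ : s₁.v vC = k := by simp [hs₁, hvk]
    have eA₁ : s₁.v vA = s.a aDm (s.a aSd k) := by simp [hs₁]
    have eB₁ : s₁.v vB = s.a aDm (s.a aSp k) := by simp [hs₁]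
    have mark : OnConstraintSide s k → Runs markNode s₁ fun s'' t =>
        ((∀ c, s''.a aY c ≠ 0 ↔ c < k + 1 ∧ OnConstraintSide s c) ∧
        (∀ c, s''.a aY c ≠ 0 → s.a aFl c ≤ s''.v vP) ∧
        (s''.v vP ≠ 0 → ∃ c, s''.a aY c ≠ 0 ∧ s.a aFl c = s''.v vP)) ∧ t ≤ 20 := by
      intro hside
      have hY' : ∀ c, Function.update (s'.a aY) k 1 c ≠ 0 ↔ c < k + 1 ∧ OnConstraintSide s c := by
        intro c
        by_cases hck : c = k
        · subst hck; simp [hside]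
        · rw [Function.update_of_ne hck, h1]
          simp only [and_congr_left_iff]
          intro _; omega
      have hback : ∀ c, Function.update (s'.a aY) k 1 c ≠ 0 → c = k ∨ s'.a aY c ≠ 0 := by
        intro c hc
        by_cases hck : c = k
        · exact Or.inl hck
        · rw [Function.update_of_ne hck] at hc
          exact Or.inr hc
      have hforth : ∀ c, s'.a aY c ≠ 0 → Function.update (s'.a aY) k 1 c ≠ 0 := by
        intro c hc
        by_cases hck : c = k
        · simp [hck]
        · rwa [Function.update_of_ne hck]
      unfold markNode
      simp only [runs_seq, runs_set, runs_put, runs_when, AExp.eval, AExp.cost, St.set_v, St.set_a,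
        St.put_a, St.put_v, reduceCtorEq, if_true, if_false, eC₁, ea₁, eFl, eP₁]
      refine ⟨fun hlt => ⟨⟨hY', ?_, ?_⟩, by norm_num⟩, fun hge => ⟨⟨hY', ?_, ?_⟩, by norm_num⟩⟩
      · intro c hc
        rcases hback c hc with rfl | hc
        · exact le_rfl
        · have := h2 c hc
          omega
      · exact fun _ => ⟨k, by simp, rfl⟩
      · intro c hc
        rcases hback c hc with rfl | hc
        · omega
        · exact h2 c hc
      · intro h
        obtain ⟨c, hc, hc'⟩ := h3 h
        exact ⟨c, hforth c hc, hc'⟩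
    have skip : ¬ OnConstraintSide s k →
        ((∀ c, s₁.a aY c ≠ 0 ↔ c < k + 1 ∧ OnConstraintSide s c) ∧
        (∀ c, s₁.a aY c ≠ 0 → s.a aFl c ≤ s₁.v vP) ∧
        (s₁.v vP ≠ 0 → ∃ c, s₁.a aY c ≠ 0 ∧ s.a aFl c = s₁.v vP)) := by
      intro hside
      rw [ea₁, eP₁]
      refine ⟨fun c => ?_, h2, h3⟩
      rw [h1]
      by_cases hck : c = k
      · subst hck; simp [hside]
      · simp only [and_congr_left_iff]
        intro _; omega
    have set_vC : ∀ s'' : St, (s''.set vC (k + 1)).v vP = s''.v vP := fun s'' => by simp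
    simp only [runs_ite, runs_when, runs_skip, AExp.eval, AExp.cost, eA₁, eB₁, eC₁, ea₁, eSd, eSp]
    refine ⟨fun h => ?_, fun h => ⟨fun h' => ?_, fun h' => ⟨fun h'' => ?_, fun h'' => ?_⟩⟩⟩
    · exact (mark (Or.inl h)).mono fun s'' t ⟨h4, h5⟩ => ⟨h4, by omega⟩
    · exact ⟨skip (by unfold OnConstraintSide; omega), by norm_num⟩
    · exact (mark (Or.inr ⟨by omega, h''⟩)).mono fun s'' t ⟨h4, h5⟩ => ⟨h4, by omega⟩
    · exact ⟨skip (by unfold OnConstraintSide; omega), by norm_num⟩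
  · rintro s' T ha hj ⟨h1, h2, h3⟩ hT hag
    refine post s' _ hag h1 h2 h3 ?_
    simp only [AExp.cost, Nat.sub_zero] at hT
    omega

/-- The nodes `a` and `b` are distinct neighbors of one of the constraint nodes below `k`. -/
def ShareBelow (s : St) (k : ℕ) (H : ℕ → ℕ → Prop) (a b : ℕ) : Prop :=
  a ≠ b ∧ ∃ y < k, s.a aY y ≠ 0 ∧ H y a ∧ H y b

/-- The new neighbors are appended, so that the original list of each node remains a prefix. -/
theorem fillPhase_runs {s : St} {Q : St → ℕ → Prop} {n q K : ℕ} {H : ℕ → ℕ → Prop}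
    (hqn : q ≤ n) (hQ : s.v vQ = q) (hrow : ∀ c < n, s.a aRow c = c * n) (hN : NbrLists s n H)
    (hhl : ∀ c < q, s.a aHl c = s.a aFl c) (hK : ∀ c < q, s.a aY c ≠ 0 → s.a aFl c ≤ K)
    (post : ∀ s' T, Agree fillPhase s s' →
      NbrLists s' n (fun a b => H a b ∨ ShareBelow s q H a b) →
      (∀ c < n, nbrList s n c <+: nbrList s' n c) →
      T ≤ q * (K * (K * 80 + 30) + 40) + 10 → Q s' T) :
    Runs fillPhase s Q := by
  refine Runs.of_agree ?_
  unfold fillPhase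
  refine Runs.forB (fun k s' => NbrLists s' n (fun a b => H a b ∨ ShareBelow s k H a b) ∧
      (∀ c < n, nbrList s n c <+: nbrList s' n c))
    0 q (K * (K * 80 + 30) + 30) (Nat.zero_le _) rfl rfl ?_ ?_ ?_ ?_
  · intro k s' ha _
    simp [ha.1 vQ rfl, hQ]
  · refine ⟨hN.congr rfl rfl rfl fun a b => ?_, fun c _ => List.prefix_rfl⟩
    simp [ShareBelow]
  · rintro k s' - hk ha hvk ⟨h1, h2⟩
    have eY : s'.a aY = s.a aY := ha.2 aY rfl
    have eR : s'.a aRow = s.a aRow := ha.2 aRow rfl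
    have eHl : s'.a aHl = s.a aHl := ha.2 aHl rfl
    have hkn : k < n := by omega
    rw [runs_when]
    simp only [AExp.eval, AExp.cost, hvk, eY]
    refine ⟨fun hYk => ?_, fun hYk => ⟨⟨h1.congr rfl rfl rfl fun a b => ?_, h2⟩, by omega⟩⟩
    swap
    · simp only [ShareBelow]
      refine or_congr_right (and_congr_right fun _ => ⟨?_, ?_⟩)
      · rintro ⟨y, hy, h⟩
        refine ⟨y, ?_, h⟩
        have : y ≠ k := by rintro rfl; omega
        omega
      · rintro ⟨y, hy, h⟩
        exact ⟨y, by omega, h⟩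
    have hYk' : s.a aY k ≠ 0 := by omega
    set f := row (s.a aFn) n k with hf
    set len := s.a aHl k with hlen
    have hlenK : len ≤ K := by rw [hlen, hhl k hk]; exact hK k hk hYk'
    have hlist : nbrList s n k = arrList f len := by rw [nbrList, hlen, hhl k hk]
    have hmem : ∀ b, (∃ i < len, f i = b) ↔ H k b := fun b => by
      rw [← hN.mem k hkn b, hlist, mem_arrList]
    -- the original neighbor list of the constraint node stays readable
    have hread : ∀ s'' : St, (∀ c < n, nbrList s n c <+: nbrList s'' n c) → ∀ i < len,
        s''.a aFn (k * n + i) = f i := by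
      intro s'' hp i hi
      have hpk := hp k hkn
      rw [hlist] at hpk
      have h3 : i < (arrList f len).length := by simpa using hi
      have h4 := hpk.getElem h3
      simp only [nbrList, arrList, List.getElem_map, List.getElem_range] at h4
      exact h4.symm
    let R : ℕ → ℕ → ℕ → ℕ → Prop := fun i j a b => (H a b ∨ ShareBelow s k H a b) ∨
      (a ≠ b ∧ ((∃ i' < i, ∃ j' < len, f i' = a ∧ f j' = b) ∨ (f i = a ∧ ∃ j' < j, f j' = b)))
    refine Runs.forB (fun i s₁ => NbrLists s₁ n (R i 0) ∧
        (∀ c < n, nbrList s n c <+: nbrList s₁ n c))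
      0 len (K * 80 + 20) (Nat.zero_le _) rfl rfl ?_ ?_ ?_ ?_
    · intro i s₁ ha₁ _
      simp [ha₁.1 vC rfl, hvk, ha₁.2 aHl rfl, eHl, hlen]
    · refine ⟨h1.congr rfl rfl rfl fun a b => ?_, h2⟩
      simp [R]
    · rintro i s₁ - hi ha₁ hvi ⟨h3, h4⟩
      refine Runs.forB (fun j s₂ => NbrLists s₂ n (R i j) ∧
        (∀ c < n, nbrList s n c <+: nbrList s₂ n c))
        0 len 65 (Nat.zero_le _) rfl rfl ?_ ?_ ?_ ?_
      · intro j s₂ ha₂ _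
        simp [ha₂.1 vC rfl, ha₁.1 vC rfl, hvk, ha₂.2 aHl rfl, ha₁.2 aHl rfl, eHl, hlen]
      · exact ⟨h3.congr rfl rfl rfl fun a b => Iff.rfl, h4⟩
      · rintro j s₂ - hj ha₂ hvj ⟨h5, h6⟩
        have eR₂ : s₂.a aRow = s.a aRow := by rw [ha₂.2 aRow rfl, ha₁.2 aRow rfl, eR]
        have eC₂ : s₂.v vC = k := by rw [ha₂.1 vC rfl, ha₁.1 vC rfl, hvk]
        have eI₂ : s₂.v vI = i := by rw [ha₂.1 vI rfl, hvi]
        have hfi : f i < n := (hN.lt _ _ ((hmem _).1 ⟨i, hi, rfl⟩)).2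
        have hfj : f j < n := (hN.lt _ _ ((hmem _).1 ⟨j, hj, rfl⟩)).2
        rw [runs_seq, runs_set, runs_seq, runs_set, runs_when]
        simp only [AExp.eval, AExp.cost, St.set_v, St.set_a, reduceCtorEq, if_true, if_false,
          eC₂, eI₂, hvj, eR₂, hrow k hkn, hread s₂ h6 i hi, hread s₂ h6 j hj, sub_add_sub_pos]
        set s₃ := (s₂.set vA (f i)).set vB (f j) with hs₃
        have hstep : ∀ a b, R i (j + 1) a b ↔ R i j a b ∨ (a ≠ b ∧ a = f i ∧ b = f j) := by
          intro a b
          simp only [R, or_assoc]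
          refine or_congr_right (or_congr_right ?_)
          rw [← and_or_left, or_assoc]
          refine and_congr_right fun _ => or_congr_right ?_
          constructor
          · rintro ⟨h7, j', hj', h8⟩
            rcases Nat.lt_succ_iff_lt_or_eq.1 hj' with h | rfl
            · exact Or.inl ⟨h7, j', h, h8⟩
            · exact Or.inr ⟨h7.symm, h8.symm⟩
          · rintro (⟨h7, j', hj', h8⟩ | ⟨h7, h8⟩)
            · exact ⟨h7, j', by omega, h8⟩
            · exact ⟨h7.symm, j, by omega, h8.symm⟩
        have h5' : NbrLists s₃ n (R i j) := h5.congr rfl rfl rfl fun _ _ => Iff.rfl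
        refine ⟨fun hne => ?_, fun hne => ⟨⟨h5.congr rfl rfl rfl fun a b => ?_, h6⟩, by norm_num⟩⟩
        · refine addNbr_runs h5' (by rw [← hrow _ hfi, ← eR₂]; rfl) (by simp [hs₃])
            (by simp [hs₃]) hfi hfj ?_
          intro s₄ T₄ ha₄ h7 h8 hT₄
          refine ⟨⟨h7.congr rfl rfl rfl fun a b => ?_, fun c hc => ?_⟩, by omega⟩
          · rw [hstep]
            refine or_congr_right ⟨fun h => h.2, fun h => ⟨?_, h⟩⟩
            rw [h.1, h.2]; exact hne
          · have h9 : nbrList s₃ n c = nbrList s₂ n c := rfl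
            show nbrList s n c <+: nbrList s₄ n c
            rcases h8 c hc with h | ⟨_, _, h⟩
            · rw [h, h9]; exact h6 c hc
            · rw [h, h9]; exact (h6 c hc).trans (List.prefix_append _ _)
        · rw [hstep]
          refine ⟨?_, Or.inl⟩
          rintro (h | ⟨h7, rfl, rfl⟩)
          · exact h
          · exact absurd h7 hne
      · rintro s₂ T ha₂ hj ⟨h5, h6⟩ hT
        simp only [AExp.cost, Nat.sub_zero] at hT
        have : len * 80 ≤ K * 80 := Nat.mul_le_mul_right _ hlenK
        refine ⟨⟨h5.congr rfl rfl rfl fun a b => ?_, h6⟩, by omega⟩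
        simp only [R]
        refine or_congr_right (and_congr_right fun _ => ?_)
        simp only [Nat.not_lt_zero, false_and, exists_false, and_false, or_false]
        constructor
        · rintro ⟨i', hi', j', hj', h7, h8⟩
          rcases Nat.lt_succ_iff_lt_or_eq.1 hi' with h | rfl
          · exact Or.inl ⟨i', h, j', hj', h7, h8⟩
          · exact Or.inr ⟨h7, j', hj', h8⟩
        · rintro (⟨i', hi', j', hj', h7, h8⟩ | ⟨h7, j', hj', h8⟩)
          · exact ⟨i', by omega, j', hj', h7, h8⟩
          · exact ⟨i, by omega, j', hj', h7, h8⟩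
    · rintro s₁ T ha₁ hi ⟨h3, h4⟩ hT
      simp only [AExp.cost, Nat.sub_zero] at hT
      have : len * (K * 80 + 20 + (1 + 1 + 6)) ≤ K * (K * 80 + 30) :=
        Nat.mul_le_mul hlenK (by omega)
      refine ⟨⟨h3.congr rfl rfl rfl fun a b => ?_, h4⟩, by omega⟩
      simp only [R, ShareBelow, or_assoc]
      refine or_congr_right ?_
      rw [← and_or_left]
      refine and_congr_right fun _ => ?_
      constructor
      · rintro ⟨y, hy, h⟩
        rcases Nat.lt_succ_iff_lt_or_eq.1 hy with h' | rfl
        · exact Or.inl ⟨y, h', h⟩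
        · obtain ⟨i, hi, hi'⟩ := (hmem a).2 h.2.1
          obtain ⟨j, hj, hj'⟩ := (hmem b).2 h.2.2
          exact Or.inr (Or.inl ⟨i, hi, j, hj, hi', hj'⟩)
      · rintro (⟨y, hy, h⟩ | ⟨i, hi, j, hj, hi', hj'⟩ | ⟨_, j, hj, _⟩)
        · exact ⟨y, by omega, h⟩
        · exact ⟨k, by omega, hYk', (hmem a).1 ⟨i, hi, hi'⟩, (hmem b).1 ⟨j, hj, hj'⟩⟩
        · omega
  · rintro s' T ha hj ⟨h1, h2⟩ hT hag
    refine post s' _ hag h1 h2 ?_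
    simp only [AExp.cost, Nat.sub_zero] at hT
    have h3 : K * (K * 80 + 30) + 30 + (1 + 6) ≤ K * (K * 80 + 30) + 40 := by omega
    have := Nat.mul_le_mul_left q h3
    omega

/-! ### Convex bipartite graphs on natural numbers -/

/-- The graph `H` on the nodes below `q` is convex bipartite with ordered part `X`, ordered by the
positions `pos`, and the nodes outside `X` have degree at most `d`. -/
structure ConvexNodes (q d : ℕ) (H : ℕ → ℕ → Prop) (X : ℕ → Prop) (pos : ℕ → ℕ) : Prop where
  lt : ∀ a b, H a b → a < q ∧ b < q
  symm : ∀ a b, H a b → H b a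
  bip : ∀ a b, H a b → (X a ↔ ¬ X b)
  convex : ∀ y a b c, ¬ X y → H y a → H y c → b < q → X b → pos a ≤ pos b → pos b ≤ pos c → H y b
  deg : ∀ y, ¬ X y → ∀ S : Finset ℕ, (∀ a ∈ S, H y a) → S.card ≤ d

/-- The distinct nodes `a` and `b` have a common neighbor in `Y`. -/
def Share (H : ℕ → ℕ → Prop) (Y : ℕ → Prop) (a b : ℕ) : Prop :=
  a ≠ b ∧ ∃ y, Y y ∧ H y a ∧ H y b

theorem Share.symm {H : ℕ → ℕ → Prop} {Y : ℕ → Prop} {a b : ℕ} (h : Share H Y a b) :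
    Share H Y b a := by
  obtain ⟨h1, y, h2, h3, h4⟩ := h
  exact ⟨h1.symm, y, h2, h4, h3⟩

namespace ConvexNodes

variable {q d K : ℕ} {H : ℕ → ℕ → Prop} {X Y : ℕ → Prop} {pos : ℕ → ℕ}

theorem share_iff (h : ConvexNodes q d H X pos) {a b : ℕ} (hab : Share H Y a b) : X a ↔ X b := by
  obtain ⟨-, y, -, h1, h2⟩ := hab
  have := h.bip _ _ h1
  have := h.bip _ _ h2
  tauto

/-- Some node of `S` has all its neighbors in `S`, with respect to `Share`, in the neighborhood of
one node of `Y`. For nodes of `X`, this is the first node in the order. Nodes outside `X` correspond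
to intervals, and an interval with the leftmost right end will do. -/
theorem exists_peak (h : ConvexNodes q d H X pos) (hY : ∀ a b, H a b → (Y a ↔ ¬ Y b)) {S : Set ℕ}
    (hne : S.Nonempty) (hS : ∀ x ∈ S, x < q ∧ ¬ Y x) :
    ∃ x ∈ S, (∀ z ∈ S, ¬ Share H Y x z) ∨
      ∃ y, Y y ∧ H y x ∧ ∀ z ∈ S, Share H Y x z → H y z := by
  have hfin : ∀ T ⊆ S, T.Finite := fun T hT =>
    (Set.finite_Iio q).subset fun x hx => (hS x (hT hx)).1
  by_cases hX : ∃ x ∈ S, X x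
  · obtain ⟨x, ⟨hxS, hxX⟩, hmin⟩ := Set.exists_min_image {x | x ∈ S ∧ X x} pos
      (hfin _ fun x hx => hx.1) hX
    refine ⟨x, hxS, ?_⟩
    by_cases hz : ∃ z ∈ S, Share H Y x z
    · obtain ⟨z, ⟨hzS, hxz⟩, hmax⟩ := Set.exists_max_image {z | z ∈ S ∧ Share H Y x z} pos
        (hfin _ fun x hx => hx.1) hz
      obtain ⟨-, y, hy, h1, h2⟩ := hxz
      refine Or.inr ⟨y, hy, h1, fun z' hz'S hxz' => ?_⟩
      have hX' := (h.share_iff hxz').1 hxX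
      have hyX : ¬ X y := fun hy' => (h.bip _ _ h1).1 hy' hxX
      exact h.convex y x z' z hyX h1 h2 (hS z' hz'S).1 hX' (hmin z' ⟨hz'S, hX'⟩)
        (hmax z' ⟨hz'S, hxz'⟩)
    · push Not at hz
      exact Or.inl hz
  · push Not at hX
    by_cases hiso : ∃ x ∈ S, ∀ y, ¬ H x y
    · obtain ⟨x, hxS, hx⟩ := hiso
      refine ⟨x, hxS, Or.inl ?_⟩
      rintro z - ⟨-, y, -, h1, -⟩
      exact hx y (h.symm _ _ h1)
    · push Not at hiso
      have hright : ∀ x, ∃ r, x ∈ S → H x r ∧ ∀ b, H x b → pos b ≤ pos r := by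
        intro x
        by_cases hxS : x ∈ S
        · obtain ⟨r, hr, hmax⟩ := Set.exists_max_image {b | H x b} pos
            ((Set.finite_Iio q).subset fun b hb => (h.lt _ _ hb).2) (hiso x hxS)
          exact ⟨r, fun _ => ⟨hr, hmax⟩⟩
        · exact ⟨0, fun h => absurd h hxS⟩
      choose r hr using hright
      obtain ⟨x, hxS, hmin⟩ := Set.exists_min_image S (fun x => pos (r x)) (hfin S subset_rfl) hne
      have hxr := (hr x hxS).1
      have hYr : Y (r x) := by
        by_contra hn
        exact (hS x hxS).2 ((hY _ _ hxr).2 hn)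
      have hXr : X (r x) := by
        by_contra hn
        exact hX x hxS ((h.bip _ _ hxr).2 hn)
      refine ⟨x, hxS, Or.inr ⟨r x, hYr, h.symm _ _ hxr, ?_⟩⟩
      rintro z hzS ⟨-, w, hw, h1, h2⟩
      refine h.symm _ _ (h.convex z w (r x) (r z) (hX z hzS) (h.symm _ _ h2) (hr z hzS).1
        (h.lt _ _ hxr).2 hXr ((hr x hxS).2 w (h.symm _ _ h1)) (hmin z hzS))

/-- A node has at most quadratically many neighbors with respect to `Share`. -/
theorem card_share_le (h : ConvexNodes q d H X pos) (hY : ∀ a b, H a b → (Y a ↔ ¬ Y b))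
    (hK : ∀ y, Y y → ∀ S : Finset ℕ, (∀ a ∈ S, H y a) → S.card ≤ d) {x : ℕ} (hx : ¬ Y x)
    {T : Finset ℕ} (hT : ∀ z ∈ T, Share H Y x z) : T.card ≤ 2 * d ^ 2 := by
  classical
  have hd : d ≤ d ^ 2 := Nat.le_self_pow two_ne_zero d
  by_cases hX : X x
  · -- the neighbors before `x` lie in one neighborhood, and so do the neighbors after `x`
    have hlt : ∀ z ∈ T, z < q := by
      intro z hz
      obtain ⟨-, y, -, -, h2⟩ := hT z hz
      exact (h.lt _ _ h2).2
    have h1 : (T.filter fun z => pos z ≤ pos x).card ≤ d := by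
      by_cases hne : (T.filter fun z => pos z ≤ pos x).Nonempty
      · obtain ⟨z, hz, hmin⟩ := Finset.exists_min_image _ pos hne
        obtain ⟨-, y, hy, h1, h2⟩ := hT z (Finset.mem_filter.1 hz).1
        have hyX : ¬ X y := fun hy' => (h.bip _ _ h1).1 hy' hX
        refine h.deg y hyX _ fun a ha => ?_
        obtain ⟨ha1, ha2⟩ := Finset.mem_filter.1 ha
        exact h.convex y z a x hyX h2 h1 (hlt a ha1) ((h.share_iff (hT a ha1)).1 hX) (hmin a ha) ha2
      · rw [Finset.not_nonempty_iff_eq_empty.1 hne]; simp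
    have h2 : (T.filter fun z => ¬ pos z ≤ pos x).card ≤ d := by
      by_cases hne : (T.filter fun z => ¬ pos z ≤ pos x).Nonempty
      · obtain ⟨z, hz, hmax⟩ := Finset.exists_max_image _ pos hne
        obtain ⟨-, y, hy, h1, h2⟩ := hT z (Finset.mem_filter.1 hz).1
        have hyX : ¬ X y := fun hy' => (h.bip _ _ h1).1 hy' hX
        refine h.deg y hyX _ fun a ha => ?_
        obtain ⟨ha1, ha2⟩ := Finset.mem_filter.1 ha
        exact h.convex y x a z hyX h1 h2 (hlt a ha1) ((h.share_iff (hT a ha1)).1 hX) (by omega)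
          (hmax a ha)
      · rw [Finset.not_nonempty_iff_eq_empty.1 hne]; simp
    have := Finset.card_filter_add_card_filter_not (s := T) (fun z => pos z ≤ pos x)
    omega
  · have hsub : T ⊆ ((Finset.range q).filter fun y => H x y).biUnion fun y =>
        (Finset.range q).filter fun z => H y z := by
      intro z hz
      obtain ⟨-, y, hy, h1, h2⟩ := hT z hz
      simp only [Finset.mem_biUnion, Finset.mem_filter, Finset.mem_range]
      exact ⟨y, ⟨(h.lt _ _ h1).1, h.symm _ _ h1⟩, (h.lt _ _ h2).2, h2⟩
    have h1 : ((Finset.range q).filter fun y => H x y).card ≤ d :=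
      h.deg x hX _ fun a ha => (Finset.mem_filter.1 ha).2
    have h2 := (Finset.card_le_card hsub).trans (Finset.card_biUnion_le_card_mul _ _ d
      fun y hy => hK y (by
        by_contra hn
        exact hx ((hY _ _ (Finset.mem_filter.1 hy).2).2 hn)) _
        fun a ha => (Finset.mem_filter.1 ha).2)
    have h3 := Nat.mul_le_mul_right d h1
    rw [← pow_two] at h3
    omega

end ConvexNodes

/-- The graph `H`, together with all pairs of neighbors of constraint nodes, is suited for the
elimination. -/
theorem ConvexNodes.fillGraph {s₀ s : St} {n q d K : ℕ} {H : ℕ → ℕ → Prop} {X : ℕ → Prop}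
    {pos : ℕ → ℕ} (h : ConvexNodes q d H X pos) (hqn : q ≤ n)
    (hY : ∀ a b, H a b → (s.a aY a ≠ 0 ↔ ¬ s.a aY b ≠ 0)) (hN₀ : NbrLists s₀ n H)
    (hK : ∀ y < q, s.a aY y ≠ 0 → s₀.a aFl y ≤ K) (hKd : K ≤ d) (hYq : ∀ y, s.a aY y ≠ 0 → y < q)
    (hN : NbrLists s n fun a b => H a b ∨ Share H (fun y => s.a aY y ≠ 0) a b)
    (hpre : ∀ c < n, nbrList s₀ n c <+: nbrList s n c) (hhl : ∀ c < q, s.a aHl c = s₀.a aFl c) :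
    FillGraph s n q K (2 * d ^ 2) fun a b => H a b ∨ Share H (fun y => s.a aY y ≠ 0) a b := by
  classical
  set Y : ℕ → Prop := fun y => s.a aY y ≠ 0 with hYdef
  have hKS : ∀ y, Y y → ∀ S : Finset ℕ, (∀ a ∈ S, H y a) → S.card ≤ K := by
    intro y hy S hS
    have hyq := hYq y hy
    refine le_trans ?_ (hK y hyq hy)
    have h1 : S ⊆ (nbrList s₀ n y).toFinset := fun a ha =>
      List.mem_toFinset.2 ((hN₀.mem y (hyq.trans_le hqn) a).2 (hS a ha))
    have h2 := (Finset.card_le_card h1).trans (List.toFinset_card_le _)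
    rwa [nbrList, arrList_length] at h2
  have hKdS : ∀ y, Y y → ∀ S : Finset ℕ, (∀ a ∈ S, H y a) → S.card ≤ d :=
    fun y hy S hS => (hKS y hy S hS).trans hKd
  -- the added pairs consist of nodes that are not constraint nodes
  have hshare : ∀ a b, Share H Y a b → ¬ Y a ∧ ¬ Y b := by
    rintro a b ⟨-, y, hy, h1, h2⟩
    exact ⟨(hY _ _ h1).1 hy, (hY _ _ h2).1 hy⟩
  have hYH : ∀ y z, Y y → (H y z ∨ Share H Y y z) → H y z := fun y z hy h1 =>
    h1.resolve_right fun h2 => (hshare _ _ h2).1 hy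
  have hXshare : ∀ x z, ¬ Y x → ¬ Y z → (H x z ∨ Share H Y x z) → Share H Y x z := by
    intro x z hx hz h1
    refine h1.resolve_left fun h2 => hx ((hY _ _ h2).2 hz)
  have hle : ∀ c < n, s₀.a aFl c ≤ s.a aFl c := by
    intro c hc
    have := (hpre c hc).length_le
    simpa [nbrList] using this
  have hread : ∀ c < n, ∀ i < s₀.a aFl c, row (s.a aFn) n c i = row (s₀.a aFn) n c i := by
    intro c hc i hi
    have h3 : i < (nbrList s₀ n c).length := by simpa [nbrList] using hi
    have h4 := (hpre c hc).getElem h3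
    simp only [nbrList, arrList, List.getElem_map, List.getElem_range] at h4
    exact h4.symm
  have hmem : ∀ x < q, ¬ Y x → ∀ z, (∃ i, s.a aHl x ≤ i ∧ i < s.a aFl x ∧
      row (s.a aFn) n x i = z) ↔ Share H Y x z := by
    intro x hx hxY z
    have hxn := hx.trans_le hqn
    have hinj : ∀ i j, i < s.a aFl x → j < s.a aFl x → row (s.a aFn) n x i = row (s.a aFn) n x j →
        i = j := by
      intro i j hi hj hij
      have hi' : i < (nbrList s n x).length := by simpa [nbrList] using hi
      have hj' : j < (nbrList s n x).length := by simpa [nbrList] using hj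
      refine (List.Nodup.getElem_inj_iff (hN.nodup x hxn) (hi := hi') (hj := hj')).1 ?_
      simpa [nbrList, arrList] using hij
    have hH : H x z ↔ ∃ i < s₀.a aFl x, row (s.a aFn) n x i = z := by
      rw [← hN₀.mem x hxn z, nbrList, mem_arrList]
      refine exists_congr fun i => and_congr_right fun hi => ?_
      rw [hread x hxn i hi]
    rw [hhl x hx]
    constructor
    · rintro ⟨i, hi, hi', hiz⟩
      have h1 := (hN.mem x hxn z).1 (mem_arrList.2 ⟨i, hi', hiz⟩)
      refine h1.resolve_left fun h2 => ?_
      obtain ⟨j, hj, hjz⟩ := hH.1 h2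
      have := hinj i j hi' (hj.trans_le (hle x hxn)) (hiz.trans hjz.symm)
      omega
    · intro hs
      obtain ⟨i, hi, hiz⟩ := mem_arrList.1 ((hN.mem x hxn z).2 (Or.inr hs))
      refine ⟨i, ?_, hi, hiz⟩
      by_contra hlt
      have h1 := hH.2 ⟨i, by omega, hiz⟩
      exact (hshare _ _ hs).1 ((hY _ _ h1).2 (hshare _ _ hs).2)
  have hY0 : ∀ x, s.a aY x = 0 ↔ ¬ Y x := fun x => by simp [hYdef]
  refine ⟨?_, ?_, ?_, ?_, ?_, ?_, ?_, ?_, ?_⟩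
  · exact fun a ha b hb => hN.fadj a (ha.trans_le hqn) b (hb.trans_le hqn)
  · intro y z hy hyz
    exact (hY0 z).2 ((hY _ _ (hYH y z hy hyz)).1 hy)
  · intro y z z' hy hyz hyz' hne
    exact Or.inr ⟨hne, y, hy, hYH y z hy hyz, hYH y z' hy hyz'⟩
  · intro y hy hyY
    have h1 := hKS y hyY (nbrList s n y).toFinset fun a ha =>
      hYH y a hyY ((hN.mem y (hy.trans_le hqn) a).1 (List.mem_toFinset.1 ha))
    rwa [List.toFinset_card_of_nodup (hN.nodup y (hy.trans_le hqn)), nbrList, arrList_length] at h1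
  · intro x hx
    rw [hhl x hx]; exact hle x (hx.trans_le hqn)
  · intro x hx hxY
    have hxn := hx.trans_le hqn
    rw [hY0] at hxY
    set L := (nbrList s n x).drop (s.a aHl x) with hL
    have hLmem : ∀ z ∈ L, Share H Y x z := by
      intro z hz
      rw [← hmem x hx hxY]
      obtain ⟨i, hi, hiz⟩ := List.mem_iff_getElem.1 hz
      simp only [hL, nbrList, arrList, List.getElem_drop, List.getElem_map,
        List.getElem_range] at hiz
      simp only [hL, nbrList, List.length_drop, arrList_length] at hi
      exact ⟨s.a aHl x + i, by omega, by omega, hiz⟩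
    have hLn : L.Nodup := (hN.nodup x hxn).sublist (List.drop_sublist _ _)
    have h1 := h.card_share_le hY hKdS hxY (T := L.toFinset) fun z hz =>
      hLmem z (List.mem_toFinset.1 hz)
    rw [List.toFinset_card_of_nodup hLn, hL, List.length_drop, nbrList, arrList_length] at h1
    omega
  · intro x hx hxY z
    rw [hY0] at hxY
    rw [hmem x hx hxY, hY0]
    constructor
    · exact fun h1 => ⟨Or.inr h1, (hshare _ _ h1).2⟩
    · exact fun h1 => hXshare x z hxY h1.2 h1.1
  · intro S hne hS
    have hS' : ∀ x ∈ S, x < q ∧ ¬ Y x := fun x hx => ⟨(hS x hx).1, (hY0 x).1 (hS x hx).2⟩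
    obtain ⟨x, hxS, hx⟩ := h.exists_peak hY hne hS'
    refine ⟨x, hxS, fun z hz z' hz' hxz hxz' hne => ?_⟩
    have h1 := hXshare x z (hS' x hxS).2 (hS' z hz).2 hxz
    have h2 := hXshare x z' (hS' x hxS).2 (hS' z' hz').2 hxz'
    rcases hx with hx | ⟨y, hy, -, hx⟩
    · exact absurd h1 (hx z hz)
    · exact Or.inr ⟨hne, y, hy, hx z hz h1, hx z' hz' h2⟩
  · -- a clique lies in the neighborhood of one constraint node
    intro C hC hclique hcard
    obtain ⟨c, hc, c', hc', hcc'⟩ := Finset.one_lt_card.1 hcard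
    have hnb : ∀ z ∈ C, ∀ z' ∈ C, z ≠ z' → Share H Y z z' := fun z hz z' hz' hne =>
      hXshare z z' ((hY0 z).1 (hC z hz)) ((hY0 z').1 (hC z' hz')) (hclique z hz z' hz' hne)
    have hlt : ∀ z ∈ C, z < q := by
      intro z hz
      obtain ⟨w, hw, hwz⟩ : ∃ w ∈ C, z ≠ w := by
        by_cases hzc : z = c
        · exact ⟨c', hc', hzc ▸ hcc'⟩
        · exact ⟨c, hc, hzc⟩
      obtain ⟨-, y, -, h1, -⟩ := hnb z hz w hw hwz
      exact (h.lt _ _ h1).2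
    obtain ⟨x, hxC, hx⟩ := h.exists_peak hY (S := C) ⟨c, hc⟩ fun x hx =>
      ⟨hlt x hx, (hY0 x).1 (hC x hx)⟩
    rcases hx with hx | ⟨y, hy, hyx, hx⟩
    · obtain ⟨w, hw, hwx⟩ : ∃ w ∈ C, x ≠ w := by
        by_cases hzc : x = c
        · exact ⟨c', hc', hzc ▸ hcc'⟩
        · exact ⟨c, hc, hzc⟩
      exact absurd (hnb x hxC w hw hwx) (hx w hw)
    · refine hKS y hy C fun z hz => ?_
      by_cases hxz : x = z
      · rwa [← hxz]
      · exact hx z hz (hnb x hxC z hz hxz)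

/-! ### Running time -/

/-- Each edge has one end outside `X`, where the degrees are at most `d`. -/
theorem ConvexNodes.sum_degree_le {q d : ℕ} {H : ℕ → ℕ → Prop} {X : ℕ → Prop} {pos : ℕ → ℕ}
    (h : ConvexNodes q d H X pos) {s : St} {n : ℕ} (hN : NbrLists s n H) (hqn : q ≤ n) :
    ∑ c ∈ Finset.range q, s.a aFl c ≤ 2 * (q * d) := by
  classical
  have hfl : ∀ c ∈ Finset.range q, s.a aFl c = ((Finset.range q).filter fun b => H c b).card := by
    intro c hc
    have hcn := (Finset.mem_range.1 hc).trans_le hqn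
    have h1 : (nbrList s n c).toFinset = (Finset.range q).filter fun b => H c b := by
      ext b
      rw [List.mem_toFinset, hN.mem c hcn b, Finset.mem_filter, Finset.mem_range]
      exact ⟨fun h1 => ⟨(h.lt _ _ h1).2, h1⟩, fun h1 => h1.2⟩
    rw [← h1, List.toFinset_card_of_nodup (hN.nodup c hcn), nbrList, arrList_length]
  rw [Finset.sum_congr rfl hfl]
  have hle : ∀ c, ((Finset.range q).filter fun b => H c b).card ≤
      ((Finset.range q).filter fun b => H c b ∧ ¬ X c).card +
      ((Finset.range q).filter fun b => H c b ∧ ¬ X b).card := by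
    intro c
    refine (Finset.card_le_card ?_).trans (Finset.card_union_le _ _)
    intro b hb
    simp only [Finset.mem_filter, Finset.mem_union] at hb ⊢
    have := h.bip _ _ hb.2
    tauto
  have hdeg : ∀ c, ((Finset.range q).filter fun b => H c b ∧ ¬ X c).card ≤ d := by
    intro c
    by_cases hc : X c
    · simp [hc]
    · exact h.deg c hc _ fun a ha => (Finset.mem_filter.1 ha).2.1
  have hswap : ∑ c ∈ Finset.range q, ((Finset.range q).filter fun b => H c b ∧ ¬ X b).card =
      ∑ b ∈ Finset.range q, ((Finset.range q).filter fun c => H b c ∧ ¬ X b).card := by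
    simp only [Finset.card_filter]
    rw [Finset.sum_comm]
    refine Finset.sum_congr rfl fun b _ => Finset.sum_congr rfl fun c _ => ?_
    have : H c b ↔ H b c := ⟨h.symm _ _, h.symm _ _⟩
    simp only [this]
  have hsum : ∑ c ∈ Finset.range q, ((Finset.range q).filter fun b => H c b ∧ ¬ X c).card ≤
      q * d := by
    refine (Finset.sum_le_card_nsmul _ _ d fun c _ => hdeg c).trans ?_
    simp
  have h1 := Finset.sum_le_sum fun c (_ : c ∈ Finset.range q) => hle c
  rw [Finset.sum_add_distrib, hswap] at h1
  omega

/-- Each edge has an end whose neighbors, with respect to this edge, lie in at most `d + 1`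
classes. -/
theorem card_edges_le {s : St} {n q m d : ℕ} {X : ℕ → Prop} {pos : ℕ → ℕ} (hc : Classes s n q)
    (heu : ∀ e < m, s.a aEu e < n) (hev : ∀ e < m, s.a aEv e < n)
    (hinj : ∀ e < m, ∀ e' < m, (s.a aEu e = s.a aEu e' ∧ s.a aEv e = s.a aEv e') ∨
      (s.a aEu e = s.a aEv e' ∧ s.a aEv e = s.a aEu e') → e = e')
    (h : ConvexNodes q d (ClusterEdge s m) X pos) : m ≤ n * ((d + 1) * s.v vEll) := by
  classical
  set cid := s.a aCid with hcid
  let first : ℕ → Prop := fun e => ¬ X (cid (s.a aEu e)) ∨ cid (s.a aEu e) = cid (s.a aEv e)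
  let f : ℕ → ℕ × ℕ := fun e =>
    if first e then (s.a aEu e, s.a aEv e) else (s.a aEv e, s.a aEu e)
  let N : ℕ → Finset ℕ := fun u => insert (cid u) ((Finset.range q).filter fun b =>
    ClusterEdge s m (cid u) b ∧ ¬ X (cid u))
  let T : Finset (ℕ × ℕ) := (Finset.range n).biUnion fun u => (N u).biUnion fun c =>
    ((Finset.range n).filter fun w => s.a aCid w = c).image fun w => (u, w)
  have hT : T.card ≤ n * ((d + 1) * s.v vEll) := by
    have h1 : T.card ≤ (Finset.range n).card * ((d + 1) * s.v vEll) := by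
      refine Finset.card_biUnion_le_card_mul _ _ _ fun u _ => ?_
      have h2 : (N u).card ≤ d + 1 := by
        refine (Finset.card_insert_le _ _).trans (Nat.succ_le_succ ?_)
        by_cases hX : X (cid u)
        · simp [hX]
        · exact h.deg _ hX _ fun a ha => (Finset.mem_filter.1 ha).2.1
      refine (Finset.card_biUnion_le_card_mul _ _ (s.v vEll) fun c _ => ?_).trans
        (Nat.mul_le_mul_right _ h2)
      exact Finset.card_image_le.trans (by rw [← hc.sz]; exact hc.sz_le c)
    simpa using h1
  have hmaps : ∀ e ∈ Finset.range m, f e ∈ T := by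
    intro e he
    rw [Finset.mem_range] at he
    have hu := heu e he
    have hv := hev e he
    simp only [T, Finset.mem_biUnion, Finset.mem_image, Finset.mem_filter, Finset.mem_range]
    by_cases hf : first e
    · refine ⟨s.a aEu e, hu, cid (s.a aEv e), ?_, s.a aEv e, ⟨hv, rfl⟩, by simp [f, hf]⟩
      simp only [N, Finset.mem_insert, Finset.mem_filter, Finset.mem_range]
      by_cases heq : cid (s.a aEu e) = cid (s.a aEv e)
      · exact Or.inl heq.symm
      · exact Or.inr ⟨hc.cid_lt _ hv, ⟨heq, _, _, ⟨e, he, Or.inl ⟨rfl, rfl⟩⟩, rfl, rfl⟩,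
          hf.resolve_right heq⟩
    · refine ⟨s.a aEv e, hv, cid (s.a aEu e), ?_, s.a aEu e, ⟨hu, rfl⟩, by simp [f, hf]⟩
      simp only [N, Finset.mem_insert, Finset.mem_filter, Finset.mem_range]
      simp only [first, not_or, not_not] at hf
      have hedge : ClusterEdge s m (cid (s.a aEv e)) (cid (s.a aEu e)) :=
        ⟨fun h1 => hf.2 h1.symm, _, _, ⟨e, he, Or.inr ⟨rfl, rfl⟩⟩, rfl, rfl⟩
      exact Or.inr ⟨hc.cid_lt _ hu, hedge, fun h1 => (h.bip _ _ hedge).1 h1 hf.1⟩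
  have hfinj : ∀ e ∈ Finset.range m, ∀ e' ∈ Finset.range m, f e = f e' → e = e' := by
    intro e he e' he' hff
    refine hinj e (Finset.mem_range.1 he) e' (Finset.mem_range.1 he') ?_
    by_cases h1 : first e <;> by_cases h2 : first e' <;>
      simp only [f, h1, h2, if_true, if_false, Prod.mk.injEq] at hff
    · exact Or.inl hff
    · exact Or.inr hff
    · exact Or.inr hff.symm
    · exact Or.inl hff.symm
  have := Finset.card_le_card_of_injOn f hmaps fun e he e' he' h1 =>
    hfinj e he e' he' h1
  rw [Finset.card_range] at this
  exact this.trans hT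

/-- Polynomials of degree five are negligible compared with the table size. -/
theorem pow_five_le (D : ℕ) : D ^ 5 ≤ 400 * 2 ^ D := by
  rcases Nat.lt_or_ge D 8 with h | h
  · interval_cases D <;> norm_num
  · obtain ⟨k, rfl⟩ := Nat.exists_eq_add_of_le' h
    clear h
    induction k with
    | zero => norm_num
    | succ k ih =>
      have : (k + 1 + 8) ^ 5 ≤ 2 * (k + 8) ^ 5 := by
        have : 2 * (k + 8) ^ 5 = (k + 1 + 8) ^ 5 + (k ^ 5 + 35 * k ^ 4 + 470 * k ^ 3 +
          2950 * k ^ 2 + 8155 * k + 6487) := by ring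
        omega
      have h2 : 2 ^ (k + 1 + 8) = 2 * 2 ^ (k + 8) := by ring
      rw [h2]
      omega

/-- Bound for the time of the algorithm after the computation of the classes. -/
theorem mainPhase_time {n q d K ell m S : ℕ} (hqn : q ≤ n) (hn : 0 < n) (hKd : K ≤ d)
    (hKn : K ≤ n) (hell : 2 ≤ ell) (hm : m ≤ n * ((d + 1) * ell)) (hS : S ≤ 2 * (q * d))
    {P : ℕ} (hP : P = popCost (2 * d ^ 2)) :
    m * 200 + S * 60 + q * (K * (K * 80 + 30)) + K * (ell * 15 + 30) + ell ^ K * 40 +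
      (S + q * (2 * d ^ 2)) * 100 + ell ^ max K 1 * (80 * max K 1 + 120) * (3 * n) +
      (P + 30) * (max K 1 + 1) * q + ell ^ max K 1 * (20 * K + 50) * q + q * 1000 + 1000 ≤
    2000000 * (n * (max d 1 * ell ^ max d 1)) := by
  set D := max d 1 with hD
  set E := ell ^ D with hE
  have hD1 : 1 ≤ D := le_max_right _ _
  have hdD : d ≤ D := le_max_left _ _
  have hKD : K ≤ D := hKd.trans hdD
  have hK1D : max K 1 ≤ D := max_le hKD hD1
  have hl1 : 1 ≤ ell := by omega
  have hE1 : ell ^ max K 1 ≤ E := Nat.pow_le_pow_right hl1 hK1D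
  have hE2 : ell ^ K ≤ E := Nat.pow_le_pow_right hl1 hKD
  have hE3 : ell ≤ E := Nat.le_self_pow (by omega) _
  have hpos : 1 ≤ E := Nat.one_le_pow _ _ hl1
  have hD5 : D ^ 5 ≤ 400 * E :=
    (pow_five_le D).trans (Nat.mul_le_mul_left _ (Nat.pow_le_pow_left hell D))
  have hD2 : D ^ 2 ≤ D ^ 5 := Nat.pow_le_pow_right hD1 (by norm_num)
  set W := D * E with hW
  have hEW : E ≤ W := Nat.le_mul_of_pos_left _ hD1
  have hDW : D ≤ W := Nat.le_mul_of_pos_right _ hpos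
  set B := n * W with hB
  have hnB : ∀ x y c, x ≤ n → y ≤ c * W → x * y ≤ c * B := by
    intro x y c hx hy
    calc x * y ≤ n * (c * W) := Nat.mul_le_mul hx hy
      _ = c * B := by rw [hB]; ring
  have hWB : W ≤ B := Nat.le_mul_of_pos_left _ hn
  have hd2 : d ^ 2 ≤ D ^ 2 := Nat.pow_le_pow_left hdD 2
  have hP' : P + 30 ≤ 1000 * D ^ 4 := by
    have h1 : 2 * d ^ 2 + 1 ≤ 3 * D ^ 2 := by
      have : 1 ≤ D ^ 2 := Nat.one_le_pow _ _ hD1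
      omega
    have h2 : (2 * d ^ 2 + 1) ^ 2 ≤ 9 * D ^ 4 := by
      calc (2 * d ^ 2 + 1) ^ 2 ≤ (3 * D ^ 2) ^ 2 := Nat.pow_le_pow_left h1 2
        _ = 9 * D ^ 4 := by ring
    have h3 : 1 ≤ D ^ 4 := Nat.one_le_pow _ _ hD1
    rw [hP, popCost]
    omega
  have t1 : m ≤ 2 * B := by
    refine hm.trans (hnB n _ 2 le_rfl ?_)
    calc (d + 1) * ell ≤ (2 * D) * E := Nat.mul_le_mul (by omega) hE3
      _ = 2 * W := by rw [hW]; ring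
  have t2 : q * d ≤ 1 * B := hnB q d 1 hqn (by omega)
  have t3 : q * (K * (K * 80 + 30)) ≤ 44000 * B := by
    refine hnB q _ 44000 hqn ?_
    have h1 : K * (K * 80 + 30) ≤ D * (D * 80 + D * 30) :=
      Nat.mul_le_mul hKD (by omega)
    have h2 : D * (D * 80 + D * 30) = 110 * D ^ 2 := by ring
    omega
  have t4 : K * (ell * 15 + 30) ≤ 45 * B := by
    refine hnB K _ 45 hKn ?_
    omega
  have t5 : q * (2 * d ^ 2) ≤ 800 * B := hnB q _ 800 hqn (by omega)
  have t6 : ell ^ max K 1 * (80 * max K 1 + 120) ≤ 200 * W := by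
    calc ell ^ max K 1 * (80 * max K 1 + 120) ≤ E * (200 * D) := Nat.mul_le_mul hE1 (by omega)
      _ = 200 * W := by rw [hW]; ring
  have t7 : ell ^ max K 1 * (80 * max K 1 + 120) * (3 * n) ≤ 600 * B := by
    calc _ ≤ 200 * W * (3 * n) := Nat.mul_le_mul_right _ t6
      _ = 600 * B := by rw [hB]; ring
  have t8 : (P + 30) * (max K 1 + 1) * q ≤ 800000 * B := by
    rw [mul_comm]
    refine hnB q _ 800000 hqn ?_
    calc (P + 30) * (max K 1 + 1) ≤ (1000 * D ^ 4) * (2 * D) := Nat.mul_le_mul hP' (by omega)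
      _ = 2000 * D ^ 5 := by ring
      _ ≤ 800000 * W := by omega
  have t9 : ell ^ max K 1 * (20 * K + 50) * q ≤ 70 * B := by
    rw [mul_comm]
    refine hnB q _ 70 hqn ?_
    calc ell ^ max K 1 * (20 * K + 50) ≤ E * (70 * D) := Nat.mul_le_mul hE1 (by omega)
      _ = 70 * W := by rw [hW]; ring
  have t10 : q ≤ B := hqn.trans (Nat.le_mul_of_pos_right _ (by omega))
  have t11 : 1 ≤ B := by omega
  show _ ≤ 2000000 * B
  omega

/-! ### Correctness of the main phase -/

theorem ElimInv.congr {s s' : St} {n q ell K : ℕ} {F : ℕ → ℕ → Prop} (h : ElimInv s n q ell K F)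
    {c : Cmd} (ha : Agree c s s') (hv : c.wv vAns = false) (hc : (c.wa aDead || c.wa aCl ||
      c.wa aUpl || c.wa aUp || c.wa aSz || c.wa aY || c.wa aGadj || c.wa aMem || c.wa aTab) =
      false) :
    ElimInv s' n q ell K F := by
  simp only [Bool.or_eq_false_iff, and_assoc] at hc
  obtain ⟨h1, h2, h3, h4, h5, h6, h7, h8, h9⟩ := hc
  have e0 := ha.1 _ hv
  have e1 := ha.2 _ h1
  have e2 := ha.2 _ h2
  have e3 := ha.2 _ h3
  have e4 := ha.2 _ h4
  have e5 := ha.2 _ h5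
  have e6 := ha.2 _ h6
  have e7 := ha.2 _ h7
  have e8 := ha.2 _ h8
  have e9 := ha.2 _ h9
  obtain ⟨a1, a2, a3, a4, a5, a6, a7⟩ := h
  constructor <;> simp only [e0, e1, e2, e3, e4, e5, e6, e7, e8, e9, upList, Compat] <;> assumption

/-- When all nodes are eliminated, `vAns` tells whether vertices can be selected that satisfy all
constraints. -/
theorem ElimInv.ans_iff {s : St} {n q ell K : ℕ} {F : ℕ → ℕ → Prop} (h : ElimInv s n q ell K F)
    (he : Env s n q ell K F) (hdead : ∀ c < q, s.a aDead c ≠ 0) (hsz : ∀ c < q, 0 < s.a aSz c) :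
    s.v vAns = 1 ↔ ∃ a : ℕ → ℕ, (∀ c < q, a c < s.a aSz c) ∧
      ∀ c z, s.a aY c ≠ 0 → F c z → Compat s n c (a c) z (a z) := by
  have hup : ∀ w < q, s.a aCl w = 0 → s.a aUpl w = 0 := by
    intro w hw hcl
    have h1 := h.mem_up w hw (hdead w hw) hcl
    by_contra h2
    have h3 := (h1 (row (s.a aUp) n w 0)).1 (mem_arrList.2 ⟨0, by omega, rfl⟩)
    exact hdead _ (he.lt _ _ h3.2).2 h3.1
  have h1 : s.v vAns = 1 ↔ s.v vAns ≠ 0 := by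
    have := h.ans_le
    omega
  have h2 := h.sem (fun _ => 0) hsz
  rw [h1, h.ans]
  have h3 : (∀ w < q, s.a aDead w ≠ 0 → s.a aCl w = 0 → s.a aUpl w = 0 →
      s.a aTab (w * ell ^ K) ≠ 0) ↔ ∀ w, (w < q ∧ s.a aDead w ≠ 0 ∧ s.a aCl w = 0) →
      s.a aTab (w * ell ^ K + encode ell (fun _ => 0) (upList s n w)) ≠ 0 := by
    have hcode : ∀ w < q, s.a aCl w = 0 → encode ell (fun _ => 0) (upList s n w) = 0 := by
      intro w hw hcl
      rw [upList, hup w hw hcl, arrList_zero]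
      rfl
    constructor
    · rintro h4 w ⟨hw, hd, hcl⟩
      rw [hcode w hw hcl]
      exact h4 w hw hd hcl (hup w hw hcl)
    · intro h4 w hw hd hcl _
      have := h4 w ⟨hw, hd, hcl⟩
      rwa [hcode w hw hcl] at this
  rw [h3, ← h2]
  constructor
  · rintro ⟨a, ha, -, h4⟩
    exact ⟨a, ha, fun c z hc hF => h4 c hc (hdead c (he.lt _ _ hF).1) z hF⟩
  · rintro ⟨a, ha, h4⟩
    -- the values outside the range of the classes are irrelevant
    refine ⟨fun c => if c < q then a c else 0, fun c hc => by simpa [hc] using ha c hc,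
      fun c hc => ?_, fun c hc _ z hF => ?_⟩
    · have : ¬ c < q := fun h5 => hc (hdead c h5)
      simp [this]
    · have h5 := he.lt _ _ hF
      simpa [h5.1, h5.2] using h4 c z hc hF

/-- The answer after the main phase, in terms of a choice of a vertex `a c` for each class `c`. -/
theorem mainPhase_runs {s : St} {Q : St → ℕ → Prop} {n q m d ell : ℕ} {X : ℕ → Prop} {pos : ℕ → ℕ}
    (hc : Classes s n q) (hn : 0 < n) (hell : s.v vEll = ell) (hell2 : 2 ≤ ell) (hm : s.v vM = m)
    (heu : ∀ e < m, s.a aEu e < n) (hev : ∀ e < m, s.a aEv e < n)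
    (hinj : ∀ e < m, ∀ e' < m, (s.a aEu e = s.a aEu e' ∧ s.a aEv e = s.a aEv e') ∨
      (s.a aEu e = s.a aEv e' ∧ s.a aEv e = s.a aEu e') → e = e')
    (hcv : ConvexNodes q d (ClusterEdge s m) X pos) (hP : s.v vP = 0)
    (hz : ∀ b ∈ [aGadj, aFadj, aFl, aSd, aDm, aY, aDead, aCl, aUpl], ∀ i, s.a b i = 0)
    (post : ∀ s' T, (s'.v vN = 1 ↔ ∃ a : ℕ → ℕ, (∀ c < q, a c < n ∧ s.a aCid (a c) = c) ∧
        ∀ c z, ClusterEdge s m c z → HasEdge s m (a c) (a z)) →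
      T ≤ 2000000 * (n * (max d 1 * ell ^ max d 1)) → Q s' T) :
    Runs mainPhase s Q := by
  have hqn := hc.le
  set H := ClusterEdge s m with hHdef
  have hHirr : ∀ a, ¬ H a a := fun a h => h.1 rfl
  unfold mainPhase
  rw [runs_seq]
  refine edgePhase_runs hc hm heu hev (hz aGadj (by simp)) (hz aFadj (by simp))
    (hz aFl (by simp)) ?_
  intro s₁ T₁ a₁ hN₁ hG₁ hT₁
  have hrow₁ : ∀ c < n, s₁.a aRow c = c * n := by
    rw [a₁.2 aRow rfl]; exact hc.rowA
  rw [runs_seq]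
  refine sidePhase_runs hqn (by rw [a₁.1 vQ rfl, hc.vQ]) hrow₁ hN₁ hcv.lt hcv.symm hcv.bip
    (by rw [a₁.2 aSd rfl]; exact hz aSd (by simp)) ?_
  intro s₂ T₂ J p a₂ hS₂ hvis₂ hT₂
  rw [runs_seq]
  refine degreePhase_runs (q := q) (by rw [a₂.1 vQ rfl, a₁.1 vQ rfl, hc.vQ])
    (by rw [a₂.2 aDm rfl, a₁.2 aDm rfl]; exact hz aDm (by simp)) ?_
  intro s₃ T₃ a₃ hhl₃ hdm₃ hdm₃' hT₃
  rw [runs_seq]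
  refine choosePhase_runs (q := q) (by rw [a₃.1 vQ rfl, a₂.1 vQ rfl, a₁.1 vQ rfl, hc.vQ])
    (by rw [a₃.1 vP rfl, a₂.1 vP rfl, a₁.1 vP rfl, hP])
    (by rw [a₃.2 aY rfl, a₂.2 aY rfl, a₁.2 aY rfl]; exact hz aY (by simp)) ?_
  intro s₄ T₄ a₄ hY₄ hP₄ hP₄' hT₄
  set K := s₄.v vP with hKdef
  have eFl₄ : s₄.a aFl = s₁.a aFl := by rw [a₄.2 aFl rfl, a₃.2 aFl rfl, a₂.2 aFl rfl]
  have eFl₃ : s₃.a aFl = s₁.a aFl := by rw [a₃.2 aFl rfl, a₂.2 aFl rfl]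
  have eFl₂ : s₂.a aFl = s₁.a aFl := a₂.2 aFl rfl
  rw [eFl₃] at hP₄ hP₄'
  rw [eFl₂] at hhl₃ hdm₃ hdm₃'
  have hN₄ : NbrLists s₄ n H := hN₁.congr
    (by rw [a₄.2 aFadj rfl, a₃.2 aFadj rfl, a₂.2 aFadj rfl])
    (by rw [a₄.2 aFn rfl, a₃.2 aFn rfl, a₂.2 aFn rfl]) eFl₄ fun _ _ => Iff.rfl
  -- exactly one end of each edge of the cluster graph is a constraint node
  have hY : ∀ a b, H a b → (s₄.a aY a ≠ 0 ↔ ¬ s₄.a aY b ≠ 0) := by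
    intro a b hab
    obtain ⟨ha, hb⟩ := hcv.lt _ _ hab
    have h1 := hS₂.edge a b hab (hvis₂ a ha) (hvis₂ b hb)
    have h2 := hS₂.edge b a (hcv.symm _ _ hab) (hvis₂ b hb) (hvis₂ a ha)
    have h3 : s₂.a aSd a ≠ s₂.a aSd b := by
      obtain ⟨-, j, -, h4⟩ := hS₂.good a (hvis₂ a ha)
      omega
    rw [hY₄, hY₄]
    simp only [OnConstraintSide, a₃.2 aSd rfl, a₃.2 aSp rfl, ← h1, ← h2, ha, hb, true_and]
    omega
  have hdeg : ∀ c < q, ¬ X c → s₁.a aFl c ≤ d := by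
    intro c hcq hX
    have hcn := hcq.trans_le hqn
    have h1 := hcv.deg c hX (nbrList s₁ n c).toFinset fun a ha =>
      (hN₁.mem c hcn a).1 (List.mem_toFinset.1 ha)
    rwa [List.toFinset_card_of_nodup (hN₁.nodup c hcn), nbrList, arrList_length] at h1
  -- the maximum degree of the constraint nodes is at most the spread, since one of the two sides of
  -- a component lies outside the ordered part
  have hKd : K ≤ d := by
    by_cases hK0 : K = 0
    · omega
    obtain ⟨c, hcY, hcK⟩ := hP₄' hK0
    obtain ⟨hcq, hside⟩ := (hY₄ c).1 hcY
    by_cases hX : X c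
    · have h1 : s₃.a aDm (s₂.a aSd c) ≤ s₃.a aDm (s₂.a aSp c) := by
        simp only [OnConstraintSide, a₃.2 aSd rfl, a₃.2 aSp rfl] at hside
        omega
      have h2 := hdm₃ c hcq
      obtain ⟨c', hc'q, h3, h4⟩ := hdm₃' (s₂.a aSp c) (by omega)
      obtain ⟨-, j, -, h5⟩ := hS₂.good c (hvis₂ c hcq)
      obtain ⟨-, j', -, h6⟩ := hS₂.good c' (hvis₂ c' hc'q)
      obtain rfl : j = j' := by omega
      have hX' : ¬ X c' := by
        rcases h5 with h5 | h5 <;> rcases h6 with h6 | h6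
        · omega
        · tauto
        · tauto
        · omega
      have := hdeg c' hc'q hX'
      omega
    · rw [← hcK]; exact hdeg c hcq hX
  have hKn : K ≤ n := by
    by_cases hK0 : K = 0
    · omega
    obtain ⟨c, hcY, hcK⟩ := hP₄' hK0
    rw [← hcK]
    exact hN₁.fl_le (((hY₄ c).1 hcY).1.trans_le hqn)
  have hYq : ∀ y, s₄.a aY y ≠ 0 → y < q := fun y hy => ((hY₄ y).1 hy).1
  have hK₄ : ∀ c < q, s₄.a aY c ≠ 0 → s₄.a aFl c ≤ K := by
    intro c _ hc
    rw [eFl₄]; exact hP₄ c hc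
  have hhl₄ : ∀ c < q, s₄.a aHl c = s₄.a aFl c := by
    intro c hcq
    rw [a₄.2 aHl rfl, eFl₄]; exact hhl₃ c hcq
  have eQ₄ : s₄.v vQ = q := by
    rw [a₄.1 vQ rfl, a₃.1 vQ rfl, a₂.1 vQ rfl, a₁.1 vQ rfl, hc.vQ]
  have hrow₄ : ∀ c < n, s₄.a aRow c = c * n := by
    rw [a₄.2 aRow rfl, a₃.2 aRow rfl, a₂.2 aRow rfl]; exact hrow₁
  rw [runs_seq]
  refine fillPhase_runs hqn eQ₄ hrow₄ hN₄ hhl₄ hK₄ ?_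
  intro s₅ T₅ a₅ hN₅ hpre hT₅
  have eY₅ : s₅.a aY = s₄.a aY := a₅.2 aY rfl
  set F : ℕ → ℕ → Prop := fun a b => H a b ∨ Share H (fun y => s₅.a aY y ≠ 0) a b with hFdef
  have hN₅' : NbrLists s₅ n F := hN₅.congr rfl rfl rfl fun a b => by
    simp only [hFdef, Share, ShareBelow, eY₅]
    refine or_congr_right (and_congr_right fun _ => exists_congr fun y => ?_)
    constructor
    · exact fun h => ⟨hYq y h.1, h⟩
    · exact fun h => h.2
  have hF₅ : FillGraph s₅ n q K (2 * d ^ 2) F :=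
    hcv.fillGraph hqn (by rw [eY₅]; exact hY) hN₄ (by rw [eY₅]; exact hK₄) hKd
      (by rw [eY₅]; exact hYq) hN₅' hpre (by rw [a₅.2 aHl rfl]; exact hhl₄)
  have hFlt : ∀ a b, F a b → a < q ∧ b < q := by
    rintro a b (h | ⟨-, y, -, h1, h2⟩)
    · exact hcv.lt _ _ h
    · exact ⟨(hcv.lt _ _ h1).2, (hcv.lt _ _ h2).2⟩
  have hFsym : ∀ a b, F a b → F b a := by
    rintro a b (h | h)
    · exact Or.inl (hcv.symm _ _ h)
    · exact Or.inr h.symm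
  have hFirr : ∀ a, ¬ F a a := by
    rintro a (h | h)
    · exact hHirr a h
    · exact h.1 rfl
  rw [runs_seq]
  have eL₅ : s₅.v vEll = ell := by
    rw [a₅.1 vEll rfl, a₄.1 vEll rfl, a₃.1 vEll rfl, a₂.1 vEll rfl, a₁.1 vEll rfl, hell]
  have eP₅ : s₅.v vP = K := a₅.1 vP rfl
  have eQ₅ : s₅.v vQ = q := by rw [a₅.1 vQ rfl, eQ₄]
  refine tablePhase_runs hell2 eL₅ eP₅ eQ₅ ?_
  intro s₆ T₆ a₆ hpw hrem hquot hmul htb hT₆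
  rw [runs_seq, runs_set]
  simp only [AExp.eval, AExp.cost]
  set s₇ := s₆.set vAns 1 with hs₇
  have a₇ : Agree (.set vAns (.lit 1)) s₆ s₇ :=
    ⟨fun x hx => by
      simp only [Cmd.wv, decide_eq_false_iff_not] at hx
      simp [hs₇, hx], fun _ _ => rfl⟩
  -- arrays and variables that are not changed between the classes and the elimination
  have eA : ∀ b : Arr, edgePhase.wa b = false → sidePhase.wa b = false →
      degreePhase.wa b = false → choosePhase.wa b = false → fillPhase.wa b = false →
      tablePhase.wa b = false → s₇.a b = s.a b := by
    intro b h1 h2 h3 h4 h5 h6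
    rw [a₇.2 b rfl, a₆.2 b h6, a₅.2 b h5, a₄.2 b h4, a₃.2 b h3, a₂.2 b h2, a₁.2 b h1]
  have eFn₇ : s₇.a aFn = s₅.a aFn := by rw [a₇.2 aFn rfl, a₆.2 aFn rfl]
  have eFl₇ : s₇.a aFl = s₅.a aFl := by rw [a₇.2 aFl rfl, a₆.2 aFl rfl]
  have eSz₇ := eA aSz rfl rfl rfl rfl rfl rfl
  have eMem₇ := eA aMem rfl rfl rfl rfl rfl rfl
  have eG₇ : s₇.a aGadj = s₁.a aGadj := by
    rw [a₇.2 aGadj rfl, a₆.2 aGadj rfl, a₅.2 aGadj rfl, a₄.2 aGadj rfl, a₃.2 aGadj rfl,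
      a₂.2 aGadj rfl]
  have eY₇ : s₇.a aY = s₄.a aY := by rw [a₇.2 aY rfl, a₆.2 aY rfl, eY₅]
  have hmemlt : ∀ c, ∀ i < s.a aSz c, row (s.a aMem) n c i < n ∧
      s.a aCid (row (s.a aMem) n c i) = c := fun c i hi =>
    (hc.mem c _).1 (mem_arrList.2 ⟨i, hi, rfl⟩)
  have he₇ : Env s₇ n q ell K F := by
    constructor
    · rw [a₇.1 vQ rfl, a₆.1 vQ rfl, eQ₅]
    · exact hqn
    · exact hKn
    · exact hell2
    · rw [eA aRow rfl rfl rfl rfl rfl rfl]; exact hc.rowA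
    · intro c _
      rw [eSz₇, ← hell]; exact hc.sz_le c
    · intro c _
      rw [eSz₇, eMem₇]; exact fun i hi => (hmemlt c i hi).1
    · intro c hcq
      rw [eFl₇]; exact hN₅'.fl_le (hcq.trans_le hqn)
    · intro c hcq
      rw [eFl₇, eFn₇]; exact hN₅'.nodup c (hcq.trans_le hqn)
    · intro c hcq
      rw [eFl₇, eFn₇]; exact hN₅'.mem c (hcq.trans_le hqn)
    · exact hFlt
    · exact hFsym
    · exact hFirr
    · exact hpw
    · exact hrem
    · exact hquot
    · exact hmul
    · exact htb
  have hF₇ : FillGraph s₇ n q K (2 * d ^ 2) F := (hF₅.agree a₆ rfl).agree a₇ rfl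
  have hD₇ : ∀ c, s₇.a aDead c = 0 := by
    rw [eA aDead rfl rfl rfl rfl rfl rfl]; exact hz aDead (by simp)
  have hI₇ : ElimInv s₇ n q ell K F := elimInv_init hD₇
    (by rw [eA aCl rfl rfl rfl rfl rfl rfl]; exact hz aCl (by simp))
    (by rw [eA aUpl rfl rfl rfl rfl rfl rfl]; exact hz aUpl (by simp)) (by simp [hs₇])
  rw [runs_seq]
  refine elimPhaseY_runs he₇ hF₇ hI₇ hD₇ ?_
  intro s₈ T₈ a₈ hI₈ hD₈ hT₈
  have he₈ := he₇.agree a₈ rfl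
  have hF₈ := hF₇.agree a₈ rfl
  rw [runs_seq]
  refine pushPhase_runs he₈.vQ ?_
  intro s₉ T₉ a₉ htop hS₉ hT₉
  have he₉ := he₈.agree a₉ rfl
  have hF₉ := hF₈.agree a₉ rfl
  have hI₉ := hI₈.congr a₉ rfl rfl
  have eY₈ : s₈.a aY = s₇.a aY := a₈.2 aY rfl
  have eY₉ : s₉.a aY = s₇.a aY := by rw [a₉.2 aY rfl, eY₈]
  rw [runs_seq]
  refine elimPhaseX_runs he₉ hF₉ hI₉ (by rw [a₉.2 aDead rfl, eY₉]; exact hD₈)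
    (by rw [eY₉, ← eY₈]; exact hS₉) ?_
  intro s₁₀ T₁₀ a₁₀ hI₁₀ hD₁₀ hT₁₀
  have he₁₀ := he₉.agree a₁₀ rfl
  have eSz : s₁₀.a aSz = s.a aSz := by rw [a₁₀.2 aSz rfl, a₉.2 aSz rfl, a₈.2 aSz rfl, eSz₇]
  have eMem : s₁₀.a aMem = s.a aMem := by
    rw [a₁₀.2 aMem rfl, a₉.2 aMem rfl, a₈.2 aMem rfl, eMem₇]
  have eG : s₁₀.a aGadj = s₁.a aGadj := by
    rw [a₁₀.2 aGadj rfl, a₉.2 aGadj rfl, a₈.2 aGadj rfl, eG₇]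
  have eY : s₁₀.a aY = s₄.a aY := by rw [a₁₀.2 aY rfl, eY₉, eY₇]
  have hsz : ∀ c < q, 0 < s.a aSz c := by
    intro c hcq
    obtain ⟨u, hu, huc⟩ := hc.surj c hcq
    obtain ⟨i, hi, -⟩ := mem_arrList.1 ((hc.mem c u).2 ⟨hu, huc⟩)
    omega
  rw [runs_set]
  simp only [AExp.eval, AExp.cost]
  refine post _ _ ?_ ?_
  · rw [St.set_v, if_pos rfl, hI₁₀.ans_iff he₁₀ hD₁₀ (by rw [eSz]; exact hsz), eSz, eY]
    simp only [Compat, eG, eMem]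
    constructor
    · rintro ⟨a, ha, hcomp⟩
      have hval : ∀ c < q, row (s.a aMem) n c (a c) < n ∧
          s.a aCid (row (s.a aMem) n c (a c)) = c := fun c hcq => hmemlt c _ (ha c hcq)
      refine ⟨fun c => row (s.a aMem) n c (a c), hval, fun c z hcz => ?_⟩
      obtain ⟨hcq, hzq⟩ := hcv.lt _ _ hcz
      by_cases hYc : s₄.a aY c ≠ 0
      · exact (hG₁ _ (hval c hcq).1 _ (hval z hzq).1).1 (hcomp c z hYc (Or.inl hcz))
      · have hYz : s₄.a aY z ≠ 0 := by
          intro h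
          exact hYc ((hY _ _ hcz).2 (not_not.2 h))
        exact HasEdge.symm ((hG₁ _ (hval z hzq).1 _ (hval c hcq).1).1
          (hcomp z c hYz (Or.inl (hcv.symm _ _ hcz))))
    · rintro ⟨a, ha, hcomp⟩
      have hidx : ∀ c, ∃ i, c < q → i < s.a aSz c ∧ row (s.a aMem) n c i = a c := by
        intro c
        by_cases hcq : c < q
        · obtain ⟨i, hi, h⟩ := mem_arrList.1 ((hc.mem c _).2 (ha c hcq))
          exact ⟨i, fun _ => ⟨hi, h⟩⟩
        · exact ⟨0, fun h => absurd h hcq⟩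
      choose i hi using hidx
      refine ⟨i, fun c hcq => (hi c hcq).1, fun c z hYc hF => ?_⟩
      have hcz : H c z := by
        refine hF.resolve_right fun h => ?_
        obtain ⟨-, y, hy, h1, -⟩ := h
        rw [eY₅] at hy
        exact (hY _ _ h1).1 hy hYc
      obtain ⟨hcq, hzq⟩ := hcv.lt _ _ hcz
      rw [(hi c hcq).2, (hi z hzq).2]
      exact (hG₁ _ (ha c hcq).1 _ (ha z hzq).1).2 (hcomp c z hcz)
  · have hfl : ∀ v ∈ Finset.range q, s₅.a aFl v ≤ s₁.a aFl v + 2 * d ^ 2 := by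
      intro v hv
      have hvq := Finset.mem_range.1 hv
      by_cases hYv : s₅.a aY v = 0
      · have := hF₅.fl_le v hvq hYv
        rwa [a₅.2 aHl rfl, hhl₄ v hvq, eFl₄] at this
      · have h1 := hF₅.deg v hvq hYv
        have h2 : d ≤ d ^ 2 := Nat.le_self_pow two_ne_zero d
        omega
    set S := ∑ c ∈ Finset.range q, s₁.a aFl c with hS
    have hSle : S ≤ 2 * (q * d) := hcv.sum_degree_le hN₁ hqn
    have hflsum : ∑ v ∈ Finset.range q, s₅.a aFl v ≤ S + q * (2 * d ^ 2) := by
      refine (Finset.sum_le_sum hfl).trans ?_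
      simp [Finset.sum_add_distrib, hS]
    have hszsum : ∑ v ∈ Finset.range q, s.a aSz v ≤ n := by
      have h1 : ∑ v ∈ Finset.range q,
          ((Finset.range n).filter fun u => s.a aCid u = v).card = n := by
        rw [← Finset.card_eq_sum_card_fiberwise (f := s.a aCid) (s := Finset.range n)
          (t := Finset.range q)]
        · simp
        · intro u hu
          simpa using hc.cid_lt u (by simpa using hu)
      simp only [hc.sz]
      exact h1.le
    set E₁ := ell ^ max K 1 * (80 * max K 1 + 120) with hE₁
    have hcostY : ∑ v ∈ Finset.range q, nodeCost s₇ ell K v ≤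
        (S + q * (2 * d ^ 2)) * 50 + E₁ * (2 * n) + q * 100 := by
      have h1 : ∀ v, nodeCost s₇ ell K v = s₅.a aFl v * 50 + E₁ * (s.a aSz v + 1) + 100 := by
        intro v
        rw [nodeCost, eFl₇, eSz₇, hE₁]; ring
      simp only [h1, Finset.sum_add_distrib, ← Finset.sum_mul, ← Finset.mul_sum, Finset.sum_const,
        Finset.card_range, smul_eq_mul, mul_one]
      have h2 := Nat.mul_le_mul_right 50 hflsum
      have h3 : E₁ * (∑ v ∈ Finset.range q, s.a aSz v + q) ≤ E₁ * (2 * n) :=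
        Nat.mul_le_mul_left _ (by omega)
      omega
    have hcostX : ∑ v ∈ Finset.range q, nodeCostX s₉ ell K (2 * d ^ 2) v ≤
        (S + q * (2 * d ^ 2)) * 50 + E₁ * n + q * 100 +
          (popCost (2 * d ^ 2) + 30) * max K 1 * q := by
      have e₉ : s₉.a aFl = s₅.a aFl := by rw [a₉.2 aFl rfl, a₈.2 aFl rfl, eFl₇]
      have h1 : ∀ v, nodeCostX s₉ ell K (2 * d ^ 2) v = s₅.a aFl v * 50 + (E₁ + 100 +
          (popCost (2 * d ^ 2) + 30) * max K 1) := by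
        intro v
        rw [nodeCostX, e₉, hE₁]; ring
      generalize (popCost (2 * d ^ 2) + 30) * max K 1 = R at h1 ⊢
      simp only [h1, Finset.sum_add_distrib, ← Finset.sum_mul, Finset.sum_const,
        Finset.card_range, smul_eq_mul]
      have h2 := Nat.mul_le_mul_right 50 hflsum
      have h3 : q * E₁ ≤ E₁ * n := by rw [mul_comm]; exact Nat.mul_le_mul_left _ hqn
      rw [mul_comm q R]
      omega
    have hm' := card_edges_le hc heu hev hinj hcv
    rw [hell] at hm'
    have htime := mainPhase_time hqn hn hKd hKn hell2 hm' hSle rfl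
    have hpop : popCost (2 * d ^ 2) * s₉.v vTop ≤ popCost (2 * d ^ 2) * q :=
      Nat.mul_le_mul_left _ htop
    have hsplit : (popCost (2 * d ^ 2) + 30) * (max K 1 + 1) * q =
        (popCost (2 * d ^ 2) + 30) * max K 1 * q + popCost (2 * d ^ 2) * q + 30 * q := by ring
    have hsplit2 : q * (K * (K * 80 + 30) + 40) = q * (K * (K * 80 + 30)) + q * 40 := by ring
    have hsplit3 : E₁ * (3 * n) = E₁ * (2 * n) + E₁ * n := by ring
    rw [← hE₁] at htime
    rw [hsplit, hsplit3] at htime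
    rw [hsplit2] at hT₅
    omega

/-! ### Colored graphs in the memory of the machine -/

/-- The state of the structured language that represents the input. -/
def ColoredGraph.initSt (I : ColoredGraph) : St :=
  ⟨fun x => I.toState.reg x.ctorIdx, fun b => I.toState.arr b.ctorIdx⟩

/-- The state `s`, reached from the initial one for the colored graph `I`, holds the list of edges,
and `aCid` gives equal numbers exactly to the vertices of the same color. -/
structure Numbered (I : ColoredGraph) (s : St) (q : ℕ) : Prop extends Classes s I.n q where
  edge₁ : ∀ e (he : e < I.edges.length), s.a aEu e = (I.edges[e]'he).1
  edge₂ : ∀ e (he : e < I.edges.length), s.a aEv e = (I.edges[e]'he).2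
  cid_eq : ∀ u v : Fin I.n, s.a aCid u = s.a aCid v ↔ I.color u = I.color v

namespace Numbered

variable {I : ColoredGraph} {s : St} {q : ℕ}

theorem edge_lt (h : Numbered I s q) {e : ℕ} (he : e < I.edges.length) :
    s.a aEu e < I.n ∧ s.a aEv e < I.n := by
  rw [h.edge₁ e he, h.edge₂ e he]
  exact ⟨Fin.isLt _, Fin.isLt _⟩

theorem edge_inj (h : Numbered I s q) {e e' : ℕ} (he : e < I.edges.length)
    (he' : e' < I.edges.length) (heq : (s.a aEu e = s.a aEu e' ∧ s.a aEv e = s.a aEv e') ∨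
      (s.a aEu e = s.a aEv e' ∧ s.a aEv e = s.a aEu e')) : e = e' := by
  rw [h.edge₁ e he, h.edge₂ e he, h.edge₁ e' he', h.edge₂ e' he'] at heq
  simp only [Fin.val_inj] at heq
  have h1 := List.Nodup.getElem_inj_iff I.edges_nodup (i := e) (j := e')
    (hi := by simpa using he) (hj := by simpa using he')
  rw [← h1, List.getElem_map, List.getElem_map]
  exact Sym2.eq_iff.2 heq

theorem hasEdge_iff (h : Numbered I s q) (u v : Fin I.n) :
    HasEdge s I.edges.length u v ↔ I.graph.Adj u v := by
  rw [← SimpleGraph.mem_edgeSet, ← I.mem_edges, List.mem_map]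
  constructor
  · rintro ⟨e, he, h1⟩
    rw [h.edge₁ e he, h.edge₂ e he] at h1
    simp only [Fin.val_inj] at h1
    exact ⟨_, List.getElem_mem he, Sym2.eq_iff.2 h1⟩
  · rintro ⟨p, hp, h1⟩
    obtain ⟨e, he, rfl⟩ := List.mem_iff_getElem.1 hp
    refine ⟨e, he, ?_⟩
    rw [h.edge₁ e he, h.edge₂ e he]
    simp only [Fin.val_inj]
    exact Sym2.eq_iff.1 h1

theorem hasEdge_lt (h : Numbered I s q) {u v : ℕ} (huv : HasEdge s I.edges.length u v) :
    u < I.n ∧ v < I.n := by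
  obtain ⟨e, he, ⟨rfl, rfl⟩ | ⟨rfl, rfl⟩⟩ := huv
  · exact h.edge_lt he
  · exact (h.edge_lt he).symm

/-- The nodes of the cluster graph and the numbers of the classes correspond to each other. -/
theorem clusterEdge_iff (h : Numbered I s q) (u v : Fin I.n) :
    ClusterEdge s I.edges.length (s.a aCid u) (s.a aCid v) ↔
      (clusterGraph I.graph I.color).Adj ⟨I.color u, Set.mem_range_self u⟩
        ⟨I.color v, Set.mem_range_self v⟩ := by
  constructor
  · rintro ⟨hne, u', v', huv, h1, h2⟩
    obtain ⟨hu', hv'⟩ := h.hasEdge_lt huv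
    have h3 := (h.cid_eq ⟨u', hu'⟩ u).1 h1
    have h4 := (h.cid_eq ⟨v', hv'⟩ v).1 h2
    refine ⟨fun h5 => hne ((h.cid_eq u v).2 (Subtype.mk.inj h5)), ⟨u', hu'⟩, ⟨v', hv'⟩,
      (h.hasEdge_iff _ _).1 huv, h3, h4⟩
  · rintro ⟨hne, u', v', huv, h1, h2⟩
    refine ⟨fun h5 => hne (Subtype.ext ((h.cid_eq u v).1 h5)), u', v', (h.hasEdge_iff _ _).2 huv,
      (h.cid_eq _ _).2 h1, (h.cid_eq _ _).2 h2⟩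

theorem exists_rep (h : Numbered I s q) (hn : 0 < I.n) :
    ∃ rep : ℕ → Fin I.n, ∀ c < q, s.a aCid (rep c) = c := by
  have : ∀ c, ∃ v : Fin I.n, c < q → s.a aCid v = c := by
    intro c
    by_cases hc : c < q
    · obtain ⟨u, hu, huc⟩ := h.surj c hc
      exact ⟨⟨u, hu⟩, fun _ => huc⟩
    · exact ⟨⟨0, hn⟩, fun h => absurd h hc⟩
  choose rep hrep using this
  exact ⟨rep, hrep⟩

/-- A realization selects a vertex from each class such that adjacent classes have adjacent
vertices; no other edges can join the selected vertices, by the definition of the cluster graph. -/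
theorem hasRealization_iff (h : Numbered I s q) (hn : 0 < I.n) :
    HasRealization I.graph I.color ↔ ∃ a : ℕ → ℕ, (∀ c < q, a c < I.n ∧ s.a aCid (a c) = c) ∧
      ∀ c z, ClusterEdge s I.edges.length c z → HasEdge s I.edges.length (a c) (a z) := by
  obtain ⟨rep, hrep⟩ := h.exists_rep hn
  constructor
  · rintro ⟨S, hS, hiso⟩
    have hex : ∀ c, ∃ u, u ∈ S ∧ I.color u = I.color (rep c) := fun c =>
      (hS _ (Set.mem_range_self (rep c))).exists
    choose a ha hac using hex
    have hcid : ∀ c < q, s.a aCid (a c) = c := fun c hc => by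
      rw [(h.cid_eq (a c) (rep c)).2 (hac c), hrep c hc]
    refine ⟨fun c => a c, fun c hc => ⟨(a c).isLt, hcid c hc⟩, fun c z hcz => ?_⟩
    have hlt : c < q ∧ z < q := by
      obtain ⟨-, u, v, huv, rfl, rfl⟩ := hcz
      exact ⟨h.cid_lt u (h.hasEdge_lt huv).1, h.cid_lt v (h.hasEdge_lt huv).2⟩
    rw [← hcid c hlt.1, ← hcid z hlt.2, h.clusterEdge_iff] at hcz
    exact (h.hasEdge_iff _ _).2 ((hiso _ (ha c) _ (ha z)).2 hcz)
  · rintro ⟨a, ha, hedge⟩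
    have hlt : ∀ v : Fin I.n, s.a aCid v < q := fun v => h.cid_lt v v.isLt
    refine ⟨{v | a (s.a aCid v) = v}, ?_, ?_⟩
    · rintro _ ⟨v, rfl⟩
      obtain ⟨h1, h2⟩ := ha _ (hlt v)
      refine ⟨⟨a (s.a aCid v), h1⟩, ⟨by simp only [Set.mem_ofPred_eq, h2], ?_⟩, ?_⟩
      · exact (h.cid_eq ⟨_, h1⟩ v).1 h2
      · rintro u ⟨hu, huv⟩
        apply Fin.ext
        rw [Set.mem_ofPred_eq, (h.cid_eq u v).2 huv] at hu
        exact hu.symm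
    · intro u hu v hv
      rw [Set.mem_ofPred_eq] at hu hv
      rw [← h.clusterEdge_iff]
      constructor
      · intro huv
        refine ⟨fun h1 => huv.ne (Fin.ext ?_), u, v, (h.hasEdge_iff u v).2 huv, rfl, rfl⟩
        rw [← hu, h1, hv]
      · intro huv
        have := hedge _ _ huv
        rw [hu, hv] at this
        exact (h.hasEdge_iff u v).1 this

theorem vEll_eq (h : Numbered I s q) : s.v vEll = clusterSize I.color := by
  classical
  have hsz : ∀ v : Fin I.n, s.a aSz (s.a aCid v) =
      (Finset.univ.filter fun u => I.color u = I.color v).card := by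
    intro v
    rw [h.sz]
    refine Finset.card_bij' (fun u hu => (⟨u, by simp at hu; exact hu.1⟩ : Fin I.n))
      (fun u _ => (u : ℕ)) ?_ ?_ ?_ ?_
    · intro u hu
      simp only [Finset.mem_filter, Finset.mem_range] at hu
      simp only [Finset.mem_filter, Finset.mem_univ, true_and]
      exact (h.cid_eq ⟨u, hu.1⟩ v).1 hu.2
    · intro u hu
      simp only [Finset.mem_filter, Finset.mem_univ, true_and] at hu
      simp only [Finset.mem_filter, Finset.mem_range]
      exact ⟨u.isLt, (h.cid_eq u v).2 hu⟩
    · intro u hu; rfl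
    · intro u hu; rfl
  refine le_antisymm ?_ ?_
  · rcases h.ell with h0 | ⟨c, hc, h1⟩
    · omega
    · obtain ⟨u, hu, rfl⟩ := h.surj c hc
      rw [← h1, hsz ⟨u, hu⟩]
      exact Finset.le_sup (f := fun v => (Finset.univ.filter fun u => I.color u = I.color v).card)
        (Finset.mem_univ _)
  · refine Finset.sup_le fun v _ => ?_
    rw [← hsz v]
    exact h.sz_le _

end Numbered

/-- The class numbers inherit the convex bipartite structure of the cluster graph. -/
theorem ConvexColoredGraph.exists_convexNodes (I : ConvexColoredGraph) {s : St} {q : ℕ}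
    (h : Numbered I.toColoredGraph s q) (hn : 0 < I.n) :
    ∃ X pos, ConvexNodes q I.d (ClusterEdge s I.edges.length) X pos := by
  classical
  obtain ⟨rep, hrep⟩ := h.exists_rep hn
  obtain ⟨hbip, α, x, hx⟩ := I.convex
  let node : ℕ → Set.range I.color := fun c => ⟨I.color (rep c), Set.mem_range_self _⟩
  have hlt : ∀ a b, ClusterEdge s I.edges.length a b → a < q ∧ b < q := by
    rintro _ _ ⟨-, u, v, huv, rfl, rfl⟩
    exact ⟨h.cid_lt u (h.hasEdge_lt huv).1, h.cid_lt v (h.hasEdge_lt huv).2⟩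
  have hadj : ∀ a b, a < q → b < q → (ClusterEdge s I.edges.length a b ↔
      (clusterGraph I.graph I.color).Adj (node a) (node b)) := by
    intro a b ha hb
    have := h.clusterEdge_iff (rep a) (rep b)
    rwa [hrep a ha, hrep b hb] at this
  have hadj' : ∀ a b, ClusterEdge s I.edges.length a b →
      (clusterGraph I.graph I.color).Adj (node a) (node b) := fun a b hab =>
    (hadj a b (hlt a b hab).1 (hlt a b hab).2).1 hab
  have hinj : ∀ a b, a < q → b < q → node a = node b → a = b := by
    intro a b ha hb hab
    rw [← hrep a ha, ← hrep b hb, h.cid_eq]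
    exact Subtype.mk.inj hab
  have hmem : ∀ a b, ClusterEdge s I.edges.length a b → (node a ∈ I.X ↔ ¬ node b ∈ I.X) := by
    intro a b hab
    rcases hbip.mem_of_adj (hadj' a b hab) with ⟨h1, h2⟩ | ⟨h1, h2⟩
    · exact ⟨fun _ => h2, fun _ => h1⟩
    · exact ⟨fun h3 => absurd h3 h1, fun h3 => absurd h2 h3⟩
  refine ⟨fun c => node c ∈ I.X,
    fun c => if hc : node c ∈ I.X then x.symm ⟨node c, hc⟩ else 0, hlt, ?_, hmem, ?_, ?_⟩
  · rintro a b ⟨hne, u, v, huv, h1, h2⟩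
    exact ⟨hne.symm, v, u, huv.symm, h2, h1⟩
  · intro y a b c hy hya hyc hb hbX h1 h2
    have haX : node a ∈ I.X := by
      by_contra hn
      exact hy ((hmem y a hya).2 hn)
    have hcX : node c ∈ I.X := by
      by_contra hn
      exact hy ((hmem y c hyc).2 hn)
    have hbX' : node b ∈ I.X := hbX
    simp only [haX, hbX', hcX, dif_pos, Fin.val_fin_le] at h1 h2
    have := hx (node y) hy _ _ _ h1 h2 (by simpa using hadj' y a hya) (by simpa using hadj' y c hyc)
    rw [hadj y b (hlt y a hya).1 hb]
    simpa using this
  · intro y hy S hS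
    have h1 : S.card = (S.image node).card := by
      rw [Finset.card_image_of_injOn]
      exact fun a ha b hb hab => hinj a b (hlt _ _ (hS a ha)).2 (hlt _ _ (hS b hb)).2 hab
    have h2 : (S.image node).card ≤
        ((clusterGraph I.graph I.color).neighborSet (node y)).ncard := by
      rw [← Set.ncard_coe_finset]
      refine Set.ncard_le_ncard ?_ (Set.toFinite _)
      intro w hw
      obtain ⟨a, ha, rfl⟩ := Finset.mem_image.1 (Finset.mem_coe.1 hw)
      exact hadj' y a (hS a ha)
    rw [h1]
    refine h2.trans ?_
    unfold ConvexColoredGraph.d spread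
    exact Finset.le_sup (f := fun y => ((clusterGraph I.graph I.color).neighborSet y).ncard)
      (by simpa using hy)

theorem hasRealization_of_clusterSize_le_one (I : ColoredGraph) (h : clusterSize I.color ≤ 1) :
    HasRealization I.graph I.color := by
  classical
  have hinj : ∀ u v, I.color u = I.color v → u = v := by
    intro u v huv
    have h1 : (Finset.univ.filter fun w => I.color w = I.color v).card ≤ 1 :=
      (Finset.le_sup (f := fun v => (Finset.univ.filter fun u => I.color u = I.color v).card)
        (Finset.mem_univ v)).trans h
    exact Finset.card_le_one.1 h1 u (by simpa using huv) v (by simp)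
  refine ⟨Set.univ, ?_, ?_⟩
  · rintro _ ⟨v, rfl⟩
    exact ⟨v, ⟨trivial, rfl⟩, fun u hu => hinj u v hu.2⟩
  · intro u _ v _
    constructor
    · intro huv
      exact ⟨fun h1 => huv.ne (hinj u v (Subtype.mk.inj h1)), u, v, huv, rfl, rfl⟩
    · rintro ⟨-, u', v', huv, h1, h2⟩
      rwa [hinj u' u h1, hinj v' v h2] at huv

/-- If all classes are singletons, then every edge of the cluster graph comes from an edge between
the only candidates, so the answer is yes. This case is separate because the analysis of the main
phase absorbs polynomials in `d` by `2 ^ d ≤ ℓ ^ d`. The bound has no term for the edges: their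
number is bounded in `card_edges_le`. -/
theorem mgrAlgorithm_runs (I : ConvexColoredGraph) :
    Runs mgrAlgorithm I.initSt fun s T => (s.v vN = 1 ↔ HasRealization I.graph I.color) ∧
      T ≤ 3000000 * (I.n * (max I.d 1 * I.ell ^ max I.d 1)) + 30 := by
  unfold mgrAlgorithm
  rw [runs_seq]
  have hN : I.initSt.v vN = I.n := rfl
  refine classPhase_runs hN rfl rfl rfl (fun _ => rfl) (fun _ => rfl) ?_
  intro s₁ T₁ q a₁ hc₁ hcid hT₁
  have hnum : Numbered I.toColoredGraph s₁ q := by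
    refine ⟨hc₁, fun e he => ?_, fun e he => ?_, fun u v => ?_⟩
    · rw [a₁.2 aEu rfl]
      exact dif_pos he
    · rw [a₁.2 aEv rfl]
      exact dif_pos he
    · rw [hcid u u.isLt v v.isLt]
      have h1 : ∀ w : Fin I.n, I.initSt.a aColor w = I.color w := fun w => dif_pos w.isLt
      rw [h1, h1]
  have hell : s₁.v vEll = I.ell := hnum.vEll_eq
  set W := max I.d 1 * I.ell ^ max I.d 1 with hW
  have hell_pos : 0 < I.n → 1 ≤ I.ell := by
    intro hn
    have h1 := hnum.sz_le (s₁.a aCid 0)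
    obtain ⟨i, hi, -⟩ := mem_arrList.1 ((hnum.mem (s₁.a aCid 0) 0).2 ⟨hn, rfl⟩)
    omega
  have hnW : I.n ≤ I.n * W := by
    rcases Nat.eq_zero_or_pos I.n with h0 | hn
    · simp [h0]
    · exact Nat.le_mul_of_pos_right _ (Nat.mul_pos (by omega) (Nat.pow_pos (hell_pos hn)))
  rw [runs_ite, runs_set]
  simp only [AExp.eval, AExp.cost, hell]
  refine ⟨fun hlt => ⟨?_, by omega⟩, fun hge => ?_⟩
  · rw [St.set_v, if_pos rfl]
    simp only [true_iff]
    exact hasRealization_of_clusterSize_le_one _ (Nat.lt_succ_iff.1 hlt)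
  · have hn : 0 < I.n := by
      by_contra h0
      have h1 := hnum.ell
      have h2 := hnum.le
      rw [hell] at h1
      rcases h1 with h1 | ⟨c, hc, -⟩ <;> omega
    obtain ⟨X, pos, hX⟩ := I.exists_convexNodes hnum hn
    refine mainPhase_runs hnum.toClasses hn hell (by omega) (m := I.edges.length)
      (by rw [a₁.1 vM rfl]; rfl) (fun e he => (hnum.edge_lt he).1) (fun e he => (hnum.edge_lt he).2)
      (fun e he e' he' => hnum.edge_inj he he') hX (by rw [a₁.1 vP rfl]; rfl) ?_ ?_
    · intro b hb i
      simp only [List.mem_cons, List.not_mem_nil, or_false] at hb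
      rcases hb with rfl | rfl | rfl | rfl | rfl | rfl | rfl | rfl | rfl
      · rw [a₁.2 aGadj rfl]; rfl
      · rw [a₁.2 aFadj rfl]; rfl
      · rw [a₁.2 aFl rfl]; rfl
      · rw [a₁.2 aSd rfl]; rfl
      · rw [a₁.2 aDm rfl]; rfl
      · rw [a₁.2 aY rfl]; rfl
      · rw [a₁.2 aDead rfl]; rfl
      · rw [a₁.2 aCl rfl]; rfl
      · rw [a₁.2 aUpl rfl]; rfl
    · intro s₂ T₂ hans hT₂
      rw [← hW] at hT₂
      exact ⟨hans.trans (hnum.hasRealization_iff hn).symm, by omega⟩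

/-- The compiled algorithm decides the problem within the stated time. -/
theorem decidesWithin_mgrAlgorithm (I : ConvexColoredGraph) :
    mgrAlgorithm.comp.DecidesWithin I.toState (HasRealization I.graph I.color)
      (3000000 * (I.n * (max I.d 1 * I.ell ^ max I.d 1)) + 30) := by
  obtain ⟨t, s, he, hans, ht⟩ := mgrAlgorithm_runs I
  obtain ⟨r, hr, hs⟩ := (Cmd.comp_exec_aux he).1 I.toState ⟨fun _ => rfl, fun _ => rfl⟩
  refine ⟨t, r, hr, ht, ?_⟩
  have h0 : r.reg 0 = s.v vN := hs.1 vN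
  rw [h0]
  exact hans

theorem computable_paramBound : Computable fun p : ℕ × ℕ =>
    3000000 * (max p.2 1 * p.1 ^ max p.2 1) + 30 := by
  have hpow : Primrec₂ fun a b : ℕ => a ^ b := by
    have h := Primrec.nat_rec (f := fun _ : ℕ => 1)
      (g := fun (a : ℕ) (p : ℕ × ℕ) => p.2 * a) (Primrec.const 1)
      (Primrec.nat_mul.comp (Primrec.snd.comp Primrec.snd) Primrec.fst).to₂
    refine h.of_eq fun a b => ?_
    induction b with
    | zero => rfl
    | succ b ih => rw [pow_succ, ← ih]
  have hmax : Primrec fun p : ℕ × ℕ => max p.2 1 :=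
    Primrec.nat_max.comp Primrec.snd (Primrec.const 1)
  exact (Primrec.nat_add.comp (Primrec.nat_mul.comp (Primrec.const 3000000)
    (Primrec.nat_mul.comp hmax (hpow.comp Primrec.fst hmax))) (Primrec.const 30)).to_comp

theorem mainTheorem7 :
    ∃ P : RamProgram,
      P.IsFPTAlgorithm convexMGR ∧
      ∃ C : ℕ, ∀ I : ConvexColoredGraph, 0 < I.n →
        P.DecidesWithin I.toColoredGraph.toState (HasRealization I.graph I.color)
          (C * ((I.n * max I.d 1 + I.ell ^ 2) * I.ell ^ max I.d 1)) := by
  refine ⟨mgrAlgorithm.comp, ⟨_, 1, computable_paramBound, fun I => ?_⟩, 3000030, fun I hn => ?_⟩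
  · obtain ⟨t, r, hr, ht, hans⟩ := decidesWithin_mgrAlgorithm I
    refine ⟨t, r, hr, ht.trans ?_, hans⟩
    have hs : convexMGR.size I = 2 + I.n + 2 * I.edges.length := rfl
    have hp : convexMGR.param I = (I.ell, I.d) := rfl
    rw [hs, hp, pow_one, mul_left_comm, add_mul]
    refine Nat.add_le_add ?_ (by omega)
    rw [mul_comm]
    exact Nat.mul_le_mul_left _ (by omega)
  · obtain ⟨t, r, hr, ht, hans⟩ := decidesWithin_mgrAlgorithm I
    refine ⟨t, r, hr, ht.trans ?_, hans⟩
    have hell : 1 ≤ I.ell := by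
      have h1 := Finset.le_sup (f := fun v => (Finset.univ.filter fun u =>
        I.color u = I.color v).card) (Finset.mem_univ (⟨0, hn⟩ : Fin I.n))
      refine le_trans ?_ h1
      exact Finset.card_pos.2 ⟨⟨0, hn⟩, by simp⟩
    have hpos : 1 ≤ I.n * (max I.d 1 * I.ell ^ max I.d 1) :=
      Nat.mul_pos hn (Nat.mul_pos (by omega) (Nat.pow_pos hell))
    have hle : I.n * (max I.d 1 * I.ell ^ max I.d 1) ≤
        (I.n * max I.d 1 + I.ell ^ 2) * I.ell ^ max I.d 1 := by
      rw [← mul_assoc]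
      exact Nat.mul_le_mul_right _ (by omega)
    omega
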